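/- Let $n>1$, let $Q,Q'_s,Q_p,Q'\subset\mathbb{R}$ be pairwise disjoint sets whose union $P=Q\cup Q'_s\cup Q_p\cup Q'$ is uniformly discrete (there is $d>0$ with $|p-q|\ge d$ for all distinct $p,q\in P$), and let $\alpha_q,\beta_q$ ($q\in P$) be real numbers. Let $H$ be the operator $f\mapsto -f''$ (weak derivatives on $\mathbb{R}\setminus P$) in $L^2(\mathbb{R},\mathbb{C}^n)$ on the functions $f=(f_1,\dots,f_n)\in W^{2,2}(\mathbb{R}\setminus P,\mathbb{C}^n)$ satisfying the following conditions. For $q\in P$ write $\Gamma_1 f=(f_1(q-),\dots,f_n(q-),f_1(q+),\dots,f_n(q+))\in\mathbb{C}^{2n}$ for the vector of boundary values and $\Gamma_2 f=(-f_1'(q-),\dots,-f_n'(q-),f_1'(q+),\dots,f_n'(q+))\in\mathbb{C}^{2n}$ for the vector of outward derivatives; indices $s,t$ run over $1,\dots,2n$. - ($\delta(q,\alpha_q)$ coupling) for $q\in Q$: all the numbers $(\Gamma_1f)_s$ equal one number $c$, and $\sum_{s}(\Gamma_2f)_s=\sum_{j=1}^n\big(f_j'(q+)-f_j'(q-)\big)=\alpha_q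 c$; - ($\delta'_s(q,\beta_q)$ coupling) for $q\in Q'_s$: all the numbers $(\Gamma_2f)_s$ equal one number $c$, and $\sum_{s}(\Gamma_1f)_s=\sum_{j=1}^n\big(f_j(q+)+f_j(q-)\big)=\beta_q c$; - ($\delta_p(q,\alpha_q)$ coupling) for $q\in Q_p$: $(\Gamma_2f)_s-(\Gamma_2f)_t=\frac{\alpha_q}{2n}\big((\Gamma_1f)_s-(\Gamma_1f)_t\big)$ for all $s,t$, and $\sum_{s}(\Gamma_1f)_s=0$; - ($\delta'(q,\beta_q)$ coupling) for $q\in Q'$: $(\Gamma_1f)_s-(\Gamma_1f)_t=\frac{\beta_q}{2n}\big((\Gamma_2f)_s-(\Gamma_2f)_t\big)$ for all $s,t$, and $\sum_{s}(\Gamma_2f)_s=0$. Then $H$ is self-adjoint and unitarily equivalent to the direct sum $\bigoplus_{k=1}^n H_k$ of self-adjoint operators $H_k$ in $L^2(\mathbb{R})$, defined as follows. The operator $H_1$ acts as $f\mapsto -f''$ on the functions $f\in W^{2,2}(\mathbb{R}\setminus P)$ satisfying \begin{align*} f(q-)=f(q+)&=:f(q),& f'(q+)-f'(q-)&=\tfrac{\alpha_q}{n}f(q),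 & q\in Q,\\ f'(q-)+f'(q+)&=0,& f(q-)+f(q+)&=\tfrac{\beta_q}{n}f'(q+), & q\in Q'_s,\\ f(q-)+f(q+)&=0,& f'(q-)+f'(q+)&=\tfrac{\alpha_q}{n}f(q+), & q\in Q_p,\\ f'(q-)=f'(q+)&=:f'(q),& f(q+)-f(q-)&=\tfrac{\beta_q}{n}f'(q), & q\in Q', \end{align*} and $H_2=\dots=H_n$ is the operator acting as $g\mapsto -g''$ on the functions $g\in W^{2,2}(\mathbb{R}\setminus P)$ satisfying \begin{gather*} g(q-)=g(q+)=0,\quad q\in Q,\qquad g'(q-)=g'(q+)=0,\quad q\in Q'_s,\\ \alpha_q g(q-)+2n\,g'(q-)=\alpha_q g(q+)-2n\,g'(q+)=0,\quad q\in Q_p,\\ 2n\,g(q-)+\beta_q g'(q-)=2n\,g(q+)-\beta_q g'(q+)=0,\quad q\in Q'. \end{gather*} -/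

import Mathlib

open MeasureTheory Filter Topology
open scoped ContDiff

noncomputable section

namespace CoupledChannels

/-- A set of reals is uniformly discrete if its distinct points keep a positive distance. -/
def UniformlyDiscrete (P : Set ℝ) : Prop :=
  ∃ d : ℝ, 0 < d ∧ ∀ p ∈ P, ∀ q ∈ P, p ≠ q → d ≤ |p - q|

/-- The Hilbert space `L²(ℝ, E)`. -/
abbrev L2 (E : Type*) [NormedAddCommGroup E] : Type _ := Lp E 2 (volume : Measure ℝ)

section PointInteractions

variable {E : Type*} [NormedAddCommGroup E] [InnerProductSpace ℂ E]

/-- `g` is the weak derivative of `f` on the open set `Ω` (`f`, `g` locally integrable). -/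
def IsWeakDeriv (Ω : Set ℝ) (f g : ℝ → E) : Prop :=
  ∀ φ : ℝ → ℝ, ContDiff ℝ ∞ φ → HasCompactSupport φ → tsupport φ ⊆ Ω →
    ∫ x, deriv φ x • f x = -∫ x, φ x • g x

/-- `f(q-) = a`, as an essential one-sided limit. It depends only on the a.e. class of `f`, and
for a function with a representative that is continuous to the left of `q` it is the
one-sided limit of this representative. -/
def HasLeftValue (f : ℝ → E) (q : ℝ) (a : E) : Prop :=
  Tendsto f (𝓝[<] q ⊓ ae volume) (𝓝 a)

/-- `f(q+) = a`, as an essential one-sided limit. -/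
def HasRightValue (f : ℝ → E) (q : ℝ) (a : E) : Prop :=
  Tendsto f (𝓝[>] q ⊓ ae volume) (𝓝 a)

/-- The boundary values `((f(q-), f(q+)), (f'(q-), f'(q+)))` at a point. -/
abbrev BoundaryValues (E : Type*) : Type _ := (E × E) × (E × E)

lemma IsWeakDeriv.add {Ω : Set ℝ} {f g f₁ g₁ F G : L2 E}
    (hf : IsWeakDeriv Ω f f₁) (hg : IsWeakDeriv Ω g g₁) (hF : F = f + g) (hG : G = f₁ + g₁) :
    IsWeakDeriv Ω F G := by
  subst hF hG
  intro φ hφ hc hs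
  have int : ∀ (ψ : ℝ → ℝ), Continuous ψ → HasCompactSupport ψ → ∀ u : L2 E,
      Integrable (fun x => ψ x • u x) := by
    intro ψ hψ hψc u
    exact ((Lp.memLp u).locallyIntegrable (by norm_num)).integrable_smul_left_of_hasCompactSupport
      hψ hψc
  have hd : Continuous (deriv φ) := hφ.continuous_deriv (by simp)
  have h1 : ∫ x, deriv φ x • (f + g : L2 E) x
      = (∫ x, deriv φ x • f x) + ∫ x, deriv φ x • g x := by
    rw [← integral_add (int _ hd hc.deriv f) (int _ hd hc.deriv g)]
    apply integral_congr_ae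
    filter_upwards [Lp.coeFn_add f g] with x hx
    rw [hx, Pi.add_apply, smul_add]
  have h2 : ∫ x, φ x • (f₁ + g₁ : L2 E) x = (∫ x, φ x • f₁ x) + ∫ x, φ x • g₁ x := by
    rw [← integral_add (int _ hφ.continuous hc f₁) (int _ hφ.continuous hc g₁)]
    apply integral_congr_ae
    filter_upwards [Lp.coeFn_add f₁ g₁] with x hx
    rw [hx, Pi.add_apply, smul_add]
  rw [h1, h2, hf φ hφ hc hs, hg φ hφ hc hs, neg_add]

lemma IsWeakDeriv.smul {Ω : Set ℝ} {f f₁ F G : L2 E} (c : ℂ)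
    (hf : IsWeakDeriv Ω f f₁) (hF : F = c • f) (hG : G = c • f₁) : IsWeakDeriv Ω F G := by
  subst hF hG
  intro φ hφ hc hs
  have h : ∀ (ψ : ℝ → ℝ) (u : L2 E), ∫ x, ψ x • (c • u : L2 E) x = c • ∫ x, ψ x • u x := by
    intro ψ u
    rw [← integral_smul]
    apply integral_congr_ae
    filter_upwards [Lp.coeFn_smul c u] with x hx
    rw [hx, Pi.smul_apply, smul_comm]
  rw [h, h, hf φ hφ hc hs, smul_neg]

lemma tendsto_ess_add {E : Type*} [NormedAddCommGroup E] {l : Filter ℝ} {f g : L2 E} {a b : E}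
    (hf : Tendsto f (l ⊓ ae volume) (𝓝 a)) (hg : Tendsto g (l ⊓ ae volume) (𝓝 b)) :
    Tendsto (f + g : L2 E) (l ⊓ ae volume) (𝓝 (a + b)) :=
  (hf.add hg).congr' (((Lp.coeFn_add f g).symm).filter_mono inf_le_right)

lemma tendsto_ess_smul {l : Filter ℝ} {f : L2 E} {a : E} (c : ℂ)
    (hf : Tendsto f (l ⊓ ae volume) (𝓝 a)) :
    Tendsto (c • f : L2 E) (l ⊓ ae volume) (𝓝 (c • a)) :=
  (hf.const_smul c).congr' (((Lp.coeFn_smul c f).symm).filter_mono inf_le_right)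

/-- The graph of the operator `f ↦ -f''` on the functions `f ∈ W^{2,2}(ℝ ∖ P, E)` whose boundary
values at every `q ∈ P` lie in the subspace `BC q`: it consists of the pairs `(f, -f'')`, where
`f`, its weak derivative `d = f'` on `ℝ ∖ P` and the weak derivative `f''` of `d` on `ℝ ∖ P`
are all in `L²(ℝ, E)`. -/
def pointInteractionGraph (P : Set ℝ) (BC : ℝ → Submodule ℂ (BoundaryValues E)) :
    Submodule ℂ (L2 E × L2 E) where
  carrier := {p | ∃ d : L2 E, IsWeakDeriv Pᶜ p.1 d ∧ IsWeakDeriv Pᶜ d (-p.2 : L2 E) ∧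
    ∀ q ∈ P, ∃ b ∈ BC q,
      HasLeftValue p.1 q b.1.1 ∧ HasRightValue p.1 q b.1.2 ∧
      HasLeftValue d q b.2.1 ∧ HasRightValue d q b.2.2}
  add_mem' := by
    rintro p r ⟨d, hd, hd', hb⟩ ⟨e, he, he', hc⟩
    refine ⟨d + e, hd.add he rfl rfl, hd'.add he' rfl (by simp [add_comm]), fun q hq => ?_⟩
    obtain ⟨b, hbm, h1, h2, h3, h4⟩ := hb q hq
    obtain ⟨c, hcm, k1, k2, k3, k4⟩ := hc q hq
    exact ⟨b + c, add_mem hbm hcm, tendsto_ess_add h1 k1, tendsto_ess_add h2 k2,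
      tendsto_ess_add h3 k3, tendsto_ess_add h4 k4⟩
  zero_mem' := by
    have h0 : ((0 : L2 E) : ℝ → E) =ᵐ[volume] 0 := Lp.coeFn_zero E 2 volume
    have hw : IsWeakDeriv Pᶜ (0 : L2 E) (0 : L2 E) := by
      intro φ _ _ _
      have h : ∀ ψ : ℝ → ℝ, ∫ x, ψ x • (0 : L2 E) x = 0 := by
        intro ψ
        rw [← integral_zero ℝ E]
        apply integral_congr_ae
        filter_upwards [h0] with x hx
        rw [hx, Pi.zero_apply, smul_zero]
      rw [h, h, neg_zero]
    have ht : ∀ l : Filter ℝ, Tendsto (0 : L2 E) (l ⊓ ae volume) (𝓝 (0 : E)) := fun l =>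
      tendsto_const_nhds.congr' ((h0.symm).filter_mono inf_le_right)
    refine ⟨0, hw, by simpa using hw, fun q _ => ⟨0, zero_mem _, ht _, ht _, ht _, ht _⟩⟩
  smul_mem' := by
    rintro c p ⟨d, hd, hd', hb⟩
    refine ⟨c • d, hd.smul c rfl rfl, hd'.smul c rfl (by simp), fun q hq => ?_⟩
    obtain ⟨b, hbm, h1, h2, h3, h4⟩ := hb q hq
    exact ⟨c • b, Submodule.smul_mem _ c hbm, tendsto_ess_smul c h1, tendsto_ess_smul c h2,
      tendsto_ess_smul c h3, tendsto_ess_smul c h4⟩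

/-- The graph is the graph of an operator: the weak derivatives are unique. -/
lemma pointInteractionGraph_snd_eq_zero {P : Set ℝ} (hP : UniformlyDiscrete P)
    (BC : ℝ → Submodule ℂ (BoundaryValues E)) [CompleteSpace E] (p : L2 E × L2 E)
    (hp : p ∈ pointInteractionGraph P BC) (h0 : p.1 = 0) : p.2 = 0 := by
  obtain ⟨d, hd0, hsep⟩ := hP
  have hcl : IsClosed P := by
    refine Metric.isClosed_of_pairwise_le_dist hd0 ?_
    intro x hx y hy hxy
    rw [Real.dist_eq]
    exact hsep x hx y hy hxy
  have hnull : volume P = 0 := by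
    refine Set.Countable.measure_zero ?_ _
    have : DiscreteTopology P := DiscreteTopology.of_forall_le_dist hd0 (by
      intro x y hxy
      rw [Subtype.dist_eq, Real.dist_eq]
      exact hsep x x.2 y y.2 (fun h => hxy (Subtype.ext h)))
    exact Set.countable_coe_iff.mp (TopologicalSpace.separableSpace_iff_countable.mp inferInstance)
  have key : ∀ f g : L2 E, f = 0 → IsWeakDeriv Pᶜ f g → g = 0 := by
    intro f g hf hg
    have hz : ∀ ψ : ℝ → ℝ, ∫ x, ψ x • f x = 0 := by
      intro ψ
      rw [← integral_zero ℝ E, hf]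
      apply integral_congr_ae
      filter_upwards [Lp.coeFn_zero E 2 (volume : Measure ℝ)] with x hx
      rw [hx, Pi.zero_apply, smul_zero]
    have hae := hcl.isOpen_compl.ae_eq_zero_of_integral_contDiff_smul_eq_zero
      (((Lp.memLp g).locallyIntegrable (by norm_num)).locallyIntegrableOn _)
      (fun φ h1 h2 h3 => by
        have := hg φ h1 h2 h3
        rw [hz] at this
        exact neg_eq_zero.mp this.symm)
    rw [Lp.eq_zero_iff_ae_eq_zero]
    filter_upwards [hae, measure_eq_zero_iff_ae_notMem.mp hnull] with x h1 h2
    exact h1 h2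
  obtain ⟨e, he, he', -⟩ := hp
  exact neg_eq_zero.mp (key e (-p.2) (key p.1 e h0 he) he')

/-- The unbounded operator `-d²/dx²` in `L²(ℝ, E)` on the functions of `W^{2,2}(ℝ ∖ P, E)` with
boundary conditions `BC q` at the points `q ∈ P`. -/
def pointInteraction (P : Set ℝ) (BC : ℝ → Submodule ℂ (BoundaryValues E)) :
    L2 E →ₗ.[ℂ] L2 E :=
  (pointInteractionGraph P BC).toLinearPMap

end PointInteractions

section Couplings

variable {n : ℕ}

/-- `Γ₁ f = (f(q-), f(q+))`, indexed by the `2n` half-channels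
(`Sum.inl j` is the left half of channel `j` and `Sum.inr j` the right half). -/
def Γ₁ (b : BoundaryValues (EuclideanSpace ℂ (Fin n))) : Fin n ⊕ Fin n → ℂ :=
  Sum.elim (fun j => b.1.1 j) (fun j => b.1.2 j)

/-- `Γ₂ f = (-f'(q-), f'(q+))`, the derivatives at `q` in the directions away from `q`. -/
def Γ₂ (b : BoundaryValues (EuclideanSpace ℂ (Fin n))) : Fin n ⊕ Fin n → ℂ :=
  Sum.elim (fun j => -b.2.1 j) (fun j => b.2.2 j)

lemma Γ₁_add (b c : BoundaryValues (EuclideanSpace ℂ (Fin n))) : Γ₁ (b + c) = Γ₁ b + Γ₁ c := by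
  funext s; cases s <;> simp [Γ₁]

lemma Γ₂_add (b c : BoundaryValues (EuclideanSpace ℂ (Fin n))) : Γ₂ (b + c) = Γ₂ b + Γ₂ c := by
  funext s; cases s <;> simp [Γ₂, add_comm]

lemma Γ₁_smul (a : ℂ) (b : BoundaryValues (EuclideanSpace ℂ (Fin n))) :
    Γ₁ (a • b) = a • Γ₁ b := by
  funext s; cases s <;> simp [Γ₁]

lemma Γ₂_smul (a : ℂ) (b : BoundaryValues (EuclideanSpace ℂ (Fin n))) :
    Γ₂ (a • b) = a • Γ₂ b := by
  funext s; cases s <;> simp [Γ₂]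

lemma Γ₁_zero : Γ₁ (0 : BoundaryValues (EuclideanSpace ℂ (Fin n))) = 0 := by
  funext s; cases s <;> simp [Γ₁]

lemma Γ₂_zero : Γ₂ (0 : BoundaryValues (EuclideanSpace ℂ (Fin n))) = 0 := by
  funext s; cases s <;> simp [Γ₂]

/-- `δ(q, α)`: all values `f_j(q±)` are equal, to `c` say, and
`∑ j, (f_j'(q+) - f_j'(q-)) = α c`. -/
def deltaCoupling (n : ℕ) (α : ℝ) : Submodule ℂ (BoundaryValues (EuclideanSpace ℂ (Fin n))) where
  carrier := {b | ∃ c : ℂ, (∀ s, Γ₁ b s = c) ∧ ∑ s, Γ₂ b s = α * c}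
  add_mem' := by
    rintro b b' ⟨c, h, k⟩ ⟨c', h', k'⟩
    refine ⟨c + c', fun s => by rw [Γ₁_add, Pi.add_apply, h, h'], ?_⟩
    simp only [Γ₂_add, Pi.add_apply, Finset.sum_add_distrib, k, k', mul_add]
  zero_mem' := ⟨0, by simp [Γ₁_zero], by simp [Γ₂_zero]⟩
  smul_mem' := by
    rintro a b ⟨c, h, k⟩
    refine ⟨a * c, fun s => by rw [Γ₁_smul, Pi.smul_apply, h, smul_eq_mul], ?_⟩
    simp only [Γ₂_smul, Pi.smul_apply, smul_eq_mul, ← Finset.mul_sum, k]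
    ring

/-- `δ'_s(q, β)`: all outward derivatives `-f_j'(q-)`, `f_k'(q+)` are equal, to `c` say, and
`∑ j, (f_j(q+) + f_j(q-)) = β c`. -/
def deltaPrimeSCoupling (n : ℕ) (β : ℝ) :
    Submodule ℂ (BoundaryValues (EuclideanSpace ℂ (Fin n))) where
  carrier := {b | ∃ c : ℂ, (∀ s, Γ₂ b s = c) ∧ ∑ s, Γ₁ b s = β * c}
  add_mem' := by
    rintro b b' ⟨c, h, k⟩ ⟨c', h', k'⟩
    refine ⟨c + c', fun s => by rw [Γ₂_add, Pi.add_apply, h, h'], ?_⟩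
    simp only [Γ₁_add, Pi.add_apply, Finset.sum_add_distrib, k, k', mul_add]
  zero_mem' := ⟨0, by simp [Γ₂_zero], by simp [Γ₁_zero]⟩
  smul_mem' := by
    rintro a b ⟨c, h, k⟩
    refine ⟨a * c, fun s => by rw [Γ₂_smul, Pi.smul_apply, h, smul_eq_mul], ?_⟩
    simp only [Γ₁_smul, Pi.smul_apply, smul_eq_mul, ← Finset.mul_sum, k]
    ring

/-- `δ_p(q, α)`: for any two half-channels the difference of the outward derivatives is `α / 2n`
times the difference of the values, and the sum of all values `f_j(q±)` vanishes. -/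
def deltaPCoupling (n : ℕ) (α : ℝ) : Submodule ℂ (BoundaryValues (EuclideanSpace ℂ (Fin n))) where
  carrier := {b | (∀ s t, Γ₂ b s - Γ₂ b t = (α / (2 * n) : ℂ) * (Γ₁ b s - Γ₁ b t)) ∧
    ∑ s, Γ₁ b s = 0}
  add_mem' := by
    rintro b b' ⟨h, k⟩ ⟨h', k'⟩
    refine ⟨fun s t => ?_, ?_⟩
    · simp only [Γ₁_add, Γ₂_add, Pi.add_apply]
      linear_combination h s t + h' s t
    · simp only [Γ₁_add, Pi.add_apply, Finset.sum_add_distrib, k, k', add_zero]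
  zero_mem' := ⟨by simp [Γ₁_zero, Γ₂_zero], by simp [Γ₁_zero]⟩
  smul_mem' := by
    rintro a b ⟨h, k⟩
    refine ⟨fun s t => ?_, ?_⟩
    · simp only [Γ₁_smul, Γ₂_smul, Pi.smul_apply, smul_eq_mul]
      linear_combination a * h s t
    · simp only [Γ₁_smul, Pi.smul_apply, smul_eq_mul, ← Finset.mul_sum, k, mul_zero]

/-- `δ'(q, β)`: for any two half-channels the difference of the values is `β / 2n` times the
difference of the outward derivatives, and `∑ j, (f_j'(q+) - f_j'(q-)) = 0`. -/
def deltaPrimeCoupling (n : ℕ) (β : ℝ) :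
    Submodule ℂ (BoundaryValues (EuclideanSpace ℂ (Fin n))) where
  carrier := {b | (∀ s t, Γ₁ b s - Γ₁ b t = (β / (2 * n) : ℂ) * (Γ₂ b s - Γ₂ b t)) ∧
    ∑ s, Γ₂ b s = 0}
  add_mem' := by
    rintro b b' ⟨h, k⟩ ⟨h', k'⟩
    refine ⟨fun s t => ?_, ?_⟩
    · simp only [Γ₁_add, Γ₂_add, Pi.add_apply]
      linear_combination h s t + h' s t
    · simp only [Γ₂_add, Pi.add_apply, Finset.sum_add_distrib, k, k', add_zero]
  zero_mem' := ⟨by simp [Γ₁_zero, Γ₂_zero], by simp [Γ₂_zero]⟩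
  smul_mem' := by
    rintro a b ⟨h, k⟩
    refine ⟨fun s t => ?_, ?_⟩
    · simp only [Γ₁_smul, Γ₂_smul, Pi.smul_apply, smul_eq_mul]
      linear_combination a * h s t
    · simp only [Γ₂_smul, Pi.smul_apply, smul_eq_mul, ← Finset.mul_sum, k, mul_zero]

end Couplings

section Hamiltonians

variable (n : ℕ) (Q Qs Qp Q' : Set ℝ) (α β : ℝ → ℝ)

open Classical in
/-- The Hamiltonian of `n` channels
`-d²/dx² + ∑_{q ∈ Q} δ(q, α_q) + ∑_{q ∈ Qs} δ'_s(q, β_q) + ∑_{q ∈ Qp} δ_p(q, α_q)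
+ ∑_{q ∈ Q'} δ'(q, β_q)` in `L²(ℝ, ℂⁿ)`. -/
def channelHamiltonian :
    L2 (EuclideanSpace ℂ (Fin n)) →ₗ.[ℂ] L2 (EuclideanSpace ℂ (Fin n)) :=
  pointInteraction (Q ∪ Qs ∪ Qp ∪ Q') fun q =>
    if q ∈ Q then deltaCoupling n (α q)
    else if q ∈ Qs then deltaPrimeSCoupling n (β q)
    else if q ∈ Qp then deltaPCoupling n (α q)
    else deltaPrimeCoupling n (β q)

/-- Boundary conditions of the scalar operator with couplings `δ`, `δ'_s`, `δ_p`, `δ'` at the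
points of `Q`, `Qs`, `Qp`, `Q'`, of strengths `α_q`, `β_q`. -/
def scalarBC (q : ℝ) : Submodule ℂ (BoundaryValues ℂ) where
  carrier := {((fL, fR), (dL, dR)) |
    (q ∈ Q → fL = fR ∧ dR - dL = α q * fR) ∧
    (q ∈ Qs → dL + dR = 0 ∧ fL + fR = β q * dR) ∧
    (q ∈ Qp → fL + fR = 0 ∧ dL + dR = α q * fR) ∧
    (q ∈ Q' → dL = dR ∧ fR - fL = β q * dR)}
  add_mem' := by
    rintro ⟨⟨a, b⟩, c, d⟩ ⟨⟨a', b'⟩, c', d'⟩ ⟨h1, h2, h3, h4⟩ ⟨k1, k2, k3, k4⟩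
    refine ⟨fun h => ?_, fun h => ?_, fun h => ?_, fun h => ?_⟩
    · exact ⟨by linear_combination (h1 h).1 + (k1 h).1, by linear_combination (h1 h).2 + (k1 h).2⟩
    · exact ⟨by linear_combination (h2 h).1 + (k2 h).1, by linear_combination (h2 h).2 + (k2 h).2⟩
    · exact ⟨by linear_combination (h3 h).1 + (k3 h).1, by linear_combination (h3 h).2 + (k3 h).2⟩
    · exact ⟨by linear_combination (h4 h).1 + (k4 h).1, by linear_combination (h4 h).2 + (k4 h).2⟩
  zero_mem' := by
    refine ⟨fun _ => ?_, fun _ => ?_, fun _ => ?_, fun _ => ?_⟩ <;> simp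
  smul_mem' := by
    rintro z ⟨⟨a, b⟩, c, d⟩ ⟨h1, h2, h3, h4⟩
    refine ⟨fun h => ?_, fun h => ?_, fun h => ?_, fun h => ?_⟩ <;>
      simp only [smul_eq_mul]
    · exact ⟨by linear_combination z * (h1 h).1, by linear_combination z * (h1 h).2⟩
    · exact ⟨by linear_combination z * (h2 h).1, by linear_combination z * (h2 h).2⟩
    · exact ⟨by linear_combination z * (h3 h).1, by linear_combination z * (h3 h).2⟩
    · exact ⟨by linear_combination z * (h4 h).1, by linear_combination z * (h4 h).2⟩

/-- The scalar operator
`-d²/dx² + ∑_{q ∈ Q} α_q δ(x-q) + ∑_{q ∈ Qs} β_q δ'_s(x-q) + ∑_{q ∈ Qp} α_q δ_p(x-q)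
+ ∑_{q ∈ Q'} β_q δ'(x-q)` in `L²(ℝ)`. -/
def scalarHamiltonian : L2 ℂ →ₗ.[ℂ] L2 ℂ :=
  pointInteraction (Q ∪ Qs ∪ Qp ∪ Q') (scalarBC Q Qs Qp Q' α β)

/-- Separating boundary conditions: Dirichlet on `Q`, Neumann on `Qs`, and Robin conditions
on both sides of the points of `Qp` and `Q'`. -/
def separatedBC (q : ℝ) : Submodule ℂ (BoundaryValues ℂ) where
  carrier := {((gL, gR), (dL, dR)) |
    (q ∈ Q → gL = 0 ∧ gR = 0) ∧
    (q ∈ Qs → dL = 0 ∧ dR = 0) ∧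
    (q ∈ Qp → α q * gL + 2 * n * dL = 0 ∧ α q * gR - 2 * n * dR = 0) ∧
    (q ∈ Q' → 2 * n * gL + β q * dL = 0 ∧ 2 * n * gR - β q * dR = 0)}
  add_mem' := by
    rintro ⟨⟨a, b⟩, c, d⟩ ⟨⟨a', b'⟩, c', d'⟩ ⟨h1, h2, h3, h4⟩ ⟨k1, k2, k3, k4⟩
    refine ⟨fun h => ?_, fun h => ?_, fun h => ?_, fun h => ?_⟩
    · exact ⟨by linear_combination (h1 h).1 + (k1 h).1, by linear_combination (h1 h).2 + (k1 h).2⟩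
    · exact ⟨by linear_combination (h2 h).1 + (k2 h).1, by linear_combination (h2 h).2 + (k2 h).2⟩
    · exact ⟨by linear_combination (h3 h).1 + (k3 h).1, by linear_combination (h3 h).2 + (k3 h).2⟩
    · exact ⟨by linear_combination (h4 h).1 + (k4 h).1, by linear_combination (h4 h).2 + (k4 h).2⟩
  zero_mem' := by
    refine ⟨fun _ => ?_, fun _ => ?_, fun _ => ?_, fun _ => ?_⟩ <;> simp
  smul_mem' := by
    rintro z ⟨⟨a, b⟩, c, d⟩ ⟨h1, h2, h3, h4⟩
    refine ⟨fun h => ?_, fun h => ?_, fun h => ?_, fun h => ?_⟩ <;>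
      simp only [smul_eq_mul]
    · exact ⟨by linear_combination z * (h1 h).1, by linear_combination z * (h1 h).2⟩
    · exact ⟨by linear_combination z * (h2 h).1, by linear_combination z * (h2 h).2⟩
    · exact ⟨by linear_combination z * (h3 h).1, by linear_combination z * (h3 h).2⟩
    · exact ⟨by linear_combination z * (h4 h).1, by linear_combination z * (h4 h).2⟩

/-- The decoupled operator `-d²/dx²` in `L²(ℝ)` with the separating boundary conditions. -/
def separatedHamiltonian : L2 ℂ →ₗ.[ℂ] L2 ℂ :=
  pointInteraction (Q ∪ Qs ∪ Qp ∪ Q') (separatedBC n Q Qs Qp Q' α β)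

end Hamiltonians

section Operators

/-- The direct sum of a finite family of unbounded operators, acting in the Hilbert direct sum
on the vectors all of whose components are in the respective domains. -/
def directSum {ι : Type*} [Fintype ι] {F : Type*} [NormedAddCommGroup F] [InnerProductSpace ℂ F]
    (T : ι → F →ₗ.[ℂ] F) : PiLp 2 (fun _ : ι => F) →ₗ.[ℂ] PiLp 2 (fun _ : ι => F) where
  domain :=
    { carrier := {x | ∀ k, x k ∈ (T k).domain}
      add_mem' := fun hx hy k => add_mem (hx k) (hy k)
      zero_mem' := fun k => zero_mem (T k).domain
      smul_mem' := fun c _ hx k => (T k).domain.smul_mem c (hx k) }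
  toFun :=
    { toFun := fun x => WithLp.toLp 2 fun k => T k ⟨x.1 k, x.2 k⟩
      map_add' := fun x y => by
        ext k
        exact (T k).map_add ⟨x.1 k, x.2 k⟩ ⟨y.1 k, y.2 k⟩
      map_smul' := fun c x => by
        ext k
        exact (T k).map_smul c ⟨x.1 k, x.2 k⟩ }

/-- Unitary equivalence of unbounded operators: there is a unitary `U` with `S = U T U⁻¹`,
including equality of the domains. -/
def UnitarilyEquivalent {F G : Type*} [NormedAddCommGroup F] [InnerProductSpace ℂ F]
    [NormedAddCommGroup G] [InnerProductSpace ℂ G] (T : F →ₗ.[ℂ] F) (S : G →ₗ.[ℂ] G) : Prop :=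
  ∃ U : F ≃ₗᵢ[ℂ] G, (∀ x : F, U x ∈ S.domain ↔ x ∈ T.domain) ∧
    ∀ (x : T.domain) (y : S.domain), (y : G) = U x → S y = U (T x)

end Operators

end CoupledChannels

end

open CoupledChannels

noncomputable section

namespace CoupledChannels

open Set
open scoped ComplexConjugate

/-! ### Product rule for primitives of locally integrable functions. -/

section Primitives

variable {E F G : Type*} [NormedAddCommGroup E] [NormedSpace ℝ E]
  [NormedAddCommGroup F] [NormedSpace ℝ F]
  [NormedAddCommGroup G] [NormedSpace ℝ G]

/-! Self-adjointness and the decomposition are both reduced to linear algebra in the boundary values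
at a single point.

For self-adjointness, Green's formula expresses `⟪f'', g⟫ - ⟪f, g''⟫` through the jumps of the
Wronskian at the points of `P`. If the condition at each point is a Lagrangian subspace for this
jump form, the operator is symmetric, because the Wronskian is then absolutely continuous across `P`
and integrable together with its derivative. Conversely, let `(g, h)` lie in the graph of the
adjoint. Testing with functions supported off `P` gives `-g'' = h` there in the distributional
sense. Uniform discreteness leaves a free interval of fixed length on one side of each point off
`P`, which bounds `g'` by local averages of `g` and `g''`; hence `g'` is square integrable
(`exists_weakDeriv_of_second`). Testing with a function that has arbitrary admissible boundary
values at one `q ∈ P` and none elsewhere isolates the jump at `q`, and maximality of the Lagrangian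
subspace gives the boundary condition for `g`. This is `isSelfAdjoint_pointInteraction`; the
Lagrangian property is a finite computation for each coupling.

For the equivalence, all couplings are symmetric under permutations of the channels. In an
orthonormal basis of `ℂⁿ` that starts with `n^(-1/2) (1, …, 1)` the boundary conditions become
diagonal: the component along the first vector satisfies the scalar conditions with strengths
divided by `n`, and a component along a vector of zero sum satisfies the separated conditions. A
constant unitary on `ℂⁿ` commutes with differentiation and with one-sided limits, so passing to
components carries one operator to the direct sum (`unitarilyEquivalent_directSum`). -/

lemma _root_.MeasureTheory.LocallyIntegrable.intervalIntegrable_real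
    {E : Type*} [NormedAddCommGroup E] {d : ℝ → E}
    (hd : LocallyIntegrable d) (a b : ℝ) : IntervalIntegrable d volume a b :=
  (hd.integrableOn_isCompact isCompact_uIcc).intervalIntegrable

/-- Fubini for `B (d x) (e y)` on the square, cut along the diagonal. The half-lines are closed in
one term and open in the other so that the diagonal is counted once, even if `μ` has atoms. -/
lemma integral_setIntegral_triangle [CompleteSpace E] [CompleteSpace F] [CompleteSpace G]
    (B : E →L[ℝ] F →L[ℝ] G) {μ : Measure ℝ} [SFinite μ]
    {d : ℝ → E} {e : ℝ → F} (hd : Integrable d μ) (he : Integrable e μ) :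
    B (∫ x, d x ∂μ) (∫ y, e y ∂μ) =
      (∫ x, B (d x) (∫ y in Iic x, e y ∂μ) ∂μ) + ∫ y, B (∫ x in Iio y, d x ∂μ) (e y) ∂μ := by
  set k : ℝ × ℝ → G := fun z => B (d z.1) (e z.2) with hk
  have hki : Integrable k (μ.prod μ) := by
    refine ((hd.norm.mul_prod he.norm).const_mul ‖B‖).mono' ?_ ?_
    · exact B.aestronglyMeasurable_comp₂ hd.aestronglyMeasurable.comp_fst
        he.aestronglyMeasurable.comp_snd
    · refine Eventually.of_forall fun z => ?_
      simpa [hk, mul_assoc] using B.le_opNorm₂ (d z.1) (e z.2)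
  have hS : MeasurableSet {z : ℝ × ℝ | z.2 ≤ z.1} := measurableSet_le measurable_snd measurable_fst
  have h0 : B (∫ x, d x ∂μ) (∫ y, e y ∂μ) = ∫ z, k z ∂(μ.prod μ) := by
    rw [integral_prod _ hki]
    have : ∀ x, ∫ y, k (x, y) ∂μ = B.flip (∫ y, e y ∂μ) (d x) := fun x => by
      exact ContinuousLinearMap.integral_comp_comm (B (d x)) he
    simp_rw [this]
    rw [ContinuousLinearMap.integral_comp_comm _ hd]; rfl
  rw [h0, ← integral_add_compl hS hki, ← integral_indicator hS, ← integral_indicator hS.compl,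
    integral_prod _ (hki.indicator hS), integral_prod_symm _ (hki.indicator hS.compl)]
  congr 1
  · refine integral_congr_ae (Eventually.of_forall fun x => ?_)
    simp only
    rw [← integral_indicator measurableSet_Iic, ← ContinuousLinearMap.integral_comp_comm _
      (he.indicator measurableSet_Iic)]
    refine integral_congr_ae (Eventually.of_forall fun y => ?_)
    by_cases h : y ≤ x <;> simp [indicator, h, hk]
  · refine integral_congr_ae (Eventually.of_forall fun y => ?_)
    simp only
    rw [← integral_indicator measurableSet_Iio]
    change _ = B.flip (e y) _
    rw [← ContinuousLinearMap.integral_comp_comm _ (hd.indicator measurableSet_Iio)]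
    refine integral_congr_ae (Eventually.of_forall fun x => ?_)
    by_cases h : y ≤ x
    · simp [indicator, h, not_lt.2 h]
    · simp [indicator, h, hk, not_le.1 h]

lemma bilin_integral_integral_of_le [CompleteSpace E] [CompleteSpace F] [CompleteSpace G]
    (B : E →L[ℝ] F →L[ℝ] G) {d : ℝ → E} {e : ℝ → F} {a b : ℝ} (hab : a ≤ b)
    (hd : IntervalIntegrable d volume a b) (he : IntervalIntegrable e volume a b) :
    B (∫ x in a..b, d x) (∫ y in a..b, e y) =
      (∫ x in a..b, B (d x) (∫ y in a..x, e y)) + ∫ y in a..b, B (∫ x in a..y, d x) (e y) := by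
  simp only [intervalIntegral.integral_of_le hab]
  rw [intervalIntegrable_iff_integrableOn_Ioc_of_le hab] at hd he
  rw [integral_setIntegral_triangle B hd he]
  congr 1
  · refine setIntegral_congr_fun measurableSet_Ioc fun x hx => ?_
    have hs : Iic x ∩ Ioc a b = Ioc a x := by
      ext y; simp only [mem_inter_iff, mem_Iic, mem_Ioc]; grind
    rw [intervalIntegral.integral_of_le hx.1.le, Measure.restrict_restrict measurableSet_Iic, hs]
  · refine setIntegral_congr_fun measurableSet_Ioc fun x hx => ?_
    have hs : Iio x ∩ Ioc a b = Ioo a x := by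
      ext y; simp only [mem_inter_iff, mem_Iio, mem_Ioc, mem_Ioo]; grind
    rw [intervalIntegral.integral_of_le hx.1.le, Measure.restrict_restrict measurableSet_Iio, hs,
      integral_Ioc_eq_integral_Ioo]

lemma _root_.IntervalIntegrable.bilin_continuous (B : E →L[ℝ] F →L[ℝ] G) {d : ℝ → E} {u : ℝ → F}
    {a b : ℝ} (hd : IntervalIntegrable d volume a b) (hu : Continuous u) :
    IntervalIntegrable (fun t => B (d t) (u t)) volume a b := by
  rw [intervalIntegrable_iff] at hd ⊢
  obtain ⟨C, hC⟩ := (isCompact_uIcc (a := a) (b := b)).exists_bound_of_continuousOn hu.continuousOn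
  refine ((hd.norm.const_mul ‖B‖).mul_const C).mono'
    (B.aestronglyMeasurable_comp₂ hd.aestronglyMeasurable hu.aestronglyMeasurable) ?_
  refine (ae_restrict_mem measurableSet_uIoc).mono fun t ht => ?_
  exact (B.le_opNorm₂ _ _).trans (by gcongr; exact hC t (uIoc_subset_uIcc ht))

/-- The product rule for primitives of locally integrable functions. -/
lemma bilin_primitive_sub [CompleteSpace E] [CompleteSpace F] [CompleteSpace G]
    (B : E →L[ℝ] F →L[ℝ] G) {d : ℝ → E} {e : ℝ → F}
    (hd : LocallyIntegrable d) (he : LocallyIntegrable e) {f : ℝ → E} {g : ℝ → F}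
    (hf : ∀ a b, f b - f a = ∫ t in a..b, d t)
    (hg : ∀ a b, g b - g a = ∫ t in a..b, e t) (a b : ℝ) :
    B (f b) (g b) - B (f a) (g a) = ∫ t in a..b, (B (d t) (g t) + B (f t) (e t)) := by
  wlog hab : a ≤ b generalizing a b
  · rw [intervalIntegral.integral_symm, ← this b a (le_of_not_ge hab)]; abel
  have hd' : ∀ a b, IntervalIntegrable d volume a b := fun a b => hd.intervalIntegrable_real a b
  have he' : ∀ a b, IntervalIntegrable e volume a b := fun a b => he.intervalIntegrable_real a b
  have hfc : Continuous f := by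
    have : f = fun x => f a + ∫ t in a..x, d t := by ext x; rw [← hf]; abel
    rw [this]
    exact continuous_const.add (intervalIntegral.continuous_primitive hd' a)
  have hgc : Continuous g := by
    have : g = fun x => g a + ∫ t in a..x, e t := by ext x; rw [← hg]; abel
    rw [this]
    exact continuous_const.add (intervalIntegral.continuous_primitive he' a)
  -- This is the product rule for the shifted functions `f - f a` and `g - g a`; `k1` to `k4` remove
  -- the shifts.
  have key := bilin_integral_integral_of_le B hab (hd' a b) (he' a b)
  simp only [← hf, ← hg] at key
  have i1 : ∀ u : ℝ → F, Continuous u → IntervalIntegrable (fun t => B (d t) (u t)) volume a b := by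
    intro u hu
    have := (hd' a b).bilin_continuous B hu
    exact this
  have i2 : ∀ u : ℝ → E, Continuous u → IntervalIntegrable (fun t => B (u t) (e t)) volume a b := by
    intro u hu
    exact (he' a b).bilin_continuous B.flip hu
  rw [intervalIntegral.integral_add (i1 g hgc) (i2 f hfc)]
  have k1 : ∫ t in a..b, B (d t) (g a) = B (f b - f a) (g a) := by
    rw [hf]
    exact ContinuousLinearMap.intervalIntegral_comp_comm (B.flip (g a)) (hd' a b)
  have k2 : ∫ t in a..b, B (f a) (e t) = B (f a) (g b - g a) := by
    rw [hg]
    exact ContinuousLinearMap.intervalIntegral_comp_comm (B (f a)) (he' a b)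
  have k3 : ∫ t in a..b, B (d t) (g t - g a) =
      (∫ t in a..b, B (d t) (g t)) - B (f b - f a) (g a) := by
    rw [← k1, ← intervalIntegral.integral_sub (i1 g hgc) (i1 _ continuous_const)]
    simp only [map_sub]
  have k4 : ∫ t in a..b, B (f t - f a) (e t) =
      (∫ t in a..b, B (f t) (e t)) - B (f a) (g b - g a) := by
    rw [← k2, ← intervalIntegral.integral_sub (i2 f hfc) (i2 _ continuous_const)]
    simp only [map_sub, sub_apply]
  rw [k3, k4] at key
  simp only [map_sub, sub_apply] at key ⊢
  rw [← sub_eq_zero] at key ⊢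
  rw [← key]; abel

end Primitives

/-! ### Almost everywhere primitives and their one-sided values. -/

section IsPrimitiveOn

variable {E F G : Type*} [NormedAddCommGroup E] [NormedSpace ℝ E]
  [NormedAddCommGroup F] [NormedSpace ℝ F] [NormedAddCommGroup G] [NormedSpace ℝ G]

/-- On `I`, the function `f` is almost everywhere a primitive of `d`. -/
def IsPrimitiveOn (I : Set ℝ) (f d : ℝ → E) : Prop :=
  ∃ c : E, ∀ᵐ y, y ∈ I → f y = c + ∫ t in (0 : ℝ)..y, d t

lemma IsPrimitiveOn.mono {I J : Set ℝ} {f d : ℝ → E} (h : IsPrimitiveOn I f d) (hJ : J ⊆ I) :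
    IsPrimitiveOn J f d := by
  obtain ⟨c, hc⟩ := h
  exact ⟨c, hc.mono fun y hy hyJ => hy (hJ hyJ)⟩

lemma IsPrimitiveOn.congr_ae {I : Set ℝ} {f d f' d' : ℝ → E} (h : IsPrimitiveOn I f d)
    (hf : f =ᵐ[volume] f') (hd : d =ᵐ[volume] d') : IsPrimitiveOn I f' d' := by
  obtain ⟨c, hc⟩ := h
  refine ⟨c, ?_⟩
  filter_upwards [hc, hf] with y hy hfy hyI
  rw [← hfy, hy hyI, intervalIntegral.integral_congr_ae (hd.mono fun t ht _ => ht)]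

lemma IsPrimitiveOn.sub {I : Set ℝ} {f d f' d' : ℝ → E} (h : IsPrimitiveOn I f d)
    (h' : IsPrimitiveOn I f' d') (hd : LocallyIntegrable d) (hd' : LocallyIntegrable d') :
    IsPrimitiveOn I (fun x => f x - f' x) (fun x => d x - d' x) := by
  obtain ⟨c, hc⟩ := h
  obtain ⟨c', hc'⟩ := h'
  refine ⟨c - c', ?_⟩
  filter_upwards [hc, hc'] with y hy hy' hyI
  rw [hy hyI, hy' hyI, intervalIntegral.integral_sub (hd.intervalIntegrable_real _ _)
    (hd'.intervalIntegrable_real _ _)]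
  abel

lemma continuous_primitive_of_locallyIntegrable {d : ℝ → E} (hd : LocallyIntegrable d) :
    Continuous fun y => ∫ t in (0 : ℝ)..y, d t :=
  intervalIntegral.continuous_primitive (fun a b => hd.intervalIntegrable_real a b) 0

/-- The product rule. -/
lemma IsPrimitiveOn.bilin [CompleteSpace E] [CompleteSpace F] [CompleteSpace G]
    (B : E →L[ℝ] F →L[ℝ] G) {I : Set ℝ} [I.OrdConnected] {f d : ℝ → E} {g e : ℝ → F}
    (hf : IsPrimitiveOn I f d) (hg : IsPrimitiveOn I g e)
    (hd : LocallyIntegrable d) (he : LocallyIntegrable e)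
    (hw : LocallyIntegrable fun t => B (d t) (g t) + B (f t) (e t)) :
    IsPrimitiveOn I (fun x => B (f x) (g x)) (fun t => B (d t) (g t) + B (f t) (e t)) := by
  rcases I.eq_empty_or_nonempty with rfl | ⟨m, hm⟩
  · exact ⟨0, Eventually.of_forall fun y hy => hy.elim⟩
  obtain ⟨c, hc⟩ := hf
  obtain ⟨c', hc'⟩ := hg
  -- The continuous representatives agree with `f` and `g` only on `I`, so the product rule is based
  -- at a point `m` of `I`; the constant supplied below moves the base point to `0`.
  set f₀ : ℝ → E := fun y => c + ∫ t in (0 : ℝ)..y, d t with hf₀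
  set g₀ : ℝ → F := fun y => c' + ∫ t in (0 : ℝ)..y, e t with hg₀
  have key := bilin_primitive_sub B hd he (f := f₀) (g := g₀)
    (fun a b => by
      simp only [hf₀, add_sub_add_left_eq_sub]
      exact intervalIntegral.integral_interval_sub_left (hd.intervalIntegrable_real _ _)
        (hd.intervalIntegrable_real _ _))
    (fun a b => by
      simp only [hg₀, add_sub_add_left_eq_sub]
      exact intervalIntegral.integral_interval_sub_left (he.intervalIntegrable_real _ _)
        (he.intervalIntegrable_real _ _)) m
  refine ⟨B (f₀ m) (g₀ m) - ∫ t in (0 : ℝ)..m, (B (d t) (g t) + B (f t) (e t)), ?_⟩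
  filter_upwards [hc, hc'] with y hy hy' hyI
  rw [hy hyI, hy' hyI]
  change B (f₀ y) (g₀ y) = _
  rw [eq_add_of_sub_eq (key y), sub_add_eq_add_sub, add_comm, add_sub_assoc,
    intervalIntegral.integral_interval_sub_left (hw.intervalIntegrable_real _ _)
      (hw.intervalIntegrable_real _ _)]
  congr 1
  refine intervalIntegral.integral_congr_ae ?_
  filter_upwards [hc, hc'] with t ht ht' htm
  have htI : t ∈ I := Set.OrdConnected.uIcc_subset ‹_› hm hyI (uIoc_subset_uIcc htm)
  rw [ht htI, ht' htI]

lemma exists_mem_Ioo_of_ae {p : ℝ → Prop} (hp : ∀ᵐ y, p y) {a b : ℝ} (hab : a < b) :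
    ∃ y ∈ Ioo a b, p y := by
  by_contra! h
  have : volume (Ioo a b) = 0 := measure_mono_null (fun y hy => h y hy) (ae_iff.1 hp)
  simp [hab.not_ge] at this

/-- One-sided neighbourhoods have positive measure. Properness of this filter is what makes
essential one-sided values unique. -/
instance nhdsWithin_Ioi_inf_ae_neBot (q : ℝ) : (𝓝[>] q ⊓ ae (volume : Measure ℝ)).NeBot := by
  refine inf_neBot_iff.2 fun s hs t ht => ?_
  obtain ⟨b, hb, hbs⟩ := (mem_nhdsGT_iff_exists_Ioo_subset).1 hs
  obtain ⟨y, hy, hyt⟩ := exists_mem_Ioo_of_ae (p := fun y => y ∈ t) ht hb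
  exact ⟨y, hbs hy, hyt⟩

instance nhdsWithin_Iio_inf_ae_neBot (q : ℝ) : (𝓝[<] q ⊓ ae (volume : Measure ℝ)).NeBot := by
  refine inf_neBot_iff.2 fun s hs t ht => ?_
  obtain ⟨b, hb, hbs⟩ := (mem_nhdsLT_iff_exists_Ioo_subset).1 hs
  obtain ⟨y, hy, hyt⟩ := exists_mem_Ioo_of_ae (p := fun y => y ∈ t) ht hb
  exact ⟨y, hbs hy, hyt⟩

lemma HasRightValue.of_primitive {f d : ℝ → E} {c : E} {q b : ℝ} (hqb : q < b)
    (hd : LocallyIntegrable d) (h : ∀ᵐ y, y ∈ Ioo q b → f y = c + ∫ t in (0 : ℝ)..y, d t) :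
    HasRightValue f q (c + ∫ t in (0 : ℝ)..q, d t) := by
  have hc : Tendsto (fun y => c + ∫ t in (0 : ℝ)..y, d t) (𝓝[>] q ⊓ ae volume)
      (𝓝 (c + ∫ t in (0 : ℝ)..q, d t)) :=
    ((continuous_const.add (continuous_primitive_of_locallyIntegrable hd)).tendsto q).mono_left
      (inf_le_left.trans nhdsWithin_le_nhds)
  refine hc.congr' ?_
  filter_upwards [h.filter_mono inf_le_right,
    mem_inf_of_left (Ioo_mem_nhdsGT hqb)] with y h1 h2
  exact (h1 h2).symm

lemma HasLeftValue.of_primitive {f d : ℝ → E} {c : E} {a q : ℝ} (haq : a < q)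
    (hd : LocallyIntegrable d) (h : ∀ᵐ y, y ∈ Ioo a q → f y = c + ∫ t in (0 : ℝ)..y, d t) :
    HasLeftValue f q (c + ∫ t in (0 : ℝ)..q, d t) := by
  have hc : Tendsto (fun y => c + ∫ t in (0 : ℝ)..y, d t) (𝓝[<] q ⊓ ae volume)
      (𝓝 (c + ∫ t in (0 : ℝ)..q, d t)) :=
    ((continuous_const.add (continuous_primitive_of_locallyIntegrable hd)).tendsto q).mono_left
      (inf_le_left.trans nhdsWithin_le_nhds)
  refine hc.congr' ?_
  filter_upwards [h.filter_mono inf_le_right,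
    mem_inf_of_left (Ioo_mem_nhdsLT haq)] with y h1 h2
  exact (h1 h2).symm

lemma IsPrimitiveOn.exists_rightValue {f d : ℝ → E} {q b : ℝ} (hqb : q < b)
    (hd : LocallyIntegrable d) (h : IsPrimitiveOn (Ioo q b) f d) : ∃ a, HasRightValue f q a := by
  obtain ⟨c, hc⟩ := h
  exact ⟨_, HasRightValue.of_primitive hqb hd hc⟩

lemma IsPrimitiveOn.exists_leftValue {f d : ℝ → E} {a q : ℝ} (haq : a < q)
    (hd : LocallyIntegrable d) (h : IsPrimitiveOn (Ioo a q) f d) : ∃ a, HasLeftValue f q a := by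
  obtain ⟨c, hc⟩ := h
  exact ⟨_, HasLeftValue.of_primitive haq hd hc⟩

/-- Primitives to the left and to the right of a point fit together if the one-sided values
agree. -/
lemma IsPrimitiveOn.join {f d : ℝ → E} {a q b : ℝ} {v : E} (haq : a < q) (hqb : q < b)
    (hd : LocallyIntegrable d) (hl : IsPrimitiveOn (Ioo a q) f d)
    (hr : IsPrimitiveOn (Ioo q b) f d) (hvl : HasLeftValue f q v) (hvr : HasRightValue f q v) :
    IsPrimitiveOn (Ioo a b) f d := by
  obtain ⟨c, hc⟩ := hl
  obtain ⟨c', hc'⟩ := hr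
  have h1 := tendsto_nhds_unique hvl (HasLeftValue.of_primitive haq hd hc)
  have h2 := tendsto_nhds_unique hvr (HasRightValue.of_primitive hqb hd hc')
  obtain rfl : c = c' := add_right_cancel (h1.symm.trans h2)
  refine ⟨c, ?_⟩
  filter_upwards [hc, hc', Measure.ae_ne volume q] with y h1 h2 hne hy
  rcases lt_or_gt_of_ne hne with h | h
  · exact h1 ⟨hy.1, h⟩
  · exact h2 ⟨h, hy.2⟩

/-- The constants of integration of two overlapping neighbourhoods agree, since the overlap has
positive measure; connectedness makes the constant global, and locally null exceptional sets are
null. -/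
lemma IsPrimitiveOn.of_locally {f d : ℝ → E} {I : Set ℝ} (hI : IsPreconnected I)
    (h : ∀ x ∈ I, ∃ u ∈ 𝓝 x, IsPrimitiveOn u f d) : IsPrimitiveOn I f d := by
  rcases I.eq_empty_or_nonempty with rfl | ⟨m, hm⟩
  · exact ⟨0, Eventually.of_forall fun y hy => hy.elim⟩
  choose! u hu c hc using h
  have hconst : ∀ x ∈ I, c m = c x := fun x hx => by
    refine hI.induction₂ (fun x y => c x = c y) (fun x hx => ?_)
      (fun _ _ _ _ _ _ h h' => h.trans h')
      (fun _ _ _ _ h => h.symm) hm hx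
    filter_upwards [mem_nhdsWithin_of_mem_nhds (eventually_mem_nhds_iff.2 (hu x hx)),
      self_mem_nhdsWithin] with y hy hyI
    obtain ⟨a, b, hab, hsub⟩ := mem_nhds_iff_exists_Ioo_subset.1 (inter_mem hy (hu y hyI))
    obtain ⟨z, hz, h1, h2⟩ := exists_mem_Ioo_of_ae ((hc x hx).and (hc y hyI)) (hab.1.trans hab.2)
    exact add_right_cancel ((h1 (hsub hz).1).symm.trans (h2 (hsub hz).2))
  refine ⟨c m, ?_⟩
  rw [ae_iff]
  refine measure_null_of_locally_null _ fun x hx => ?_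
  have hxI : x ∈ I := by
    by_contra hxI
    exact hx fun h => absurd h hxI
  refine ⟨u x ∩ {y | ¬(y ∈ I → f y = c m + ∫ t in (0 : ℝ)..y, d t)},
    inter_mem (mem_nhdsWithin_of_mem_nhds (hu x hxI)) self_mem_nhdsWithin, ?_⟩
  refine measure_mono_null (fun y hy => ?_) (ae_iff.1 (hc x hxI))
  rintro h
  exact hy.2 fun hyI => by rw [hconst x hxI]; exact h hy.1

/-- An integrable function with integrable derivative on a half-line has boundary value minus the
integral of the derivative. -/
lemma IsPrimitiveOn.hasRightValue_Ioi [CompleteSpace E] {f w : ℝ → E} {q : ℝ}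
    (hf : Integrable f) (hw : Integrable w)
    (h : IsPrimitiveOn (Ioi q) f w) : HasRightValue f q (-∫ t in Ioi q, w t) := by
  obtain ⟨c, hc⟩ := h
  have hr := HasRightValue.of_primitive (b := q + 1) (by linarith) hw.locallyIntegrable
    (hc.mono fun y hy hyI => hy hyI.1)
  have hlim : Tendsto (fun y => c + ∫ t in (0 : ℝ)..y, w t) atTop
      (𝓝 (c + ∫ t in Ioi (0 : ℝ), w t)) :=
    tendsto_const_nhds.add (intervalIntegral_tendsto_integral_Ioi 0 hw.integrableOn tendsto_id)
  -- The primitive converges at infinity because `w` is integrable, and the limit is zero because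
  -- `f` is integrable on a half-line of infinite measure.
  have h0 : c + ∫ t in Ioi (0 : ℝ), w t = 0 := by
    refine IntegrableAtFilter.eq_zero_of_tendsto (μ := volume) ?_ ?_ hlim
    · refine ⟨Ioi q, Ioi_mem_atTop q, hf.integrableOn.congr_fun_ae ?_⟩
      exact (ae_restrict_iff' measurableSet_Ioi).2 hc
    · intro s hs
      obtain ⟨a, ha⟩ := mem_atTop_sets.1 hs
      exact top_le_iff.1 (Real.volume_Ici (a := a) ▸ measure_mono fun y hy => ha y hy)
  convert hr using 1
  have h2 := intervalIntegral.integral_Ioi_sub_Ioi' (a := 0) (b := q) hw.integrableOn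
    hw.integrableOn
  rw [← h2, add_sub, h0, zero_sub]

lemma IsPrimitiveOn.hasLeftValue_Iio [CompleteSpace E] {f w : ℝ → E} {q : ℝ}
    (hf : Integrable f) (hw : Integrable w)
    (h : IsPrimitiveOn (Iio q) f w) : HasLeftValue f q (∫ t in Iic q, w t) := by
  obtain ⟨c, hc⟩ := h
  have hr := HasLeftValue.of_primitive (a := q - 1) (by linarith) hw.locallyIntegrable
    (hc.mono fun y hy hyI => hy hyI.2)
  have hlim : Tendsto (fun y => c + ∫ t in (0 : ℝ)..y, w t) atBot
      (𝓝 (c + -∫ t in Iic (0 : ℝ), w t)) := by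
    simp only [intervalIntegral.integral_symm _ (0 : ℝ)]
    exact tendsto_const_nhds.add
      (intervalIntegral_tendsto_integral_Iic 0 hw.integrableOn tendsto_id).neg
  have h0 : c + -∫ t in Iic (0 : ℝ), w t = 0 := by
    refine IntegrableAtFilter.eq_zero_of_tendsto (μ := volume) ?_ ?_ hlim
    · refine ⟨Iio q, Iio_mem_atBot q, hf.integrableOn.congr_fun_ae ?_⟩
      exact (ae_restrict_iff' measurableSet_Iio).2 hc
    · intro s hs
      obtain ⟨a, ha⟩ := mem_atBot_sets.1 hs
      exact top_le_iff.1 (Real.volume_Iic (a := a) ▸ measure_mono fun y hy => ha y hy)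
  convert hr using 1
  rw [← intervalIntegral.integral_Iic_sub_Iic (a := 0) (b := q) hw.integrableOn hw.integrableOn,
    ← sub_eq_zero, ← neg_eq_zero, ← h0]
  abel

end IsPrimitiveOn

/-! ### Test functions. -/

section TestFunctions

/-- Real test functions on `Ω`. -/
structure IsTest (Ω : Set ℝ) (φ : ℝ → ℝ) : Prop where
  contDiff : ContDiff ℝ ∞ φ
  hasCompactSupport : HasCompactSupport φ
  tsupport_subset : tsupport φ ⊆ Ω

variable {Ω : Set ℝ} {φ ψ : ℝ → ℝ}

lemma IsTest.mono {Ω' : Set ℝ} (h : IsTest Ω φ) (hΩ : Ω ⊆ Ω') : IsTest Ω' φ :=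
  ⟨h.1, h.2, h.3.trans hΩ⟩

lemma IsTest.deriv (h : IsTest Ω φ) : IsTest Ω (deriv φ) :=
  ⟨(contDiff_infty_iff_deriv.1 h.1).2, h.2.deriv, fun _ hx => h.3 (tsupport_deriv_subset hx)⟩

lemma IsTest.continuous (h : IsTest Ω φ) : Continuous φ := h.1.continuous

lemma IsTest.hasDerivAt (h : IsTest Ω φ) (x : ℝ) : HasDerivAt φ (_root_.deriv φ x) x :=
  ((contDiff_infty_iff_deriv.1 h.1).1 x).hasDerivAt

lemma IsTest.sub_const_mul (h : IsTest Ω φ) (h' : IsTest Ω ψ) (c : ℝ) :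
    IsTest Ω (fun x => φ x - c * ψ x) := by
  refine ⟨h.1.sub (contDiff_const.mul h'.1), h.2.sub h'.2.mul_left, ?_⟩
  refine (tsupport_sub _ _).trans (union_subset h.3 ?_)
  exact (tsupport_mul_subset_right).trans h'.3

lemma IsTest.integrable_smul {E : Type*} [NormedAddCommGroup E] [NormedSpace ℝ E]
    (h : IsTest Ω φ) {f : ℝ → E} (hf : LocallyIntegrable f) :
    Integrable fun x => φ x • f x :=
  hf.integrable_smul_left_of_hasCompactSupport h.continuous h.2

lemma IsTest.integrable_smul_of_continuousOn {E : Type*} [NormedAddCommGroup E] [NormedSpace ℝ E]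
    (h : IsTest Ω φ) (hΩ : IsOpen Ω) {f : ℝ → E} (hf : ContinuousOn f Ω) :
    Integrable fun x => φ x • f x := by
  refine Continuous.integrable_of_hasCompactSupport ?_ h.2.smul_right
  refine continuous_of_tsupport fun x hx => ?_
  have hxΩ : x ∈ Ω := h.3 (tsupport_smul_subset_left φ f hx)
  exact h.continuous.continuousAt.smul (hf.continuousAt (hΩ.mem_nhds hxΩ))

lemma exists_isTest_integral_eq_one {a b : ℝ} (hab : a < b) :
    ∃ η : ℝ → ℝ, IsTest (Ioo a b) η ∧ (∀ x, 0 ≤ η x) ∧ ∫ x, η x = 1 := by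
  let f : ContDiffBump ((a + b) / 2) :=
    ⟨(b - a) / 8, (b - a) / 4, by linarith, by linarith⟩
  refine ⟨f.normed volume, ⟨f.contDiff_normed, f.hasCompactSupport_normed, ?_⟩,
    f.nonneg_normed, f.integral_normed⟩
  rw [f.tsupport_normed_eq, Real.closedBall_eq_Icc]
  intro x hx
  simp only [f, mem_Icc] at hx
  constructor <;> linarith [hx.1, hx.2]

/-- The primitive from `a` vanishes to the left of the support of `ψ`, and to its right because the
total integral is zero; so its support stays in the compact hull of the support of `ψ`. -/
lemma IsTest.exists_primitive {a b : ℝ} (hψ : IsTest (Ioo a b) ψ) (h0 : ∫ x, ψ x = 0) :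
    ∃ φ, IsTest (Ioo a b) φ ∧ _root_.deriv φ = ψ := by
  set φ : ℝ → ℝ := fun x => ∫ t in a..x, ψ t with hφ
  have hder : ∀ x, HasDerivAt φ (ψ x) x := fun x =>
    intervalIntegral.integral_hasDerivAt_right (hψ.continuous.intervalIntegrable _ _)
      hψ.continuous.stronglyMeasurable.stronglyMeasurableAtFilter hψ.continuous.continuousAt
  have hdφ : _root_.deriv φ = ψ := funext fun x => (hder x).deriv
  rcases (tsupport ψ).eq_empty_or_nonempty with he | hne
  · obtain rfl : ψ = 0 := by rwa [tsupport_eq_empty_iff] at he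
    exact ⟨0, ⟨contDiff_const, HasCompactSupport.zero, by simp⟩, by ext; simp⟩
  obtain ⟨a', ha', hmin⟩ := hψ.2.exists_isLeast hne
  obtain ⟨b', hb', hmax⟩ := hψ.2.exists_isGreatest hne
  have hsupp : Function.support ψ ⊆ Icc a' b' := fun x hx =>
    ⟨hmin (subset_tsupport _ hx), hmax (subset_tsupport _ hx)⟩
  have haa' := (hψ.3 ha').1
  have hbb' := (hψ.3 hb').2
  have hφs : Function.support φ ⊆ Icc a' b' := by
    intro x hx
    by_contra hxI
    apply hx
    by_cases hxa : a' ≤ x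
    · have hbx : b' < x := by
        by_contra! h
        exact hxI ⟨hxa, h⟩
      have : Function.support ψ ⊆ Ioc a x := fun y hy =>
        ⟨haa'.trans_le (hsupp hy).1, (hsupp hy).2.trans hbx.le⟩
      simp only [hφ]
      rw [intervalIntegral.integral_eq_integral_of_support_subset this, h0]
    · simp only [hφ]
      rw [intervalIntegral.integral_congr (g := fun _ => 0), intervalIntegral.integral_zero]
      intro t ht
      by_contra h
      have := (hsupp h).1
      have h2 : t ≤ max a x := ht.2
      rw [le_max_iff] at h2
      grind
  have hts : tsupport φ ⊆ Icc a' b' := closure_minimal hφs isClosed_Icc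
  refine ⟨φ, ⟨?_, ?_, ?_⟩, hdφ⟩
  · exact contDiff_infty_iff_deriv.2 ⟨fun x => (hder x).differentiableAt, hdφ ▸ hψ.1⟩
  · exact HasCompactSupport.of_support_subset_isCompact isCompact_Icc hφs
  · exact hts.trans fun x hx => ⟨haa'.trans_le hx.1, hx.2.trans_lt hbb'⟩

end TestFunctions

/-! ### Weak derivatives and primitives. -/

section WeakDerivatives

variable {E : Type*} [NormedAddCommGroup E] [InnerProductSpace ℂ E]

lemma isWeakDeriv_iff {Ω : Set ℝ} {f g : ℝ → E} : IsWeakDeriv Ω f g ↔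
    ∀ φ, IsTest Ω φ → ∫ x, deriv φ x • f x = -∫ x, φ x • g x :=
  ⟨fun h φ hφ => h φ hφ.1 hφ.2 hφ.3, fun h φ h1 h2 h3 => h φ ⟨h1, h2, h3⟩⟩

lemma IsWeakDeriv.mono {Ω Ω' : Set ℝ} {f g : ℝ → E} (h : IsWeakDeriv Ω f g) (hΩ : Ω' ⊆ Ω) :
    IsWeakDeriv Ω' f g := fun φ h1 h2 h3 => h φ h1 h2 (h3.trans hΩ)

lemma IsWeakDeriv.congr_ae {Ω : Set ℝ} {f g f' g' : ℝ → E} (h : IsWeakDeriv Ω f g)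
    (hf : f =ᵐ[volume] f') (hg : g =ᵐ[volume] g') : IsWeakDeriv Ω f' g' := by
  intro φ h1 h2 h3
  rw [← integral_congr_ae (hf.mono fun x hx => congrArg (deriv φ x • ·) hx),
    ← integral_congr_ae (hg.mono fun x hx => congrArg (φ x • ·) hx)]
  exact h φ h1 h2 h3

lemma IsWeakDeriv.congr_on {Ω : Set ℝ} {f g g' : ℝ → E} (h : IsWeakDeriv Ω f g)
    (hg : ∀ x ∈ Ω, g x = g' x) : IsWeakDeriv Ω f g' := by
  rw [isWeakDeriv_iff] at h ⊢
  intro φ hφ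
  rw [h φ hφ]
  congr 2
  ext x
  by_cases hx : x ∈ tsupport φ
  · rw [hg x (hφ.3 hx)]
  · simp [image_eq_zero_of_notMem_tsupport hx]

lemma isWeakDeriv_of_hasDerivAt [CompleteSpace E] {Ω : Set ℝ} (hΩ : IsOpen Ω) {f f' : ℝ → E}
    (hf : ∀ x ∈ Ω, HasDerivAt f (f' x) x) (hf' : ContinuousOn f' Ω) : IsWeakDeriv Ω f f' := by
  rw [isWeakDeriv_iff]
  intro φ hφ
  have hfc : ContinuousOn f Ω := fun x hx => (hf x hx).continuousAt.continuousWithinAt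
  have i1 := hφ.deriv.integrable_smul_of_continuousOn hΩ hfc
  have i2 := hφ.integrable_smul_of_continuousOn hΩ hf'
  have key := integral_eq_zero_of_hasDerivAt_of_integrable (f := fun x => φ x • f x)
    (f' := fun x => φ x • f' x + deriv φ x • f x) (fun x => ?_) (i2.add i1)
    (hφ.integrable_smul_of_continuousOn hΩ hfc)
  · rw [integral_add i2 i1] at key
    exact eq_neg_of_add_eq_zero_right key
  · by_cases hx : x ∈ tsupport φ
    · exact (hφ.hasDerivAt x).smul (hf x (hφ.3 hx))
    · have h0 : φ =ᶠ[𝓝 x] 0 := notMem_tsupport_iff_eventuallyEq.1 hx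
      have h1 : φ x = 0 := h0.self_of_nhds
      have h2 : deriv φ x = 0 := by rw [h0.deriv_eq]; simp
      rw [h1, h2, zero_smul, zero_smul, add_zero]
      refine (hasDerivAt_const x (0 : E)).congr_of_eventuallyEq ?_
      filter_upwards [h0] with y hy
      simp [hy]

/-- The product rule for `φ` and the primitive on an interval at whose ends `φ` vanishes. -/
lemma isWeakDeriv_primitive [CompleteSpace E] {d : ℝ → E} (hd : LocallyIntegrable d) (Ω : Set ℝ) :
    IsWeakDeriv Ω (fun x => ∫ t in (0 : ℝ)..x, d t) d := by
  rw [isWeakDeriv_iff]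
  intro φ hφ
  set f : ℝ → E := fun x => ∫ t in (0 : ℝ)..x, d t with hf
  have hfc : Continuous f := continuous_primitive_of_locallyIntegrable hd
  obtain ⟨R, hR⟩ := hφ.2.isBounded.subset_ball_lt 0 0
  have hsub : tsupport φ ⊆ Ioo (-R) R := by simpa [Real.ball_eq_Ioo] using hR.2
  have hz : φ R = 0 ∧ φ (-R) = 0 := by
    constructor <;> refine image_eq_zero_of_notMem_tsupport fun h => ?_
    · exact lt_irrefl _ (hsub h).2
    · exact lt_irrefl _ (hsub h).1
  have i1 := hφ.deriv.integrable_smul hfc.locallyIntegrable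
  have i2 := hφ.integrable_smul hd
  have key := bilin_primitive_sub (ContinuousLinearMap.lsmul ℝ ℝ) (d := deriv φ) (e := d) (f := φ)
    (g := f) hφ.deriv.continuous.locallyIntegrable hd
    (fun a b => (intervalIntegral.integral_eq_sub_of_hasDerivAt (fun x _ => hφ.hasDerivAt x)
      (hφ.deriv.continuous.intervalIntegrable _ _)).symm)
    (fun a b => intervalIntegral.integral_interval_sub_left (hd.intervalIntegrable_real _ _)
        (hd.intervalIntegrable_real _ _)) (-R) R
  simp only [ContinuousLinearMap.lsmul_apply, hz.1, hz.2, zero_smul, sub_zero] at key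
  rw [intervalIntegral.integral_eq_integral_of_support_subset, integral_add i1 i2] at key
  · exact eq_neg_of_add_eq_zero_left key.symm
  · intro x hx
    have : x ∈ tsupport φ := by
      by_contra h
      have h0 : φ =ᶠ[𝓝 x] 0 := notMem_tsupport_iff_eventuallyEq.1 h
      have h1 : φ x = 0 := h0.self_of_nhds
      have h2 : deriv φ x = 0 := by rw [h0.deriv_eq]; simp
      exact hx (by simp [h1, h2])
    exact ⟨(hsub this).1, (hsub this).2.le⟩

/-- A functional of the form `ψ ↦ ∫ (ψ' f + ψ v)` that vanishes on derivatives of test functions is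
a multiple of the integral. -/
lemma exists_integral_test_eq_smul {a b : ℝ} (hab : a < b) {f v : ℝ → E}
    (hf : LocallyIntegrable f) (hv : LocallyIntegrable v)
    (h : ∀ φ, IsTest (Ioo a b) φ →
      (∫ x, deriv (deriv φ) x • f x) + ∫ x, deriv φ x • v x = 0) :
    ∃ M : E, ∀ ψ, IsTest (Ioo a b) ψ →
      (∫ x, deriv ψ x • f x) + ∫ x, ψ x • v x = (∫ x, ψ x) • M := by
  obtain ⟨η, hη, -, hη1⟩ := exists_isTest_integral_eq_one hab
  refine ⟨(∫ x, deriv η x • f x) + ∫ x, η x • v x, fun ψ hψ => ?_⟩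
  set c := ∫ x, ψ x with hc
  have hψi : Integrable ψ := hψ.continuous.integrable_of_hasCompactSupport hψ.2
  have hηi : Integrable η := hη.continuous.integrable_of_hasCompactSupport hη.2
  -- Subtracting `(∫ ψ) η` makes the integral vanish, so the difference is the derivative of a test
  -- function and the functional kills it.
  obtain ⟨φ, hφ, hφd⟩ := (hψ.sub_const_mul hη c).exists_primitive (by
    rw [integral_sub hψi (hηi.const_mul c), integral_const_mul, hη1, mul_one, hc, sub_self])
  have key := h φ hφ
  rw [hφd] at key
  have hdd : deriv (fun x => ψ x - c * η x) = fun x => deriv ψ x - c * deriv η x :=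
    funext fun x => ((hψ.hasDerivAt x).sub ((hη.hasDerivAt x).const_mul c)).deriv
  rw [hdd] at key
  simp only [sub_smul, mul_smul] at key
  rw [integral_sub (hψ.deriv.integrable_smul hf) ((hη.deriv.integrable_smul hf).fun_smul c),
    integral_sub (hψ.integrable_smul hv) ((hη.integrable_smul hv).fun_smul c),
    integral_smul, integral_smul] at key
  rw [smul_add, ← sub_eq_zero, ← key]
  abel

/-- The du Bois-Reymond lemma: the difference of `f` and a primitive of `d` annihilates derivatives
of test functions, hence is almost everywhere constant on an interval. -/
lemma IsWeakDeriv.isPrimitiveOn [CompleteSpace E] {Ω : Set ℝ} {f d : ℝ → E}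
    (h : IsWeakDeriv Ω f d) (hf : LocallyIntegrable f) (hd : LocallyIntegrable d) {a b : ℝ}
    (hΩ : Ioo a b ⊆ Ω) : IsPrimitiveOn (Ioo a b) f d := by
  rcases le_or_gt b a with hab | hab
  · exact ⟨0, Eventually.of_forall fun y hy => absurd (hy.1.trans hy.2) hab.not_gt⟩
  rw [isWeakDeriv_iff] at h
  set p : ℝ → E := fun x => ∫ t in (0 : ℝ)..x, d t with hp
  have hpl : LocallyIntegrable p := (continuous_primitive_of_locallyIntegrable hd).locallyIntegrable
  have hpw := isWeakDeriv_iff.1 (isWeakDeriv_primitive hd Ω)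
  obtain ⟨M, hM⟩ := exists_integral_test_eq_smul hab (f := fun _ => (0 : E))
    (v := fun x => f x - p x)
    (continuous_const.locallyIntegrable) (hf.sub hpl) (fun φ hφ => by
      have h1 := h φ (hφ.mono hΩ)
      have h2 := hpw φ (hφ.mono hΩ)
      simp only [smul_zero, integral_zero, zero_add, smul_sub]
      rw [integral_sub (hφ.deriv.integrable_smul hf) (hφ.deriv.integrable_smul hpl), h1, h2,
        sub_self])
  simp only [smul_zero, integral_zero, zero_add] at hM
  have hlc : LocallyIntegrable fun x => f x - p x - M :=
    (hf.sub hpl).sub continuous_const.locallyIntegrable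
  refine ⟨M, ?_⟩
  filter_upwards [isOpen_Ioo.ae_eq_zero_of_integral_contDiff_smul_eq_zero (U := Ioo a b)
    (hlc.locallyIntegrableOn _) (fun ψ h1 h2 h3 => by
      have hψ : IsTest (Ioo a b) ψ := ⟨h1, h2, h3⟩
      have i1 : Integrable fun x => ψ x • (f x - p x) := hψ.integrable_smul (hf.sub hpl)
      simp only [smul_sub _ _ M]
      rw [integral_sub i1
        (hψ.integrable_smul continuous_const.locallyIntegrable), integral_smul_const]
      exact sub_eq_zero.2 (hM ψ hψ))] with y hy hyI
  rw [← sub_eq_zero, ← hy hyI]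
  abel

/-- The local constants of integration form a locally constant function `c` on `Ω`, which has
derivative zero, and `f` is `c` plus a global primitive. Connectedness of `Ω` plays no role. -/
lemma isWeakDeriv_of_isPrimitiveOn [CompleteSpace E] {Ω : Set ℝ} (hΩ : IsOpen Ω) {f d : ℝ → E}
    (hd : LocallyIntegrable d)
    (h : ∀ x ∈ Ω, ∃ u ∈ 𝓝 x, IsPrimitiveOn u f d) : IsWeakDeriv Ω f d := by
  choose! u hu c hc using h
  set p : ℝ → E := fun x => ∫ t in (0 : ℝ)..x, d t with hp
  have hpl : LocallyIntegrable p := (continuous_primitive_of_locallyIntegrable hd).locallyIntegrable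
  have hconst : ∀ x ∈ Ω, ∀ᶠ y in 𝓝 x, c y = c x := fun x hx => by
    filter_upwards [eventually_mem_nhds_iff.2 (hu x hx), hΩ.mem_nhds hx] with y hy hyI
    obtain ⟨a, b, hab, hsub⟩ := mem_nhds_iff_exists_Ioo_subset.1 (inter_mem hy (hu y hyI))
    obtain ⟨z, hz, h1, h2⟩ := exists_mem_Ioo_of_ae ((hc x hx).and (hc y hyI)) (hab.1.trans hab.2)
    exact add_right_cancel ((h2 (hsub hz).2).symm.trans (h1 (hsub hz).1))
  have hcd : ∀ x ∈ Ω, HasDerivAt c 0 x := fun x hx =>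
    (hasDerivAt_const x (c x)).congr_of_eventuallyEq (hconst x hx)
  have hcc : ContinuousOn c Ω := fun x hx => (hcd x hx).continuousAt.continuousWithinAt
  have hcw := isWeakDeriv_iff.1 (isWeakDeriv_of_hasDerivAt hΩ hcd continuousOn_const)
  have hfae : ∀ᵐ y, y ∈ Ω → f y = c y + p y := by
    rw [ae_iff]
    refine measure_null_of_locally_null _ fun x hx => ?_
    have hxI : x ∈ Ω := by
      by_contra hxI
      exact hx fun h => absurd h hxI
    refine ⟨{y | y ∈ u x ∧ c y = c x} ∩ {y | ¬(y ∈ Ω → f y = c y + p y)},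
      inter_mem (mem_nhdsWithin_of_mem_nhds (inter_mem (hu x hxI) (hconst x hxI)))
        self_mem_nhdsWithin, ?_⟩
    refine measure_mono_null (fun y hy => ?_) (ae_iff.1 (hc x hxI))
    rintro h
    exact hy.2 fun hyI => by rw [hy.1.2]; exact h hy.1.1
  rw [isWeakDeriv_iff]
  intro φ hφ
  have h2 := isWeakDeriv_iff.1 (isWeakDeriv_primitive hd Ω) φ hφ
  have h1 := hcw φ hφ
  simp only [smul_zero, integral_zero, neg_zero] at h1
  rw [← h2, ← zero_add (∫ x, deriv φ x • ∫ t in (0 : ℝ)..x, d t), ← h1,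
    ← integral_add (hφ.deriv.integrable_smul_of_continuousOn hΩ hcc) (hφ.deriv.integrable_smul hpl)]
  refine integral_congr_ae ?_
  filter_upwards [hfae] with x hx
  by_cases hxs : x ∈ tsupport (deriv φ)
  · rw [hx (hφ.deriv.3 hxs), smul_add]
  · simp [image_eq_zero_of_notMem_tsupport hxs]

/-- A function with second distributional derivative `k` on an interval has a weak derivative,
which is a primitive of `k`. -/
lemma exists_isWeakDeriv_of_second [CompleteSpace E] {a b : ℝ} (hab : a < b) {f k : ℝ → E}
    (hf : LocallyIntegrable f) (hk : LocallyIntegrable k)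
    (h : ∀ φ, IsTest (Ioo a b) φ → ∫ x, deriv (deriv φ) x • f x = ∫ x, φ x • k x) :
    ∃ c : E, IsWeakDeriv (Ioo a b) f (fun x => c + ∫ t in (0 : ℝ)..x, k t) := by
  set p : ℝ → E := fun x => ∫ t in (0 : ℝ)..x, k t with hp
  have hpl : LocallyIntegrable p := (continuous_primitive_of_locallyIntegrable hk).locallyIntegrable
  have hpw := isWeakDeriv_iff.1 (isWeakDeriv_primitive hk (Ioo a b))
  -- With `p` a primitive of `k`, the functional `ψ ↦ ∫ (ψ' f + ψ p)` vanishes on derivatives, so it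
  -- is `(∫ ψ) M`; this says that `p - M` is the weak derivative of `f`.
  obtain ⟨M, hM⟩ := exists_integral_test_eq_smul hab hf hpl (fun φ hφ => by
    rw [h φ hφ, hpw φ hφ, add_neg_cancel])
  refine ⟨-M, isWeakDeriv_iff.2 fun ψ hψ => ?_⟩
  simp only [smul_add]
  rw [integral_add (hψ.integrable_smul continuous_const.locallyIntegrable)
    (hψ.integrable_smul hpl), integral_smul_const, eq_sub_of_add_eq (hM ψ hψ), smul_neg]
  abel

end WeakDerivatives

/-! ### Gaps of uniformly discrete sets. -/

section UniformlyDiscrete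

variable {P : Set ℝ}

lemma UniformlyDiscrete.isClosed (hP : UniformlyDiscrete P) : IsClosed P := by
  obtain ⟨d, hd0, hsep⟩ := hP
  refine Metric.isClosed_of_pairwise_le_dist hd0 fun x hx y hy hxy => ?_
  exact (hsep x hx y hy hxy).trans_eq (Real.dist_eq x y).symm

lemma UniformlyDiscrete.volume_eq_zero (hP : UniformlyDiscrete P) : volume P = 0 := by
  obtain ⟨d, hd0, hsep⟩ := hP
  refine Set.Countable.measure_zero ?_ _
  have : DiscreteTopology P := DiscreteTopology.of_forall_le_dist hd0 fun x y hxy =>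
    (hsep x x.2 y y.2 (fun h => hxy (Subtype.ext h))).trans_eq (Real.dist_eq (x : ℝ) y).symm
  exact Set.countable_coe_iff.mp (TopologicalSpace.separableSpace_iff_countable.mp inferInstance)

/-- With `δ` half the separation, the open interval of radius `δ` about any point contains at most
one point of `P`. So even very close to `P` one side is free for the length `δ`, and this uniform
length later gives a bound independent of the point. -/
lemma UniformlyDiscrete.exists_gap (hP : UniformlyDiscrete P) :
    ∃ δ : ℝ, 0 < δ ∧ (∀ q ∈ P, Ioo q (q + δ) ⊆ Pᶜ ∧ Ioo (q - δ) q ⊆ Pᶜ) ∧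
      (∀ x ∉ P, ∃ a b, x ∈ Ioo a b ∧ Ioo a b ⊆ Pᶜ ∧ (x + δ ≤ b ∨ a ≤ x - δ)) := by
  have hcl := hP.isClosed
  obtain ⟨d, hd0, hsep⟩ := hP
  refine ⟨d / 2, by linarith, fun q hq => ⟨fun x hx hxP => ?_, fun x hx hxP => ?_⟩, fun x hx => ?_⟩
  · have := hsep q hq x hxP hx.1.ne
    rw [abs_sub_comm, abs_of_pos (by linarith [hx.1])] at this
    linarith [hx.2]
  · have := hsep q hq x hxP hx.2.ne'
    rw [abs_of_pos (by linarith [hx.2])] at this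
    linarith [hx.1]
  · obtain ⟨a, b, hab, hsub⟩ := mem_nhds_iff_exists_Ioo_subset.1 (hcl.isOpen_compl.mem_nhds hx)
    by_cases h : ∃ p ∈ P, p ∈ Ioo x (x + d / 2)
    · obtain ⟨p, hp, hxp⟩ := h
      refine ⟨min a (x - d / 2), b, ⟨(min_le_left _ _).trans_lt hab.1, hab.2⟩, fun y hy hyP => ?_,
        Or.inr (min_le_right _ _)⟩
      by_cases hay : a < y
      · exact hsub ⟨hay, hy.2⟩ hyP
      · have hy1 := hy.1
        rw [min_lt_iff] at hy1
        have h1 : x - d / 2 < y := by grind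
        have h2 : y < x := (not_lt.1 hay).trans_lt hab.1
        have := hsep p hp y hyP (by linarith [hxp.1])
        rw [abs_of_pos (by linarith [hxp.1])] at this
        linarith [hxp.2]
    · refine ⟨a, max b (x + d / 2), ⟨hab.1, hab.2.trans_le (le_max_left _ _)⟩, fun y hy hyP => ?_,
        Or.inl (le_max_right _ _)⟩
      by_cases hyb : y < b
      · exact hsub ⟨hy.1, hyb⟩ hyP
      · have hy2 := hy.2
        rw [lt_max_iff] at hy2
        exact h ⟨y, hyP, hab.2.trans_le (not_lt.1 hyb), by grind⟩

end UniformlyDiscrete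

/-! ### Green's formula. -/

section Green

variable {E : Type*} [NormedAddCommGroup E] [InnerProductSpace ℂ E]

/-- The jump at a point of the Wronskian `⟪f', g⟫ - ⟪f, g'⟫` in terms of the boundary values. -/
def wronskianJump (b c : BoundaryValues E) : ℂ :=
  (inner ℂ b.2.2 c.1.2 - inner ℂ b.1.2 c.2.2) - (inner ℂ b.2.1 c.1.1 - inner ℂ b.1.1 c.2.1)

/-- Boundary conditions that coincide with their complement with respect to the jump of the
Wronskian. -/
def IsLagrangian (L : Submodule ℂ (BoundaryValues E)) : Prop :=
  ∀ c, c ∈ L ↔ ∀ b ∈ L, wronskianJump b c = 0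

/-- The functions `f` and `d` have the boundary values `b` at `q`. -/
structure HasBoundaryValues (f d : ℝ → E) (q : ℝ) (b : BoundaryValues E) : Prop where
  left : HasLeftValue f q b.1.1
  right : HasRightValue f q b.1.2
  derivLeft : HasLeftValue d q b.2.1
  derivRight : HasRightValue d q b.2.2

lemma L2.locallyIntegrable {E : Type*} [NormedAddCommGroup E] (f : L2 E) : LocallyIntegrable f :=
  (Lp.memLp f).locallyIntegrable (by norm_num)

/-- The mixed terms `⟪d, e⟫` of the two product rules cancel. -/
lemma isPrimitiveOn_wronskian [CompleteSpace E] {Ω : Set ℝ} {f d k g e m : L2 E}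
    (hf : IsWeakDeriv Ω f d) (hd : IsWeakDeriv Ω d k) (hg : IsWeakDeriv Ω g e)
    (he : IsWeakDeriv Ω e m) {a b : ℝ} (hΩ : Ioo a b ⊆ Ω) :
    IsPrimitiveOn (Ioo a b) (fun x => inner ℂ (d x) (g x) - inner ℂ (f x) (e x))
      (fun x => inner ℂ (k x) (g x) - inner ℂ (f x) (m x)) := by
  -- The inner product is conjugate linear on the left, so it is bilinear only over `ℝ`.
  set B : E →L[ℝ] E →L[ℝ] ℂ :=
    (isBoundedBilinearMap_inner (𝕜 := ℂ) (E := E)).toContinuousLinearMap with hB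
  have i : ∀ u v : L2 E, LocallyIntegrable fun x => inner ℂ (u x) (v x) := fun u v =>
    (L2.integrable_inner u v).locallyIntegrable
  have p : ∀ u v : L2 E, IsWeakDeriv Ω u v → IsPrimitiveOn (Ioo a b) u v := fun u v h =>
    h.isPrimitiveOn (L2.locallyIntegrable u) (L2.locallyIntegrable v) hΩ
  have h1 := (p d k hd).bilin B (p g e hg) (L2.locallyIntegrable k) (L2.locallyIntegrable e)
    ((i k g).add (i d e))
  have h2 := (p f d hf).bilin B (p e m he) (L2.locallyIntegrable d) (L2.locallyIntegrable m)
    ((i d e).add (i f m))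
  refine (h1.sub h2 ((i k g).add (i d e)) ((i d e).add (i f m))).congr_ae
    (Eventually.of_forall fun x => rfl) (Eventually.of_forall fun x => ?_)
  change inner ℂ (k x) (g x) + inner ℂ (d x) (e x) - (inner ℂ (d x) (e x) + inner ℂ (f x) (m x)) = _
  ring

/-- Integrability of `W` and `w` makes the contributions of `±∞` vanish, so each half-line
contributes only its boundary value at `q`. -/
lemma integral_eq_of_isPrimitiveOn_off {W w : ℝ → ℂ} (hW : Integrable W) (hw : Integrable w) {q : ℝ}
    (h : ∀ x ≠ q, ∃ u ∈ 𝓝 x, IsPrimitiveOn u W w) {l r : ℂ} (hl : HasLeftValue W q l)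
    (hr : HasRightValue W q r) : ∫ x, w x = l - r := by
  have h1 := (IsPrimitiveOn.of_locally isPreconnected_Ioi
    fun x (hx : x ∈ Ioi q) => h x hx.ne').hasRightValue_Ioi hW hw
  have h2 := (IsPrimitiveOn.of_locally isPreconnected_Iio
    fun x (hx : x ∈ Iio q) => h x hx.ne).hasLeftValue_Iio hW hw
  rw [tendsto_nhds_unique hl h2, tendsto_nhds_unique hr h1, sub_neg_eq_add,
    intervalIntegral.integral_Iic_add_Ioi hw.integrableOn hw.integrableOn]

variable {P : Set ℝ}

lemma HasBoundaryValues.wronskian {f d g e : ℝ → E} {q : ℝ} {b c : BoundaryValues E}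
    (hb : HasBoundaryValues f d q b) (hc : HasBoundaryValues g e q c) :
    HasLeftValue (fun x => inner ℂ (d x) (g x) - inner ℂ (f x) (e x)) q
      (inner ℂ b.2.1 c.1.1 - inner ℂ b.1.1 c.2.1) ∧
    HasRightValue (fun x => inner ℂ (d x) (g x) - inner ℂ (f x) (e x)) q
      (inner ℂ b.2.2 c.1.2 - inner ℂ b.1.2 c.2.2) :=
  ⟨(hb.derivLeft.inner hc.left).sub (hb.left.inner hc.derivLeft),
    (hb.derivRight.inner hc.right).sub (hb.right.inner hc.derivRight)⟩

/-- Green's formula: if the boundary form vanishes at all points of `P` but `q`, then only the term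
of `q` is left. -/
lemma integral_wronskian_eq [CompleteSpace E] (hP : UniformlyDiscrete P) {f d k g e m : L2 E}
    (hf : IsWeakDeriv Pᶜ f d) (hd : IsWeakDeriv Pᶜ d k) (hg : IsWeakDeriv Pᶜ g e)
    (he : IsWeakDeriv Pᶜ e m) {b c : ℝ → BoundaryValues E}
    (hb : ∀ p ∈ P, HasBoundaryValues f d p (b p)) (hc : ∀ p ∈ P, HasBoundaryValues g e p (c p))
    {q : ℝ} (h0 : ∀ p ∈ P, p ≠ q → wronskianJump (b p) (c p) = 0) {l r : ℂ}
    (hl : HasLeftValue (fun x => inner ℂ (d x) (g x) - inner ℂ (f x) (e x)) q l)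
    (hr : HasRightValue (fun x => inner ℂ (d x) (g x) - inner ℂ (f x) (e x)) q r) :
    ∫ x, (inner ℂ (k x) (g x) - inner ℂ (f x) (m x)) = l - r := by
  have hw := (L2.integrable_inner (𝕜 := ℂ) k g).sub (L2.integrable_inner (𝕜 := ℂ) f m)
  refine integral_eq_of_isPrimitiveOn_off
    ((L2.integrable_inner d g).sub (L2.integrable_inner f e)) hw (fun x hxq => ?_) hl hr
  obtain ⟨δ, hδ, hgap, hloc⟩ := hP.exists_gap
  by_cases hx : x ∈ P
  · refine ⟨Ioo (x - δ) (x + δ), Ioo_mem_nhds (by linarith) (by linarith), ?_⟩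
    have hv := (hb x hx).wronskian (hc x hx)
    -- A vanishing jump means equal one-sided values of the Wronskian, so it stays a primitive
    -- across `x`. Points of `P` other than `q` thus disappear without a sum over an infinite set.
    refine IsPrimitiveOn.join (by linarith) (by linarith) hw.locallyIntegrable
      (isPrimitiveOn_wronskian hf hd hg he (hgap x hx).2)
      (isPrimitiveOn_wronskian hf hd hg he (hgap x hx).1) hv.1 ?_
    rw [← sub_eq_zero.1 (h0 x hx hxq)]
    exact hv.2
  · obtain ⟨a', b', hxab, hsub, -⟩ := hloc x hx
    exact ⟨_, Ioo_mem_nhds hxab.1 hxab.2, isPrimitiveOn_wronskian hf hd hg he hsub⟩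

/-- The line is split at the arbitrary point `0`: either it lies in `P` and its jump vanishes, or
the Wronskian is continuous there. -/
lemma integral_wronskian_eq_zero [CompleteSpace E] (hP : UniformlyDiscrete P) {f d k g e m : L2 E}
    (hf : IsWeakDeriv Pᶜ f d) (hd : IsWeakDeriv Pᶜ d k) (hg : IsWeakDeriv Pᶜ g e)
    (he : IsWeakDeriv Pᶜ e m) {b c : ℝ → BoundaryValues E}
    (hb : ∀ p ∈ P, HasBoundaryValues f d p (b p)) (hc : ∀ p ∈ P, HasBoundaryValues g e p (c p))
    (h0 : ∀ p ∈ P, wronskianJump (b p) (c p) = 0) :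
    ∫ x, (inner ℂ (k x) (g x) - inner ℂ (f x) (m x)) = 0 := by
  by_cases h : (0 : ℝ) ∈ P
  · have hv := (hb 0 h).wronskian (hc 0 h)
    rw [integral_wronskian_eq hP hf hd hg he hb hc (fun p hp _ => h0 p hp) hv.1 hv.2,
      ← neg_sub, neg_eq_zero]
    exact h0 0 h
  · obtain ⟨δ, hδ, -, hloc⟩ := hP.exists_gap
    obtain ⟨a, a', h0I, hsub, -⟩ := hloc 0 h
    obtain ⟨v, hv⟩ := isPrimitiveOn_wronskian hf hd hg he hsub
    have hw := (L2.integrable_inner (𝕜 := ℂ) k g).sub (L2.integrable_inner (𝕜 := ℂ) f m)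
    rw [integral_wronskian_eq hP hf hd hg he hb hc (fun p hp _ => h0 p hp)
      (HasLeftValue.of_primitive h0I.1 hw.locallyIntegrable
        (hv.mono fun y hy hyI => hy ⟨hyI.1, hyI.2.trans h0I.2⟩))
      (HasRightValue.of_primitive h0I.2 hw.locallyIntegrable
        (hv.mono fun y hy hyI => hy ⟨h0I.1.trans hyI.1, hyI.2⟩)), sub_self]

end Green

/-! ### Square integrability from local averages. -/

section LocalAverages

open scoped ENNReal

/-- Cauchy–Schwarz against the constant `1`. -/
lemma sq_lintegral_le {μ : Measure ℝ} {k : ℝ → ℝ≥0∞} (hk : AEMeasurable k μ) :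
    (∫⁻ y, k y ∂μ) ^ 2 ≤ μ univ * ∫⁻ y, k y ^ 2 ∂μ := by
  have h := ENNReal.lintegral_mul_le_Lp_mul_Lq μ (p := 2) (q := 2) (by constructor <;> norm_num)
    (f := fun _ => 1) (g := k) aemeasurable_const hk
  simp only [Pi.mul_apply, one_mul, ENNReal.one_rpow, lintegral_one] at h
  refine (pow_le_pow_left' h 2).trans_eq ?_
  rw [mul_pow, ← ENNReal.rpow_natCast, ← ENNReal.rpow_natCast, ← ENNReal.rpow_mul,
    ← ENNReal.rpow_mul]
  norm_num

/-- Tonelli, with the symmetric condition `|x - y| < δ`. -/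
lemma lintegral_lintegral_Ioo {k : ℝ → ℝ≥0∞} (hk : AEMeasurable k volume) (δ : ℝ) :
    ∫⁻ x, ∫⁻ y in Ioo (x - δ) (x + δ), k y = ENNReal.ofReal (2 * δ) * ∫⁻ y, k y := by
  have hS : MeasurableSet {z : ℝ × ℝ | z.2 ∈ Ioo (z.1 - δ) (z.1 + δ)} :=
    (measurableSet_lt (f := fun z : ℝ × ℝ => z.1 - δ) (g := fun z => z.2)
      (by fun_prop) (by fun_prop)).inter
      (measurableSet_lt (f := fun z : ℝ × ℝ => z.2) (g := fun z => z.1 + δ)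
        (by fun_prop) (by fun_prop))
  simp_rw [← lintegral_indicator measurableSet_Ioo]
  rw [lintegral_lintegral_swap]
  · rw [← lintegral_const_mul'' _ hk]
    refine lintegral_congr fun y => ?_
    have : (fun x => (Ioo (x - δ) (x + δ)).indicator k y)
        = (Ioo (y - δ) (y + δ)).indicator fun _ => k y := by
      ext x
      simp only [indicator, mem_Ioo]
      congr 1
      simp only [eq_iff_iff]
      constructor <;> rintro ⟨h1, h2⟩ <;> constructor <;> linarith
    rw [this, lintegral_indicator measurableSet_Ioo, setLIntegral_const, Real.volume_Ioo, mul_comm]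
    congr 2
    ring
  · have : (Function.uncurry fun x y => (Ioo (x - δ) (x + δ)).indicator k y)
        = {z : ℝ × ℝ | z.2 ∈ Ioo (z.1 - δ) (z.1 + δ)}.indicator fun z => k z.2 := by
      ext ⟨x, y⟩
      simp [indicator, Function.uncurry]
    rw [this]
    exact (hk.comp_quasiMeasurePreserving Measure.quasiMeasurePreserving_snd).indicator hS

/-- A function that is pointwise bounded by local averages of a square integrable function is
square integrable. -/
lemma memLp_two_of_le_local_integral {E : Type*} [NormedAddCommGroup E] {e : ℝ → E} {k : ℝ → ℝ}
    (he : AEStronglyMeasurable e) (hk : MemLp k 2) {M δ : ℝ}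
    (h : ∀ᵐ x, ‖e x‖ ≤ M * ∫ y in Ioo (x - δ) (x + δ), ‖k y‖) : MemLp e 2 := by
  refine ⟨he, ?_⟩
  rw [eLpNorm_lt_top_iff_lintegral_rpow_enorm_lt_top (by norm_num) (by norm_num)]
  have hkm : AEMeasurable (fun y => ‖k y‖ₑ) volume := hk.1.enorm
  have hkL : ∫⁻ y, ‖k y‖ₑ ^ 2 < ⊤ := by
    have := (eLpNorm_lt_top_iff_lintegral_rpow_enorm_lt_top (by norm_num) (by norm_num)).1 hk.2
    simpa using this
  calc ∫⁻ x, ‖e x‖ₑ ^ (2 : ℝ≥0∞).toReal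
      ≤ ∫⁻ x, (ENNReal.ofReal M ^ 2 * ENNReal.ofReal (2 * δ)) *
          ∫⁻ y in Ioo (x - δ) (x + δ), ‖k y‖ₑ ^ 2 := by
        refine lintegral_mono_ae ?_
        filter_upwards [h] with x hx
        have hki : Integrable k (volume.restrict (Ioo (x - δ) (x + δ))) :=
          (hk.restrict _).integrable (by norm_num)
        have h1 : ‖e x‖ₑ ≤ ENNReal.ofReal M * ∫⁻ y in Ioo (x - δ) (x + δ), ‖k y‖ₑ := by
          rw [← ofReal_norm]
          refine (ENNReal.ofReal_le_ofReal hx).trans ?_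
          rw [ENNReal.ofReal_mul' (integral_nonneg fun _ => norm_nonneg _),
            ofReal_integral_norm_eq_lintegral_enorm hki]
        have h2 := sq_lintegral_le (μ := volume.restrict (Ioo (x - δ) (x + δ))) hkm.restrict
        rw [Measure.restrict_apply_univ, Real.volume_Ioo,
          show x + δ - (x - δ) = 2 * δ by ring] at h2
        simp only [ENNReal.toReal_ofNat, ENNReal.rpow_ofNat]
        calc ‖e x‖ₑ ^ 2 ≤ (ENNReal.ofReal M * ∫⁻ y in Ioo (x - δ) (x + δ), ‖k y‖ₑ) ^ 2 := by
              gcongr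
          _ ≤ _ := by
              rw [mul_pow, mul_assoc]
              gcongr
    _ = (ENNReal.ofReal M ^ 2 * ENNReal.ofReal (2 * δ)) *
          (ENNReal.ofReal (2 * δ) * ∫⁻ y, ‖k y‖ₑ ^ 2) := by
        rw [lintegral_const_mul' _ _ (ENNReal.mul_ne_top
          (ENNReal.pow_ne_top ENNReal.ofReal_ne_top) ENNReal.ofReal_ne_top),
          lintegral_lintegral_Ioo (hkm.pow_const 2) δ]
    _ < ⊤ := by
        refine ENNReal.mul_lt_top (ENNReal.mul_lt_top (ENNReal.pow_lt_top ENNReal.ofReal_lt_top)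
          ENNReal.ofReal_lt_top) ?_
        exact ENNReal.mul_lt_top ENNReal.ofReal_lt_top hkL

end LocalAverages

/-! ### Square integrability of the first derivative. -/

section Regularity

variable {E : Type*} [NormedAddCommGroup E] [InnerProductSpace ℂ E] [CompleteSpace E]

lemma IsTest.translate {η : ℝ → ℝ} {a b : ℝ} (hη : IsTest (Ioo a b) η) (x : ℝ) :
    IsTest (Ioo (x + a) (x + b)) fun y => η (y - x) := by
  have h : tsupport (fun y => η (y - x)) ⊆ (fun y => y - x) ⁻¹' tsupport η :=
    tsupport_comp_subset_preimage η (by fun_prop)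
  refine ⟨hη.1.comp (contDiff_id.sub contDiff_const),
    hη.2.comp_homeomorph (Homeomorph.subRight x), fun y hy => ?_⟩
  have := hη.3 (h hy)
  constructor <;> linarith [this.1, this.2]

/-- The value of the derivative is controlled by local integrals of the function and of the second
derivative. -/
lemma norm_le_of_isWeakDeriv {g k : ℝ → E} (hg : LocallyIntegrable g) (hk : LocallyIntegrable k)
    {c : E} {I : Set ℝ} (h : IsWeakDeriv I g (fun y => c + ∫ t in (0 : ℝ)..y, k t))
    {η : ℝ → ℝ} {x δ M : ℝ} (hη : IsTest I η) (hηx : tsupport η ⊆ Ioo (x - δ) (x + δ))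
    (hη0 : ∀ y, 0 ≤ η y) (hη1 : ∫ y, η y = 1) (hM : ∀ y, ‖deriv η y‖ ≤ M) :
    ‖c + ∫ t in (0 : ℝ)..x, k t‖ ≤
      M * (∫ y in Ioo (x - δ) (x + δ), ‖g y‖) + ∫ y in Ioo (x - δ) (x + δ), ‖k y‖ := by
  set p : ℝ → E := fun y => ∫ t in (0 : ℝ)..y, k t with hp
  have hpc : Continuous p := continuous_primitive_of_locallyIntegrable hk
  have hi := fun y => (hk.intervalIntegrable_real (0 : ℝ) y)
  have hgJ : IntegrableOn g (Ioo (x - δ) (x + δ)) :=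
    (hg.integrableOn_isCompact isCompact_Icc).mono_set Ioo_subset_Icc_self
  have hkJ : IntegrableOn k (Ioo (x - δ) (x + δ)) :=
    (hk.integrableOn_isCompact isCompact_Icc).mono_set Ioo_subset_Icc_self
  have hηi : Integrable η := hη.continuous.integrable_of_hasCompactSupport hη.2
  -- Since `∫ η = 1`, the value at `x` is the `η`-average of the derivative minus the averaged
  -- increment `p y - p x`. The average is an integral of `g` by the weak derivative, the increment
  -- an integral of `k`.
  have e1 : c + p x = -(∫ y, deriv η y • g y) - ∫ y, η y • (p y - p x) := by
    have i1 : Integrable fun y => η y • (c + p y) :=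
      hη.integrable_smul (continuous_const.add hpc).locallyIntegrable
    have i2 : Integrable fun y => η y • (p y - p x) :=
      hη.integrable_smul (hpc.sub continuous_const).locallyIntegrable
    have h' : ∫ y, deriv η y • g y = -∫ y, η y • (c + p y) := isWeakDeriv_iff.1 h η hη
    rw [h', neg_neg, ← integral_sub i1 i2]
    have : ∀ y, η y • (c + p y) - η y • (p y - p x) = η y • (c + p x) := fun y => by
      rw [← smul_sub]; congr 1; abel
    simp_rw [this]
    rw [integral_smul_const, hη1, one_smul]
  have b1 : ‖∫ y, deriv η y • g y‖ ≤ M * ∫ y in Ioo (x - δ) (x + δ), ‖g y‖ := by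
    rw [← integral_const_mul, ← setIntegral_eq_integral_of_forall_compl_eq_zero
      (s := Ioo (x - δ) (x + δ)) (f := fun y => deriv η y • g y)]
    · refine norm_integral_le_of_norm_le (hgJ.norm.const_mul M) (Eventually.of_forall fun y => ?_)
      rw [norm_smul]
      gcongr
      exact hM y
    · intro y hy
      rw [image_eq_zero_of_notMem_tsupport fun h' => hy (hηx (tsupport_deriv_subset h')), zero_smul]
  have b2 : ‖∫ y, η y • (p y - p x)‖ ≤ ∫ y in Ioo (x - δ) (x + δ), ‖k y‖ := by
    have : ∫ y in Ioo (x - δ) (x + δ), ‖k y‖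
        = ∫ y, η y * ∫ y in Ioo (x - δ) (x + δ), ‖k y‖ := by
      rw [integral_mul_const, hη1, one_mul]
    rw [this]
    refine norm_integral_le_of_norm_le (hηi.mul_const _) (Eventually.of_forall fun y => ?_)
    by_cases hy : y ∈ tsupport η
    · rw [norm_smul, Real.norm_of_nonneg (hη0 y)]
      refine mul_le_mul_of_nonneg_left ?_ (hη0 y)
      simp only [hp]
      rw [intervalIntegral.integral_interval_sub_left (hi _) (hi _)]
      refine (intervalIntegral.norm_integral_le_integral_norm_uIoc).trans ?_
      refine setIntegral_mono_set hkJ.norm (Eventually.of_forall fun _ => norm_nonneg _)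
        (LE.le.eventuallyLE fun t ht => ?_)
      have hyJ := hηx hy
      -- Positivity of `δ` is read off from the nonempty interval.
      have hxJ : x ∈ Ioo (x - δ) (x + δ) := by
        constructor <;> linarith [hyJ.1.trans hyJ.2]
      exact ordConnected_Ioo.uIcc_subset hxJ hyJ (uIoc_subset_uIcc ht)
    · simp [image_eq_zero_of_notMem_tsupport hy]
  change ‖c + p x‖ ≤ _
  rw [e1]
  refine (norm_sub_le _ _).trans ?_
  rw [norm_neg]
  exact add_le_add b1 b2

lemma IsWeakDeriv.ae_unique {Ω : Set ℝ} (hΩ : IsOpen Ω) {f g g' : ℝ → E} (h : IsWeakDeriv Ω f g)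
    (h' : IsWeakDeriv Ω f g') (hg : LocallyIntegrable g) (hg' : LocallyIntegrable g') :
    ∀ᵐ x, x ∈ Ω → g x = g' x := by
  filter_upwards [hΩ.ae_eq_zero_of_integral_contDiff_smul_eq_zero
    ((hg.sub hg').locallyIntegrableOn Ω) (fun φ h1 h2 h3 => by
      have hφ : IsTest Ω φ := ⟨h1, h2, h3⟩
      simp only [Pi.sub_apply, smul_sub]
      rw [integral_sub (hφ.integrable_smul hg) (hφ.integrable_smul hg'), sub_eq_zero, ← neg_inj,
        ← h φ h1 h2 h3, ← h' φ h1 h2 h3])] with x hx hxΩ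
  exact sub_eq_zero.1 (hx hxΩ)

/-- Being a primitive is checked locally, so the detour through primitives replaces a partition of
unity. -/
lemma isWeakDeriv_of_locally {Ω : Set ℝ} (hΩ : IsOpen Ω) {f d : ℝ → E} (hf : LocallyIntegrable f)
    (hd : LocallyIntegrable d) (h : ∀ x ∈ Ω, ∃ u ∈ 𝓝 x, IsWeakDeriv u f d) :
    IsWeakDeriv Ω f d := by
  refine isWeakDeriv_of_isPrimitiveOn hΩ hd fun x hx => ?_
  obtain ⟨u, hu, hw⟩ := h x hx
  obtain ⟨a, b, hab, hsub⟩ := mem_nhds_iff_exists_Ioo_subset.1 hu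
  exact ⟨_, Ioo_mem_nhds hab.1 hab.2, hw.isPrimitiveOn hf hd hsub⟩

/-- A square integrable function whose second distributional derivative off a uniformly discrete
set is square integrable has a square integrable weak derivative. -/
lemma exists_weakDeriv_of_second {P : Set ℝ} (hP : UniformlyDiscrete P) (g k : L2 E)
    (h : ∀ φ, IsTest Pᶜ φ → ∫ x, deriv (deriv φ) x • g x = ∫ x, φ x • k x) :
    ∃ e : L2 E, IsWeakDeriv Pᶜ g e ∧ IsWeakDeriv Pᶜ e k := by
  have hcl := hP.isClosed
  have hnull : ∀ᵐ x, x ∉ P := measure_eq_zero_iff_ae_notMem.mp hP.volume_eq_zero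
  obtain ⟨δ, hδ, -, hloc⟩ := hP.exists_gap
  have hgl := L2.locallyIntegrable g
  have hkl := L2.locallyIntegrable k
  choose! a b hx hsub hlong using hloc
  have hex : ∀ x ∉ P, ∃ c : E,
      IsWeakDeriv (Ioo (a x) (b x)) g (fun y => c + ∫ t in (0 : ℝ)..y, k t) := fun x hxP =>
    exists_isWeakDeriv_of_second ((hx x hxP).1.trans (hx x hxP).2) hgl hkl
      fun φ hφ => h φ (hφ.mono (hsub x hxP))
  choose! c hc using hex
  set p : ℝ → E := fun y => ∫ t in (0 : ℝ)..y, k t with hp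
  have hpc : Continuous p := continuous_primitive_of_locallyIntegrable hkl
  set e : ℝ → E := fun x => c x + p x with he
  -- The intervals and constants are chosen separately for each `x`. On an overlap both candidates
  -- are the weak derivative of `g`, so the constants coincide; hence `e` is continuous off `P`, and
  -- in particular measurable.
  have hconst : ∀ x ∉ P, ∀ y ∈ Ioo (a x) (b x), c y = c x := by
    intro x hxP y hy
    have hyP : y ∉ P := hsub x hxP hy
    have hcap : Ioo (max (a x) (a y)) (min (b x) (b y)) ⊆ Ioo (a x) (b x) ∩ Ioo (a y) (b y) := by
      rw [Ioo_inter_Ioo]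
    have hne : max (a x) (a y) < min (b x) (b y) :=
      (max_lt hy.1 (hx y hyP).1).trans (lt_min hy.2 (hx y hyP).2)
    have hu := ((hc x hxP).mono (hcap.trans inter_subset_left)).ae_unique isOpen_Ioo
      ((hc y hyP).mono (hcap.trans inter_subset_right))
      (continuous_const.add hpc).locallyIntegrable (continuous_const.add hpc).locallyIntegrable
    obtain ⟨z, hz, hzz⟩ := exists_mem_Ioo_of_ae hu hne
    exact (add_right_cancel (hzz hz)).symm
  have hnhds : ∀ x ∉ P, Ioo (a x) (b x) ∈ 𝓝 x := fun x hxP => Ioo_mem_nhds (hx x hxP).1 (hx x hxP).2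
  have hecont : ContinuousOn e Pᶜ := fun x hxP => by
    refine ContinuousAt.continuousWithinAt (ContinuousAt.add ?_ hpc.continuousAt)
    refine (continuousAt_const (y := c x)).congr ?_
    filter_upwards [hnhds x hxP] with y hy
    exact (hconst x hxP y hy).symm
  have hemeas : AEStronglyMeasurable e := by
    have h1 := hecont.aestronglyMeasurable (μ := volume) hcl.isOpen_compl.measurableSet
    rwa [Measure.restrict_eq_self_of_ae_mem (s := Pᶜ) hnull] at h1
  -- One bump sits to the right of `0` and one to the left; translated to `x`, the one on the free
  -- side is used. As only translates occur, the bound on the derivative does not depend on `x`.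
  obtain ⟨η₁, hη₁, hη₁0, hη₁1⟩ := exists_isTest_integral_eq_one hδ
  obtain ⟨η₂, hη₂, hη₂0, hη₂1⟩ := exists_isTest_integral_eq_one (neg_lt_zero.2 hδ)
  obtain ⟨M₁, hM₁⟩ := hη₁.deriv.2.exists_bound_of_continuous hη₁.deriv.continuous
  obtain ⟨M₂, hM₂⟩ := hη₂.deriv.2.exists_bound_of_continuous hη₂.deriv.continuous
  -- The entry `1` lets `M` also dominate the coefficient of the integral of `‖k‖`.
  set M := max 1 (max M₁ M₂) with hM
  have hderiv : ∀ (η : ℝ → ℝ) (x y : ℝ), deriv (fun z => η (z - x)) y = deriv η (y - x) :=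
    fun η x y => deriv_comp_sub_const η x y
  have hbound : ∀ x ∉ P, ‖e x‖ ≤ M * (∫ y in Ioo (x - δ) (x + δ), ‖g y‖) +
      ∫ y in Ioo (x - δ) (x + δ), ‖k y‖ := by
    intro x hxP
    rcases hlong x hxP with hl | hl
    · have ht := hη₁.translate x
      refine norm_le_of_isWeakDeriv hgl hkl (hc x hxP) (ht.mono ?_) (ht.3.trans ?_)
        (fun y => hη₁0 _) ((integral_sub_right_eq_self η₁ x).trans hη₁1) (fun y => ?_)
      · exact Ioo_subset_Ioo (by linarith [(hx x hxP).1]) hl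
      · exact Ioo_subset_Ioo (by linarith) le_rfl
      · rw [hderiv]
        exact (hM₁ _).trans ((le_max_left _ _).trans (le_max_right _ _))
    · have ht := hη₂.translate x
      refine norm_le_of_isWeakDeriv hgl hkl (hc x hxP) (ht.mono ?_) (ht.3.trans ?_)
        (fun y => hη₂0 _) ((integral_sub_right_eq_self η₂ x).trans hη₂1) (fun y => ?_)
      · exact Ioo_subset_Ioo (by linarith) (by linarith [(hx x hxP).2])
      · exact Ioo_subset_Ioo (by linarith) (by linarith)
      · rw [hderiv]
        exact (hM₂ _).trans ((le_max_right _ _).trans (le_max_right _ _))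
  have hmem : MemLp e 2 := by
    refine memLp_two_of_le_local_integral hemeas ((Lp.memLp g).norm.add (Lp.memLp k).norm) (M := M)
      (δ := δ) ?_
    filter_upwards [hnull] with x hxP
    refine (hbound x hxP).trans ?_
    have i1 : IntegrableOn (fun y => ‖g y‖) (Ioo (x - δ) (x + δ)) :=
      ((hgl.integrableOn_isCompact isCompact_Icc).mono_set Ioo_subset_Icc_self).norm
    have i2 : IntegrableOn (fun y => ‖k y‖) (Ioo (x - δ) (x + δ)) :=
      ((hkl.integrableOn_isCompact isCompact_Icc).mono_set Ioo_subset_Icc_self).norm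
    have e1 : ∫ y in Ioo (x - δ) (x + δ), ‖((fun y => ‖g y‖) + fun y => ‖k y‖) y‖
        = (∫ y in Ioo (x - δ) (x + δ), ‖g y‖) + ∫ y in Ioo (x - δ) (x + δ), ‖k y‖ := by
      rw [← integral_add i1 i2]
      refine integral_congr_ae (Eventually.of_forall fun y => ?_)
      exact Real.norm_of_nonneg (add_nonneg (norm_nonneg _) (norm_nonneg _))
    rw [e1, mul_add]
    gcongr
    exact le_mul_of_one_le_left (integral_nonneg fun _ => norm_nonneg _) (le_max_left _ _)
  have hel : LocallyIntegrable e := hmem.locallyIntegrable (by norm_num)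
  have hae : e =ᵐ[volume] (hmem.toLp e : L2 E) := hmem.coeFn_toLp.symm
  refine ⟨hmem.toLp e, ?_, ?_⟩
  · refine IsWeakDeriv.congr_ae ?_ (EventuallyEq.refl _ _) hae
    refine isWeakDeriv_of_locally hcl.isOpen_compl hgl hel fun x hxP => ⟨_, hnhds x hxP, ?_⟩
    exact (hc x hxP).congr_on fun y hy => by simp only [he, hconst x hxP y hy, hp]
  · refine IsWeakDeriv.congr_ae ?_ hae (EventuallyEq.refl _ _)
    refine isWeakDeriv_of_isPrimitiveOn hcl.isOpen_compl hkl fun x hxP => ⟨_, hnhds x hxP, c x, ?_⟩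
    exact Eventually.of_forall fun y hy => by simp only [he, hconst x hxP y hy, hp]

end Regularity

/-! ### Self-adjointness from Lagrangian boundary conditions. -/

section SelfAdjointness

variable {E : Type*} [NormedAddCommGroup E] [InnerProductSpace ℂ E]

lemma HasBoundaryValues.congr_ae {E : Type*} [NormedAddCommGroup E] {f d f' d' : ℝ → E}
    {q : ℝ} {b : BoundaryValues E} (h : HasBoundaryValues f d q b) (hf : f =ᵐ[volume] f')
    (hd : d =ᵐ[volume] d') :
    HasBoundaryValues f' d' q b :=
  ⟨h.left.congr' (hf.filter_mono inf_le_right), h.right.congr' (hf.filter_mono inf_le_right),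
    h.derivLeft.congr' (hd.filter_mono inf_le_right),
    h.derivRight.congr' (hd.filter_mono inf_le_right)⟩

lemma HasBoundaryValues.of_eventuallyEq_zero {E : Type*} [NormedAddCommGroup E] {f d : ℝ → E}
    {q : ℝ} (hf : f =ᶠ[𝓝 q] 0)
    (hd : d =ᶠ[𝓝 q] 0) : HasBoundaryValues f d q 0 := by
  have key : ∀ {u : ℝ → E}, u =ᶠ[𝓝 q] 0 → ∀ s : Set ℝ,
      Tendsto u (𝓝[s] q ⊓ ae volume) (𝓝 0) := fun hu s =>
    tendsto_const_nhds.congr' (hu.symm.filter_mono (inf_le_left.trans nhdsWithin_le_nhds))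
  exact ⟨key hf _, key hf _, key hd _, key hd _⟩

lemma mem_pointInteractionGraph {P : Set ℝ} {BC : ℝ → Submodule ℂ (BoundaryValues E)}
    {p : L2 E × L2 E} : p ∈ pointInteractionGraph P BC ↔ ∃ d : L2 E, IsWeakDeriv Pᶜ p.1 d ∧
      IsWeakDeriv Pᶜ d (-p.2 : L2 E) ∧ ∀ q ∈ P, ∃ b ∈ BC q, HasBoundaryValues p.1 d q b := by
  refine exists_congr fun d => and_congr_right fun _ => and_congr_right fun _ =>
    forall₂_congr fun q _ => exists_congr fun b => and_congr_right fun _ => ?_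
  exact ⟨fun h => ⟨h.1, h.2.1, h.2.2.1, h.2.2.2⟩, fun h => ⟨h.1, h.2, h.3, h.4⟩⟩

lemma isWeakDeriv_toLp [CompleteSpace E] {P : Set ℝ} (hP : IsClosed P) {f f' : ℝ → E}
    (hf : MemLp f 2) (hf' : MemLp f' 2) (h : ∀ x ∉ P, HasDerivAt f (f' x) x)
    (hc : ContinuousOn f' Pᶜ) : IsWeakDeriv Pᶜ (hf.toLp f : L2 E) (hf'.toLp f' : L2 E) :=
  (isWeakDeriv_of_hasDerivAt hP.isOpen_compl h hc).congr_ae hf.coeFn_toLp.symm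
    hf'.coeFn_toLp.symm

variable {P : Set ℝ} {BC : ℝ → Submodule ℂ (BoundaryValues E)}

lemma mem_pointInteractionGraph_of_hasDerivAt [CompleteSpace E] (hP : IsClosed P)
    {f₀ f₁ f₂ : ℝ → E} (m₀ : MemLp f₀ 2) (m₁ : MemLp f₁ 2) (m₂ : MemLp f₂ 2)
    (h₀ : ∀ x ∉ P, HasDerivAt f₀ (f₁ x) x) (h₁ : ∀ x ∉ P, HasDerivAt f₁ (f₂ x) x)
    (hc : ContinuousOn f₂ Pᶜ) (hb : ∀ q ∈ P, ∃ b ∈ BC q, HasBoundaryValues f₀ f₁ q b) :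
    ((m₀.toLp f₀ : L2 E), (-m₂.toLp f₂ : L2 E)) ∈ pointInteractionGraph P BC := by
  refine mem_pointInteractionGraph.2 ⟨m₁.toLp f₁, ?_, ?_, fun q hq => ?_⟩
  · exact isWeakDeriv_toLp hP m₀ m₁ h₀ fun x hx => (h₁ x hx).continuousAt.continuousWithinAt
  · simpa only [neg_neg] using isWeakDeriv_toLp hP m₁ m₂ h₁ hc
  · obtain ⟨b, hb, hv⟩ := hb q hq
    exact ⟨b, hb, hv.congr_ae m₀.coeFn_toLp.symm m₁.coeFn_toLp.symm⟩

lemma IsTest.memLp_smul {Ω : Set ℝ} {φ : ℝ → ℝ} (hφ : IsTest Ω φ) (v : E) :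
    MemLp (fun x => φ x • v) 2 :=
  (hφ.continuous.smul continuous_const).memLp_of_hasCompactSupport hφ.2.smul_right

/-- All boundary values vanish, so every boundary condition holds. These elements give both the
density of the domain and the differential equation for the adjoint. -/
lemma IsTest.mem_pointInteractionGraph [CompleteSpace E] (hP : IsClosed P) {φ : ℝ → ℝ}
    (hφ : IsTest Pᶜ φ) (v : E) :
    (((hφ.memLp_smul v).toLp _ : L2 E), (-(hφ.deriv.deriv.memLp_smul v).toLp _ : L2 E)) ∈
      pointInteractionGraph P BC := by
  refine mem_pointInteractionGraph_of_hasDerivAt hP (hφ.memLp_smul v) (hφ.deriv.memLp_smul v)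
    (hφ.deriv.deriv.memLp_smul v) (fun x _ => (hφ.hasDerivAt x).smul_const v)
    (fun x _ => (hφ.deriv.hasDerivAt x).smul_const v)
    (hφ.deriv.deriv.continuous.smul continuous_const).continuousOn
    fun q hq => ⟨0, zero_mem _, ?_⟩
  have h0 : ∀ {ψ : ℝ → ℝ}, IsTest Pᶜ ψ → (fun x => ψ x • v) =ᶠ[𝓝 q] 0 := fun {ψ} hψ => by
    have : ψ =ᶠ[𝓝 q] 0 := notMem_tsupport_iff_eventuallyEq.1 fun h => hψ.3 h hq
    filter_upwards [this] with x hx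
    simp [hx]
  exact HasBoundaryValues.of_eventuallyEq_zero (h0 hφ) (h0 hφ.deriv)

lemma inner_toLp_smul [CompleteSpace E] {Ω : Set ℝ} {φ : ℝ → ℝ} (hφ : IsTest Ω φ) (v : E)
    (g : L2 E) : inner ℂ ((hφ.memLp_smul v).toLp _ : L2 E) g = inner ℂ v (∫ x, φ x • g x) := by
  rw [L2.inner_def, ← integral_inner (hφ.integrable_smul (L2.locallyIntegrable g))]
  refine integral_congr_ae ?_
  filter_upwards [(hφ.memLp_smul v).coeFn_toLp] with x hx
  rw [hx, ← Complex.coe_smul, ← Complex.coe_smul, inner_smul_left, inner_smul_right,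
    Complex.conj_ofReal]

/-- A smooth function with prescribed value and derivative at `q` and support close to `q`. -/
lemma exists_contDiff_cutoff (q : ℝ) {δ : ℝ} (hδ : 0 < δ) (u v : E) :
    ∃ S : ℝ → E, ContDiff ℝ ∞ S ∧ HasCompactSupport S ∧ tsupport S ⊆ Ioo (q - δ) (q + δ) ∧
      S q = u ∧ deriv S q = v := by
  let χ : ContDiffBump q := ⟨δ / 4, δ / 2, by linarith, by linarith⟩
  have hlin : ∀ x, HasDerivAt (fun x : ℝ => u + (x - q) • v) v x := fun x => by
    simpa using (((hasDerivAt_id x).sub_const q).smul_const v).const_add u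
  have hsub : tsupport (fun x => χ x • (u + (x - q) • v)) ⊆ tsupport χ :=
    tsupport_smul_subset_left _ _
  have heq : (fun x => χ x • (u + (x - q) • v)) =ᶠ[𝓝 q] fun x => u + (x - q) • v := by
    filter_upwards [χ.eventuallyEq_one] with x hx
    simp [hx]
  refine ⟨fun x => χ x • (u + (x - q) • v), ?_, χ.hasCompactSupport.smul_right, hsub.trans ?_,
    ?_, ?_⟩
  · exact χ.contDiff.smul
      (contDiff_const.add ((contDiff_id.sub contDiff_const).smul contDiff_const))
  · rw [χ.tsupport_eq, Real.closedBall_eq_Icc]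
    intro x hx
    simp only [χ, mem_Icc] at hx
    constructor <;> linarith [hx.1, hx.2]
  · simpa using heq.self_of_nhds
  · rw [heq.deriv_eq, (hlin q).deriv]

/-- Glue two functions at a point. -/
def glue {F : Type*} (q : ℝ) (l r : ℝ → F) (x : ℝ) : F := if x < q then l x else r x

lemma glue_eventuallyEq_left {F : Type*} {q : ℝ} (l r : ℝ → F) {x : ℝ} (hx : x < q) :
    glue q l r =ᶠ[𝓝 x] l := by
  filter_upwards [Iio_mem_nhds hx] with y hy
  exact if_pos hy

lemma glue_eventuallyEq_right {F : Type*} {q : ℝ} (l r : ℝ → F) {x : ℝ} (hx : q < x) :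
    glue q l r =ᶠ[𝓝 x] r := by
  filter_upwards [Ioi_mem_nhds hx] with y hy
  exact if_neg (not_lt.2 (le_of_lt hy))

lemma HasDerivAt.glue {q : ℝ} {l r l' r' : ℝ → E} {x : ℝ} (hx : x ≠ q)
    (hl : HasDerivAt l (l' x) x) (hr : HasDerivAt r (r' x) x) :
    HasDerivAt (glue q l r) (CoupledChannels.glue q l' r' x) x := by
  rcases lt_or_gt_of_ne hx with h | h
  · rw [(glue_eventuallyEq_left l' r' h).self_of_nhds]
    exact hl.congr_of_eventuallyEq (glue_eventuallyEq_left l r h)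
  · rw [(glue_eventuallyEq_right l' r' h).self_of_nhds]
    exact hr.congr_of_eventuallyEq (glue_eventuallyEq_right l r h)

lemma memLp_glue {E : Type*} [NormedAddCommGroup E] (q : ℝ) {l r : ℝ → E}
    (hl : MemLp l 2) (hr : MemLp r 2) :
    MemLp (glue q l r) 2 := by
  classical
  have h : glue q l r = (Iio q).piecewise l r := by
    ext x
    simp [glue, piecewise]
  rw [h]
  exact MemLp.piecewise measurableSet_Iio (hl.restrict _) (hr.restrict _)

lemma hasLeftValue_glue {E : Type*} [NormedAddCommGroup E] {q : ℝ} {l : ℝ → E}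
    (r : ℝ → E) (hl : Continuous l) :
    HasLeftValue (glue q l r) q (l q) := by
  refine ((hl.tendsto q).mono_left (inf_le_left.trans nhdsWithin_le_nhds)).congr' ?_
  filter_upwards [mem_inf_of_left self_mem_nhdsWithin] with y hy
  exact (if_pos hy).symm

lemma hasRightValue_glue {E : Type*} [NormedAddCommGroup E] {q : ℝ} (l : ℝ → E)
    {r : ℝ → E} (hr : Continuous r) :
    HasRightValue (glue q l r) q (r q) := by
  refine ((hr.tendsto q).mono_left (inf_le_left.trans nhdsWithin_le_nhds)).congr' ?_
  filter_upwards [mem_inf_of_left self_mem_nhdsWithin] with y hy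
  exact (if_neg (not_lt.2 (le_of_lt hy))).symm

lemma glue_eventuallyEq_zero {E : Type*} [NormedAddCommGroup E] {q : ℝ} {l r : ℝ → E}
    {x : ℝ} (hl : x ∉ tsupport l)
    (hr : x ∉ tsupport r) : glue q l r =ᶠ[𝓝 x] 0 := by
  filter_upwards [notMem_tsupport_iff_eventuallyEq.1 hl, notMem_tsupport_iff_eventuallyEq.1 hr]
    with y h1 h2
  simp [glue, h1, h2]

/-- Prescribed boundary values at one point of `P` are attained by a function in the maximal
domain with vanishing boundary values at the other points. -/
lemma exists_boundaryValues [CompleteSpace E] (hP : UniformlyDiscrete P) {q : ℝ} (hq : q ∈ P)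
    (b : BoundaryValues E) : ∃ f d k : L2 E, IsWeakDeriv Pᶜ f d ∧ IsWeakDeriv Pᶜ d k ∧
      HasBoundaryValues f d q b ∧ ∀ p ∈ P, p ≠ q → HasBoundaryValues f d p 0 := by
  obtain ⟨δ, hδ, hgap, -⟩ := hP.exists_gap
  -- Two smooth cutoffs carry the left and the right data and are glued at `q`; with `δ` the gap,
  -- their supports meet `P` at most in `q`.
  obtain ⟨l, hl, hlc, hls, hl0, hl1⟩ := exists_contDiff_cutoff q hδ b.1.1 b.2.1
  obtain ⟨r, hr, hrc, hrs, hr0, hr1⟩ := exists_contDiff_cutoff q hδ b.1.2 b.2.2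
  have hl' := contDiff_infty_iff_deriv.1 hl
  have hr' := contDiff_infty_iff_deriv.1 hr
  have hl'' := contDiff_infty_iff_deriv.1 hl'.2
  have hr'' := contDiff_infty_iff_deriv.1 hr'.2
  have m₀ := memLp_glue q (hl.continuous.memLp_of_hasCompactSupport hlc)
    (hr.continuous.memLp_of_hasCompactSupport hrc)
  have m₁ := memLp_glue q (hl'.2.continuous.memLp_of_hasCompactSupport hlc.deriv)
    (hr'.2.continuous.memLp_of_hasCompactSupport hrc.deriv)
  have m₂ := memLp_glue q (hl''.2.continuous.memLp_of_hasCompactSupport hlc.deriv.deriv)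
    (hr''.2.continuous.memLp_of_hasCompactSupport hrc.deriv.deriv)
  have hne : ∀ {x}, x ∉ P → x ≠ q := fun hx h => hx (h ▸ hq)
  have h₀ : ∀ x ∉ P, HasDerivAt (glue q l r) (glue q (deriv l) (deriv r) x) x := fun x hx =>
    HasDerivAt.glue (hne hx) (hl'.1 x).hasDerivAt (hr'.1 x).hasDerivAt
  have h₁ : ∀ x ∉ P, HasDerivAt (glue q (deriv l) (deriv r))
      (glue q (deriv (deriv l)) (deriv (deriv r)) x) x := fun x hx =>
    HasDerivAt.glue (hne hx) (hl''.1 x).hasDerivAt (hr''.1 x).hasDerivAt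
  have hc₁ : ContinuousOn (glue q (deriv l) (deriv r)) Pᶜ := fun x hx =>
    (h₁ x hx).continuousAt.continuousWithinAt
  have hc₂ : ContinuousOn (glue q (deriv (deriv l)) (deriv (deriv r))) Pᶜ := fun x hx =>
    (HasDerivAt.glue (hne hx) (((contDiff_infty_iff_deriv.1 hl''.2).1 x).hasDerivAt)
      (((contDiff_infty_iff_deriv.1 hr''.2).1 x).hasDerivAt)).continuousAt.continuousWithinAt
  refine ⟨m₀.toLp _, m₁.toLp _, m₂.toLp _, isWeakDeriv_toLp hP.isClosed m₀ m₁ h₀ hc₁,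
    isWeakDeriv_toLp hP.isClosed m₁ m₂ h₁ hc₂, ?_, fun p hp hpq => ?_⟩
  · refine HasBoundaryValues.congr_ae ⟨?_, ?_, ?_, ?_⟩ m₀.coeFn_toLp.symm m₁.coeFn_toLp.symm
    · exact hl0 ▸ hasLeftValue_glue r hl.continuous
    · exact hr0 ▸ hasRightValue_glue l hr.continuous
    · exact hl1 ▸ hasLeftValue_glue (deriv r) hl'.2.continuous
    · exact hr1 ▸ hasRightValue_glue (deriv l) hr'.2.continuous
  · refine HasBoundaryValues.congr_ae ?_ m₀.coeFn_toLp.symm m₁.coeFn_toLp.symm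
    have hpI : p ∉ Ioo (q - δ) (q + δ) := fun h => by
      rcases lt_or_gt_of_ne hpq with h' | h'
      · exact (hgap q hq).2 ⟨h.1, h'⟩ hp
      · exact (hgap q hq).1 ⟨h', h.2⟩ hp
    exact HasBoundaryValues.of_eventuallyEq_zero
      (glue_eventuallyEq_zero (fun h => hpI (hls h)) (fun h => hpI (hrs h)))
      (glue_eventuallyEq_zero (fun h => hpI (hls (tsupport_deriv_subset h)))
        (fun h => hpI (hrs (tsupport_deriv_subset h))))

/-- Both `g` and `e` are primitives in the gaps next to `q`, so they extend continuously up to `q`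
from either side. -/
lemma exists_hasBoundaryValues [CompleteSpace E] (hP : UniformlyDiscrete P) {g e k : L2 E}
    (hg : IsWeakDeriv Pᶜ g e) (he : IsWeakDeriv Pᶜ e k) {q : ℝ} (hq : q ∈ P) :
    ∃ c, HasBoundaryValues g e q c := by
  obtain ⟨δ, hδ, hgap, -⟩ := hP.exists_gap
  have i : ∀ u : L2 E, LocallyIntegrable u := L2.locallyIntegrable
  obtain ⟨gl, hgl⟩ := (hg.isPrimitiveOn (i g) (i e) (hgap q hq).2).exists_leftValue
    (by linarith) (i e)
  obtain ⟨gr, hgr⟩ := (hg.isPrimitiveOn (i g) (i e) (hgap q hq).1).exists_rightValue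
    (by linarith) (i e)
  obtain ⟨el, hel⟩ := (he.isPrimitiveOn (i e) (i k) (hgap q hq).2).exists_leftValue
    (by linarith) (i k)
  obtain ⟨er, her⟩ := (he.isPrimitiveOn (i e) (i k) (hgap q hq).1).exists_rightValue
    (by linarith) (i k)
  exact ⟨((gl, gr), (el, er)), hgl, hgr, hel, her⟩

lemma integral_inner_sub_inner (k g f m : L2 E) :
    ∫ x, (inner ℂ (k x) (g x) - inner ℂ (f x) (m x)) = inner ℂ k g - inner ℂ f m := by
  rw [L2.inner_def, L2.inner_def,
    integral_sub (L2.integrable_inner k g) (L2.integrable_inner f m)]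

lemma graph_pointInteraction [CompleteSpace E] (hP : UniformlyDiscrete P)
    (BC : ℝ → Submodule ℂ (BoundaryValues E)) :
    (pointInteraction P BC).graph = pointInteractionGraph P BC :=
  Submodule.toLinearPMap_graph_eq _ fun p hp h0 =>
    pointInteractionGraph_snd_eq_zero hP BC p hp h0

/-- A function orthogonal to all test functions off `P` vanishes off the null set `P`. -/
lemma dense_domain_pointInteraction [CompleteSpace E] (hP : UniformlyDiscrete P) :
    Dense ((pointInteraction P BC).domain : Set (L2 E)) := by
  rw [Submodule.dense_iff_topologicalClosure_eq_top, Submodule.topologicalClosure_eq_top_iff,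
    Submodule.eq_bot_iff]
  intro g hg
  have hz : ∀ φ, IsTest Pᶜ φ → ∫ x, φ x • g x = 0 := fun φ hφ => by
    refine ext_inner_left ℂ fun v => ?_
    rw [← inner_toLp_smul hφ, inner_zero_right]
    have hmem := hφ.mem_pointInteractionGraph (BC := BC) hP.isClosed v
    rw [← graph_pointInteraction hP] at hmem
    exact Submodule.inner_right_of_mem_orthogonal (LinearPMap.mem_domain_of_mem_graph hmem) hg
  have hae := hP.isClosed.isOpen_compl.ae_eq_zero_of_integral_contDiff_smul_eq_zero
    ((L2.locallyIntegrable g).locallyIntegrableOn _) fun φ h1 h2 h3 => hz φ ⟨h1, h2, h3⟩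
  rw [Lp.eq_zero_iff_ae_eq_zero]
  filter_upwards [hae, measure_eq_zero_iff_ae_notMem.mp hP.volume_eq_zero] with x h1 h2
  exact h1 h2

/-- The half of self-adjointness that needs regularity. Test functions off `P` give the equation
`-g'' = h` and then a square integrable `g'`. A function with boundary values `b ∈ BC q` at `q` and
zero at the other points reduces Green's formula to the jump at `q`, and maximality of `BC q`
concludes. -/
lemma mem_pointInteractionGraph_of_adjoint [CompleteSpace E] (hP : UniformlyDiscrete P)
    (hBC : ∀ q ∈ P, IsLagrangian (BC q)) {g h : L2 E}
    (hgh : ∀ f k, (f, k) ∈ pointInteractionGraph P BC → inner ℂ k g - inner ℂ f h = 0) :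
    (g, h) ∈ pointInteractionGraph P BC := by
  have hsecond : ∀ φ, IsTest Pᶜ φ →
      ∫ x, deriv (deriv φ) x • g x = ∫ x, φ x • (-h : L2 E) x := fun φ hφ => by
    refine ext_inner_left ℂ fun v => ?_
    have := hgh _ _ (hφ.mem_pointInteractionGraph (BC := BC) hP.isClosed v)
    rw [← inner_toLp_smul hφ, ← inner_toLp_smul hφ.deriv.deriv, inner_neg_right]
    rw [inner_neg_left] at this
    linear_combination -this
  obtain ⟨e, hge, heh⟩ := exists_weakDeriv_of_second hP g (-h) hsecond
  refine mem_pointInteractionGraph.2 ⟨e, hge, heh, fun q hq => ?_⟩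
  have hex : ∀ p ∈ P, ∃ c, HasBoundaryValues g e p c := fun p hp =>
    exists_hasBoundaryValues hP hge heh hp
  choose! c hc using hex
  refine ⟨c q, ((hBC q hq) _).2 fun b hb => ?_, hc q hq⟩
  obtain ⟨f, d, k, hfd, hdk, hbq, hb0⟩ := exists_boundaryValues hP hq b
  classical
  have hmem : (f, -k) ∈ pointInteractionGraph P BC := by
    refine mem_pointInteractionGraph.2 ⟨d, hfd, by simpa using hdk, fun p hp => ?_⟩
    by_cases hpq : p = q
    · exact ⟨b, hpq ▸ hb, hpq ▸ hbq⟩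
    · exact ⟨0, zero_mem _, hb0 p hp hpq⟩
  have h1 := hgh _ _ hmem
  have hv := hbq.wronskian (hc q hq)
  have h2 := integral_wronskian_eq hP hfd hdk hge heh
    (b := fun p => if p = q then b else 0) (c := c) (q := q) (fun p hp => by
      by_cases hpq : p = q
      · simpa [hpq] using hbq
      · simpa [hpq] using hb0 p hp hpq) hc
    (fun p _ hpq => by simp [hpq, wronskianJump]) hv.1 hv.2
  rw [integral_inner_sub_inner, inner_neg_right] at h2
  rw [inner_neg_left] at h1
  rw [wronskianJump]
  linear_combination h1 + h2

/-- The symmetric half: isotropy of `BC p` makes every jump in Green's formula vanish. -/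
lemma inner_sub_inner_eq_zero_of_mem_graph [CompleteSpace E] (hP : UniformlyDiscrete P)
    (hBC : ∀ q ∈ P, IsLagrangian (BC q)) {f k g h : L2 E}
    (hfk : (f, k) ∈ pointInteractionGraph P BC) (hgh : (g, h) ∈ pointInteractionGraph P BC) :
    inner ℂ k g - inner ℂ f h = 0 := by
  obtain ⟨d, hfd, hdk, hb⟩ := mem_pointInteractionGraph.1 hfk
  obtain ⟨e, hge, heh, hc⟩ := mem_pointInteractionGraph.1 hgh
  choose! b hbBC hb using hb
  choose! c hcBC hc using hc
  have key := integral_wronskian_eq_zero hP hfd hdk hge heh hb hc fun p hp =>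
    ((hBC p hp) _).1 (hcBC p hp) _ (hbBC p hp)
  rw [integral_inner_sub_inner, inner_neg_right, inner_neg_left] at key
  linear_combination -key

/-- Second derivatives off a uniformly discrete set with Lagrangian boundary conditions define a
self-adjoint operator. -/
theorem isSelfAdjoint_pointInteraction [CompleteSpace E] (hP : UniformlyDiscrete P)
    (hBC : ∀ q ∈ P, IsLagrangian (BC q)) : IsSelfAdjoint (pointInteraction P BC) := by
  have hdense : Dense ((pointInteraction P BC).domain : Set (L2 E)) :=
    dense_domain_pointInteraction hP
  have hgraph := graph_pointInteraction hP BC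
  generalize pointInteraction P BC = T at hdense hgraph
  rw [LinearPMap.isSelfAdjoint_def]
  apply LinearPMap.eq_of_eq_graph
  rw [LinearPMap.adjoint_graph_eq_graph_adjoint hdense, hgraph]
  ext ⟨g, h⟩
  rw [Submodule.mem_adjoint_iff]
  exact ⟨fun hgh => mem_pointInteractionGraph_of_adjoint hP hBC hgh,
    fun hgh f k hfk => inner_sub_inner_eq_zero_of_mem_graph hP hBC hfk hgh⟩

end SelfAdjointness

/-! ### Each coupling is a Lagrangian subspace. -/

section Lagrangian

lemma sum_conj_single_mul {S : Type*} [Fintype S] [DecidableEq S] (s : S) (z : ℂ) (x : S → ℂ) :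
    ∑ r, conj ((Pi.single s z : S → ℂ) r) * x r = conj z * x s := by
  rw [Finset.sum_eq_single s (fun r _ hr => by simp [hr]) (fun h => absurd (Finset.mem_univ s) h),
    Pi.single_eq_same]

/-- Isotropy is the reality of `α`. For maximality, the pair `(0, e_s - e_{s₀})` forces equal values
and `(1, α e_{s₀})` forces the condition on the sum. -/
lemma equal_values_iff {S : Type*} [Fintype S] [DecidableEq S] [Nonempty S] (α : ℝ) (x y : S → ℂ) :
    (∃ c : ℂ, (∀ s, x s = c) ∧ ∑ s, y s = α * c) ↔
      ∀ x' y' : S → ℂ, (∃ c : ℂ, (∀ s, x' s = c) ∧ ∑ s, y' s = α * c) →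
        ∑ s, (conj (y' s) * x s - conj (x' s) * y s) = 0 := by
  constructor
  · rintro ⟨c, hx, hy⟩ x' y' ⟨c', hx', hy'⟩
    have h := congrArg conj hy'
    rw [map_sum, map_mul, Complex.conj_ofReal] at h
    simp only [hx, hx', Finset.sum_sub_distrib, ← Finset.sum_mul, ← Finset.mul_sum, h, hy]
    ring
  · intro h
    obtain ⟨s₀⟩ := ‹Nonempty S›
    have hx : ∀ s, x s = x s₀ := fun s => by
      have := h 0 (Pi.single s 1 - Pi.single s₀ 1) ⟨0, by simp, by simp⟩
      simp only [Pi.zero_apply, Pi.sub_apply, map_zero, zero_mul, sub_zero, map_sub, sub_mul,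
        Finset.sum_sub_distrib, sum_conj_single_mul, map_one, one_mul] at this
      exact sub_eq_zero.1 this
    refine ⟨x s₀, hx, ?_⟩
    have := h (fun _ => 1) (Pi.single s₀ (α : ℂ)) ⟨1, by simp, by simp⟩
    simp only [map_one, one_mul, Finset.sum_sub_distrib, sum_conj_single_mul,
      Complex.conj_ofReal] at this
    exact (sub_eq_zero.1 this).symm

/-- The conditions say that `y - a x` is constant and `x` has zero sum. For real `a` the parts `a x`
cancel in the form, and the constants are paired with zero sums. For maximality, `(e_s - e_t, a (e_s
- e_t))` tests a difference and `(0, 1)` tests the sum. -/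
lemma equal_differences_iff {S : Type*} [Fintype S] [DecidableEq S] [Nonempty S] (a : ℝ)
    (x y : S → ℂ) :
    ((∀ s t, y s - y t = a * (x s - x t)) ∧ ∑ s, x s = 0) ↔
      ∀ x' y' : S → ℂ, ((∀ s t, y' s - y' t = a * (x' s - x' t)) ∧ ∑ s, x' s = 0) →
        ∑ s, (conj (y' s) * x s - conj (x' s) * y s) = 0 := by
  constructor
  · rintro ⟨hy, hx⟩ x' y' ⟨hy', hx'⟩
    obtain ⟨s₀⟩ := ‹Nonempty S›
    have h1 : ∀ s, y s = a * x s + (y s₀ - a * x s₀) := fun s => by linear_combination hy s s₀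
    have h2 : ∀ s, conj (y' s) = a * conj (x' s) + conj (y' s₀ - a * x' s₀) := fun s => by
      have : y' s = a * x' s + (y' s₀ - a * x' s₀) := by linear_combination hy' s s₀
      rw [this, map_add, map_mul, Complex.conj_ofReal]
    have h3 : ∀ s, conj (y' s) * x s - conj (x' s) * y s =
        conj (y' s₀ - a * x' s₀) * x s - conj (x' s) * (y s₀ - a * x s₀) := fun s => by
      rw [h1 s, h2 s]; ring
    have h4 : ∑ s, conj (x' s) = 0 := by rw [← map_sum, hx', map_zero]
    simp only [h3, Finset.sum_sub_distrib, ← Finset.mul_sum, ← Finset.sum_mul, hx, h4]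
    ring
  · intro h
    refine ⟨fun s t => ?_, ?_⟩
    · have := h (Pi.single s 1 - Pi.single t 1)
        (fun r => a * (Pi.single (M := fun _ => ℂ) s 1 - Pi.single t 1 : S → ℂ) r)
        ⟨fun _ _ => by ring, by simp⟩
      simp only [Pi.sub_apply, map_mul, map_sub, Complex.conj_ofReal, sub_mul, mul_assoc,
        Finset.sum_sub_distrib, ← Finset.mul_sum, sum_conj_single_mul, map_one, one_mul] at this
      linear_combination -this
    · have := h 0 (fun _ => 1) ⟨fun _ _ => by simp, by simp⟩
      simpa using this

variable {n : ℕ}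

/-- The boundary values with given values and outward derivatives. -/
def ofΓ (x y : Fin n ⊕ Fin n → ℂ) : BoundaryValues (EuclideanSpace ℂ (Fin n)) :=
  ((WithLp.toLp 2 fun j => x (.inl j), WithLp.toLp 2 fun j => x (.inr j)),
    (WithLp.toLp 2 fun j => -y (.inl j), WithLp.toLp 2 fun j => y (.inr j)))

lemma Γ₁_ofΓ (x y : Fin n ⊕ Fin n → ℂ) : Γ₁ (ofΓ x y) = x := by
  funext s; cases s <;> simp [Γ₁, ofΓ]

lemma Γ₂_ofΓ (x y : Fin n ⊕ Fin n → ℂ) : Γ₂ (ofΓ x y) = y := by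
  funext s; cases s <;> simp [Γ₂, ofΓ]

/-- Outward derivatives give all half-channels the same sign, so the jump is the standard symplectic
form in `(Γ₁, Γ₂)`. -/
lemma wronskianJump_eq_sum (b c : BoundaryValues (EuclideanSpace ℂ (Fin n))) :
    wronskianJump b c = ∑ s, (conj (Γ₂ b s) * Γ₁ c s - conj (Γ₁ b s) * Γ₂ c s) := by
  simp only [wronskianJump, PiLp.inner_apply, Fintype.sum_sum_type, Γ₁, Γ₂, Sum.elim_inl,
    Sum.elim_inr, RCLike.inner_apply, ← Finset.sum_sub_distrib, ← Finset.sum_add_distrib, map_neg]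
  exact Finset.sum_congr rfl fun j _ => by ring

/-- `(Γ₁, Γ₂)` is onto, by `ofΓ`, so testing with boundary values is testing with arbitrary pairs of
vectors that satisfy `p`. -/
lemma isLagrangian_of_iff {L : Submodule ℂ (BoundaryValues (EuclideanSpace ℂ (Fin n)))}
    (p : (Fin n ⊕ Fin n → ℂ) → (Fin n ⊕ Fin n → ℂ) → Prop) (hL : ∀ b, b ∈ L ↔ p (Γ₁ b) (Γ₂ b))
    (hp : ∀ x y, p x y ↔ ∀ x' y', p x' y' → ∑ s, (conj (y' s) * x s - conj (x' s) * y s) = 0) :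
    IsLagrangian L := by
  intro c
  rw [hL, hp]
  refine ⟨fun h b hb => ?_, fun h x' y' hxy => ?_⟩
  · rw [wronskianJump_eq_sum]
    exact h _ _ ((hL b).1 hb)
  · have := h (ofΓ x' y') ((hL _).2 (by rwa [Γ₁_ofΓ, Γ₂_ofΓ]))
    rwa [wronskianJump_eq_sum, Γ₁_ofΓ, Γ₂_ofΓ] at this

/-- Exchanging values and outward derivatives only changes the sign of the form. Hence `δ'_s`
follows from the computation for `δ`, and `δ'` from that for `δ_p`. -/
lemma isLagrangian_of_iff_swap {L : Submodule ℂ (BoundaryValues (EuclideanSpace ℂ (Fin n)))}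
    (p : (Fin n ⊕ Fin n → ℂ) → (Fin n ⊕ Fin n → ℂ) → Prop) (hL : ∀ b, b ∈ L ↔ p (Γ₂ b) (Γ₁ b))
    (hp : ∀ x y, p x y ↔ ∀ x' y', p x' y' → ∑ s, (conj (y' s) * x s - conj (x' s) * y s) = 0) :
    IsLagrangian L := by
  refine isLagrangian_of_iff (fun x y => p y x) hL fun x y => (hp y x).trans ?_
  rw [forall_comm]
  refine forall₃_congr fun x' y' _ => ?_
  rw [← neg_eq_zero, ← Finset.sum_neg_distrib]
  simp only [neg_sub]

lemma isLagrangian_deltaCoupling [NeZero n] (α : ℝ) : IsLagrangian (deltaCoupling n α) :=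
  isLagrangian_of_iff _ (fun _ => Iff.rfl) (equal_values_iff α)

lemma isLagrangian_deltaPrimeSCoupling [NeZero n] (β : ℝ) :
    IsLagrangian (deltaPrimeSCoupling n β) :=
  isLagrangian_of_iff_swap _ (fun _ => Iff.rfl) (equal_values_iff β)

lemma isLagrangian_deltaPCoupling [NeZero n] (α : ℝ) : IsLagrangian (deltaPCoupling n α) :=
  isLagrangian_of_iff
    (fun x y => (∀ s t, y s - y t = ((α / (2 * n) : ℝ) : ℂ) * (x s - x t)) ∧ ∑ s, x s = 0)
    (fun b => by push_cast; exact Iff.rfl) (equal_differences_iff _)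

lemma isLagrangian_deltaPrimeCoupling [NeZero n] (β : ℝ) : IsLagrangian (deltaPrimeCoupling n β) :=
  isLagrangian_of_iff_swap
    (fun x y => (∀ s t, y s - y t = ((β / (2 * n) : ℝ) : ℂ) * (x s - x t)) ∧ ∑ s, x s = 0)
    (fun b => by push_cast; exact Iff.rfl) (equal_differences_iff _)

lemma wronskianJump_scalar (b c : BoundaryValues ℂ) : wronskianJump b c =
    conj b.2.2 * c.1.2 - conj b.1.2 * c.2.2 - (conj b.2.1 * c.1.1 - conj b.1.1 * c.2.1) := by
  simp only [wronskianJump, RCLike.inner_apply]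
  ring

/-- Two homogeneous conditions on scalar boundary values are Lagrangian if they annihilate each
other and are tested by two elements that satisfy them. -/
lemma isLagrangian_scalar {L : Submodule ℂ (BoundaryValues ℂ)} {p₁ p₂ : BoundaryValues ℂ → Prop}
    (hL : ∀ b, b ∈ L ↔ p₁ b ∧ p₂ b)
    (h0 : ∀ b c, p₁ b → p₂ b → p₁ c → p₂ c → wronskianJump b c = 0) {b₁ b₂ : BoundaryValues ℂ}
    (hb₁ : b₁ ∈ L) (hb₂ : b₂ ∈ L) (h₁ : ∀ c, wronskianJump b₁ c = 0 → p₁ c)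
    (h₂ : ∀ c, wronskianJump b₁ c = 0 → wronskianJump b₂ c = 0 → p₂ c) : IsLagrangian L := by
  intro c
  refine ⟨fun hc b hb => ?_, fun h => (hL c).2 ⟨h₁ c (h _ hb₁), h₂ c (h _ hb₁) (h _ hb₂)⟩⟩
  exact h0 b c ((hL b).1 hb).1 ((hL b).1 hb).2 ((hL c).1 hc).1 ((hL c).1 hc).2

variable {Q Qs Qp Q' : Set ℝ}

lemma conj_real_mul_eq {a : ℝ} {z w : ℂ} (h : z = a * w) : conj z = a * conj w := by
  rw [h, map_mul, Complex.conj_ofReal]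

/-- Disjointness leaves a single pair of equations at `q`. In each case `b₁` and `b₂` span the
two-dimensional solution space, chosen so that pairing with `b₁` is the first equation and with `b₂`
the second, up to sign. -/
lemma isLagrangian_scalarBC (hQQs : Disjoint Q Qs) (hQQp : Disjoint Q Qp) (hQQ' : Disjoint Q Q')
    (hQsQp : Disjoint Qs Qp) (hQsQ' : Disjoint Qs Q') (hQpQ' : Disjoint Qp Q') (α β : ℝ → ℝ)
    {q : ℝ} (hq : q ∈ Q ∪ Qs ∪ Qp ∪ Q') : IsLagrangian (scalarBC Q Qs Qp Q' α β q) := by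
  have hmem : ∀ b : BoundaryValues ℂ, b ∈ scalarBC Q Qs Qp Q' α β q ↔
    (q ∈ Q → b.1.1 = b.1.2 ∧ b.2.2 - b.2.1 = α q * b.1.2) ∧
    (q ∈ Qs → b.2.1 + b.2.2 = 0 ∧ b.1.1 + b.1.2 = β q * b.2.2) ∧
    (q ∈ Qp → b.1.1 + b.1.2 = 0 ∧ b.2.1 + b.2.2 = α q * b.1.2) ∧
    (q ∈ Q' → b.2.1 = b.2.2 ∧ b.1.2 - b.1.1 = β q * b.2.2) := fun b => Iff.rfl
  rcases hq with ((hq | hq) | hq) | hq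
  · have h2 := disjoint_left.1 hQQs hq
    have h3 := disjoint_left.1 hQQp hq
    have h4 := disjoint_left.1 hQQ' hq
    simp only [hq, h2, h3, h4, true_imp_iff, false_imp_iff, and_true] at hmem
    refine isLagrangian_scalar hmem (fun b c hb hb' hc hc' => ?_)
      (b₁ := ((0, 0), (1, 1))) (b₂ := ((1, 1), (0, (α q : ℂ)))) (by rw [hmem]; simp)
      (by rw [hmem]; simp) (fun c h => ?_) (fun c h h' => ?_)
    · have e := conj_real_mul_eq hb'
      rw [map_sub] at e
      rw [wronskianJump_scalar, hb, hc]
      linear_combination c.1.2 * e - conj b.1.2 * hc'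
    · simp only [wronskianJump_scalar, map_zero, map_one] at h
      linear_combination -h
    · simp only [wronskianJump_scalar, map_zero, map_one, Complex.conj_ofReal] at h'
      linear_combination -h'
  · have h1 := disjoint_right.1 hQQs hq
    have h3 := disjoint_left.1 hQsQp hq
    have h4 := disjoint_left.1 hQsQ' hq
    simp only [hq, h1, h3, h4, true_imp_iff, false_imp_iff, and_true, true_and] at hmem
    refine isLagrangian_scalar hmem (fun b c hb hb' hc hc' => ?_)
      (b₁ := ((1, -1), (0, 0))) (b₂ := ((0, (β q : ℂ)), (-1, 1))) (by rw [hmem]; simp)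
      (by rw [hmem]; simp) (fun c h => ?_) (fun c h h' => ?_)
    · have e := conj_real_mul_eq hb'
      rw [map_add] at e
      rw [wronskianJump_scalar, eq_neg_of_add_eq_zero_left hb, eq_neg_of_add_eq_zero_left hc,
        map_neg]
      linear_combination conj b.2.2 * hc' - c.2.2 * e
    · simp only [wronskianJump_scalar, map_zero, map_one, map_neg] at h
      linear_combination h
    · simp only [wronskianJump_scalar, map_zero, map_one, map_neg, Complex.conj_ofReal] at h'
      linear_combination h'
  · have h1 := disjoint_right.1 hQQp hq
    have h2 := disjoint_right.1 hQsQp hq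
    have h4 := disjoint_left.1 hQpQ' hq
    simp only [hq, h1, h2, h4, true_imp_iff, false_imp_iff, and_true, true_and] at hmem
    refine isLagrangian_scalar hmem (fun b c hb hb' hc hc' => ?_)
      (b₁ := ((0, 0), (1, -1))) (b₂ := ((-1, 1), (0, (α q : ℂ)))) (by rw [hmem]; simp)
      (by rw [hmem]; simp) (fun c h => ?_) (fun c h h' => ?_)
    · have e := conj_real_mul_eq hb'
      rw [map_add] at e
      rw [wronskianJump_scalar, eq_neg_of_add_eq_zero_left hb, eq_neg_of_add_eq_zero_left hc,
        map_neg]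
      linear_combination c.1.2 * e - conj b.1.2 * hc'
    · simp only [wronskianJump_scalar, map_zero, map_one, map_neg] at h
      linear_combination -h
    · simp only [wronskianJump_scalar, map_zero, map_one, map_neg, Complex.conj_ofReal] at h'
      linear_combination -h'
  · have h1 := disjoint_right.1 hQQ' hq
    have h2 := disjoint_right.1 hQsQ' hq
    have h3 := disjoint_right.1 hQpQ' hq
    simp only [hq, h1, h2, h3, true_imp_iff, false_imp_iff, true_and] at hmem
    refine isLagrangian_scalar hmem (fun b c hb hb' hc hc' => ?_)
      (b₁ := ((1, 1), (0, 0))) (b₂ := ((0, (β q : ℂ)), (1, 1))) (by rw [hmem]; simp)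
      (by rw [hmem]; simp) (fun c h => ?_) (fun c h h' => ?_)
    · have e := conj_real_mul_eq hb'
      rw [map_sub] at e
      rw [wronskianJump_scalar, hb, hc]
      linear_combination conj b.2.2 * hc' - c.2.2 * e
    · simp only [wronskianJump_scalar, map_zero, map_one] at h
      linear_combination h
    · simp only [wronskianJump_scalar, map_zero, map_one, Complex.conj_ofReal] at h'
      linear_combination h'

/-- The two sides of `q` decouple: `b₁` is a solution living on the left and `b₂` one living on the
right, and each tests the condition of its own side. -/
lemma isLagrangian_separatedBC (hn : n ≠ 0)
    (hQQs : Disjoint Q Qs) (hQQp : Disjoint Q Qp) (hQQ' : Disjoint Q Q')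
    (hQsQp : Disjoint Qs Qp) (hQsQ' : Disjoint Qs Q') (hQpQ' : Disjoint Qp Q') (α β : ℝ → ℝ)
    {q : ℝ} (hq : q ∈ Q ∪ Qs ∪ Qp ∪ Q') : IsLagrangian (separatedBC n Q Qs Qp Q' α β q) := by
  have hmem : ∀ b : BoundaryValues ℂ, b ∈ separatedBC n Q Qs Qp Q' α β q ↔
    (q ∈ Q → b.1.1 = 0 ∧ b.1.2 = 0) ∧
    (q ∈ Qs → b.2.1 = 0 ∧ b.2.2 = 0) ∧
    (q ∈ Qp → α q * b.1.1 + 2 * n * b.2.1 = 0 ∧ α q * b.1.2 - 2 * n * b.2.2 = 0) ∧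
    (q ∈ Q' → 2 * n * b.1.1 + β q * b.2.1 = 0 ∧ 2 * n * b.1.2 - β q * b.2.2 = 0) :=
    fun b => Iff.rfl
  have hn' : (2 * n : ℂ) ≠ 0 := by simp [hn]
  rcases hq with ((hq | hq) | hq) | hq
  · have h2 := disjoint_left.1 hQQs hq
    have h3 := disjoint_left.1 hQQp hq
    have h4 := disjoint_left.1 hQQ' hq
    simp only [hq, h2, h3, h4, true_imp_iff, false_imp_iff, and_true] at hmem
    refine isLagrangian_scalar hmem (fun b c hb hb' hc hc' => ?_)
      (b₁ := ((0, 0), (1, 0))) (b₂ := ((0, 0), (0, 1))) (by rw [hmem]; simp)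
      (by rw [hmem]; simp) (fun c h => ?_) (fun c h h' => ?_)
    · simp [wronskianJump_scalar, hb, hb', hc, hc']
    · simpa [wronskianJump_scalar] using h
    · simpa [wronskianJump_scalar] using h'
  · have h1 := disjoint_right.1 hQQs hq
    have h3 := disjoint_left.1 hQsQp hq
    have h4 := disjoint_left.1 hQsQ' hq
    simp only [hq, h1, h3, h4, true_imp_iff, false_imp_iff, and_true, true_and] at hmem
    refine isLagrangian_scalar hmem (fun b c hb hb' hc hc' => ?_)
      (b₁ := ((1, 0), (0, 0))) (b₂ := ((0, 1), (0, 0))) (by rw [hmem]; simp)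
      (by rw [hmem]; simp) (fun c h => ?_) (fun c h h' => ?_)
    · simp [wronskianJump_scalar, hb, hb', hc, hc']
    · simpa [wronskianJump_scalar] using h
    · simpa [wronskianJump_scalar] using h'
  · have h1 := disjoint_right.1 hQQp hq
    have h2 := disjoint_right.1 hQsQp hq
    have h4 := disjoint_left.1 hQpQ' hq
    simp only [hq, h1, h2, h4, true_imp_iff, false_imp_iff, and_true, true_and] at hmem
    refine isLagrangian_scalar hmem (fun b c hb hb' hc hc' => ?_)
      (b₁ := ((2 * n, 0), (-(α q : ℂ), 0))) (b₂ := ((0, 2 * n), (0, (α q : ℂ))))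
      (by rw [hmem]; simp; ring) (by rw [hmem]; simp; ring) (fun c h => ?_) (fun c h h' => ?_)
    · have e := congrArg conj hb
      have e' := congrArg conj hb'
      simp only [map_add, map_sub, map_mul, Complex.conj_ofReal, map_zero, map_natCast,
        Complex.conj_ofNat] at e e'
      -- The factor `2n` allows the Robin conditions to be substituted without solving them for the
      -- derivative.
      refine (mul_eq_zero.1 ?_).resolve_left hn'
      rw [wronskianJump_scalar]
      linear_combination conj b.1.1 * hc - c.1.1 * e + conj b.1.2 * hc' - c.1.2 * e'
    · simp only [wronskianJump_scalar, map_zero, map_mul, map_neg, Complex.conj_ofReal,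
        map_natCast, Complex.conj_ofNat] at h
      linear_combination h
    · simp only [wronskianJump_scalar, map_zero, map_mul, Complex.conj_ofReal, map_natCast,
        Complex.conj_ofNat] at h'
      linear_combination h'
  · have h1 := disjoint_right.1 hQQ' hq
    have h2 := disjoint_right.1 hQsQ' hq
    have h3 := disjoint_right.1 hQpQ' hq
    simp only [hq, h1, h2, h3, true_imp_iff, false_imp_iff, true_and] at hmem
    refine isLagrangian_scalar hmem (fun b c hb hb' hc hc' => ?_)
      (b₁ := (((β q : ℂ), 0), (-(2 * n), 0))) (b₂ := ((0, (β q : ℂ)), (0, 2 * n)))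
      (by rw [hmem]; simp; ring) (by rw [hmem]; simp; ring) (fun c h => ?_) (fun c h h' => ?_)
    · have e := congrArg conj hb
      have e' := congrArg conj hb'
      simp only [map_add, map_sub, map_mul, Complex.conj_ofReal, map_zero, map_natCast,
        Complex.conj_ofNat] at e e'
      refine (mul_eq_zero.1 ?_).resolve_left hn'
      rw [wronskianJump_scalar]
      linear_combination c.2.1 * e - conj b.2.1 * hc - c.2.2 * e' + conj b.2.2 * hc'
    · simp only [wronskianJump_scalar, map_zero, map_mul, map_neg, Complex.conj_ofReal,
        map_natCast, Complex.conj_ofNat] at h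
      linear_combination h
    · simp only [wronskianJump_scalar, map_zero, map_mul, Complex.conj_ofReal, map_natCast,
        Complex.conj_ofNat] at h'
      linear_combination h'

end Lagrangian

/-! ### Constant linear maps and change of basis in the channel space. -/

section Transport

variable {E F : Type*} [NormedAddCommGroup E] [InnerProductSpace ℂ E]
  [NormedAddCommGroup F] [InnerProductSpace ℂ F]

/-- The boundary values of `L ∘ f`. -/
def mapBoundaryValues (L : E →L[ℂ] F) (b : BoundaryValues E) : BoundaryValues F :=
  ((L b.1.1, L b.1.2), (L b.2.1, L b.2.2))

lemma IsWeakDeriv.compLpL [CompleteSpace E] [CompleteSpace F] {Ω : Set ℝ} {f d : L2 E}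
    (h : IsWeakDeriv Ω f d) (L : E →L[ℂ] F) :
    IsWeakDeriv Ω (L.compLpL 2 volume f) (L.compLpL 2 volume d) := by
  have key : ∀ ψ, IsTest Ω ψ → ∀ u : L2 E,
      ∫ x, ψ x • (L.compLpL 2 volume u : L2 F) x = L (∫ x, ψ x • u x) := fun ψ hψ u => by
    rw [← ContinuousLinearMap.integral_comp_comm L
      (hψ.integrable_smul (L2.locallyIntegrable u))]
    refine integral_congr_ae ?_
    filter_upwards [L.coeFn_compLpL u] with x hx
    rw [hx, ← Complex.coe_smul, ← Complex.coe_smul, map_smul]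
  rw [isWeakDeriv_iff] at h ⊢
  intro φ hφ
  rw [key _ hφ.deriv, key _ hφ, h φ hφ, map_neg]

lemma HasBoundaryValues.compLpL {f d : L2 E} {q : ℝ} {b : BoundaryValues E}
    (h : HasBoundaryValues f d q b) (L : E →L[ℂ] F) :
    HasBoundaryValues (L.compLpL 2 volume f) (L.compLpL 2 volume d) q (mapBoundaryValues L b) := by
  have h' : HasBoundaryValues (fun x => L (f x)) (fun x => L (d x)) q (mapBoundaryValues L b) :=
    ⟨(L.continuous.tendsto _).comp h.left, (L.continuous.tendsto _).comp h.right,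
      (L.continuous.tendsto _).comp h.derivLeft, (L.continuous.tendsto _).comp h.derivRight⟩
  exact h'.congr_ae (L.coeFn_compLpL f).symm (L.coeFn_compLpL d).symm

/-- A constant linear map commutes with weak differentiation and with one-sided limits, so only the
boundary conditions have to be compared. -/
lemma compLpL_mem_graph [CompleteSpace E] [CompleteSpace F] {P : Set ℝ}
    {BC : ℝ → Submodule ℂ (BoundaryValues E)}
    {BC' : ℝ → Submodule ℂ (BoundaryValues F)} (L : E →L[ℂ] F)
    (hL : ∀ q ∈ P, ∀ b ∈ BC q, mapBoundaryValues L b ∈ BC' q) {p : L2 E × L2 E}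
    (hp : p ∈ pointInteractionGraph P BC) :
    (L.compLpL 2 volume p.1, L.compLpL 2 volume p.2) ∈ pointInteractionGraph P BC' := by
  obtain ⟨d, h1, h2, h3⟩ := mem_pointInteractionGraph.1 hp
  refine mem_pointInteractionGraph.2 ⟨L.compLpL 2 volume d, h1.compLpL L, ?_, fun q hq => ?_⟩
  · have := h2.compLpL L
    rwa [map_neg] at this
  · obtain ⟨b, hb, hv⟩ := h3 q hq
    exact ⟨_, hL q hq b hb, hv.compLpL L⟩

variable {ι : Type*} [Fintype ι]

/-- The embedding of `ℂ` along a vector. -/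
abbrev alongVector (v : E) : ℂ →L[ℂ] E := ContinuousLinearMap.toSpanSingleton ℂ v

lemma compLpL_comp_apply {G H K : Type*} [NormedAddCommGroup G] [NormedSpace ℂ G]
    [NormedAddCommGroup H] [NormedSpace ℂ H] [NormedAddCommGroup K] [NormedSpace ℂ K]
    (L : H →L[ℂ] K) (M : G →L[ℂ] H) (f : L2 G) :
    L.compLpL 2 volume (M.compLpL 2 volume f) = (L.comp M).compLpL 2 volume f := by
  apply Lp.ext
  filter_upwards [L.coeFn_compLpL (M.compLpL 2 volume f), M.coeFn_compLpL f,
    (L.comp M).coeFn_compLpL f] with x h1 h2 h3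
  rw [h1, h2, h3]
  rfl

/-- The unitary that maps a function to its components in an orthonormal basis. -/
def componentsL2 (b : OrthonormalBasis ι ℂ E) : L2 E ≃ₗᵢ[ℂ] PiLp 2 (fun _ : ι => L2 ℂ) :=
  LinearEquiv.isometryOfInner
    { toFun := fun f => WithLp.toLp 2 fun k => (innerSL ℂ (b k)).compLpL 2 volume f
      map_add' := fun f g => by
        ext1 k
        exact map_add _ f g
      map_smul' := fun c f => by
        ext1 k
        exact map_smul _ c f
      invFun := fun g => ∑ k, (alongVector (b k)).compLpL 2 volume (g k)
      left_inv := fun f => by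
        simp only [compLpL_comp_apply]
        apply Lp.ext
        have h1 := Lp.coeFn_finsetSum Finset.univ (fun k =>
          ((alongVector (b k)).comp (innerSL ℂ (b k))).compLpL 2 (volume : Measure ℝ) f)
        have h2 : ∀ᵐ x, ∀ k, ((alongVector (b k)).comp (innerSL ℂ (b k))).compLpL 2 volume f x
            = ((alongVector (b k)).comp (innerSL ℂ (b k))) (f x) :=
          ae_all_iff.2 fun k => ContinuousLinearMap.coeFn_compLpL _ f
        filter_upwards [h1, h2] with x h1 h2
        rw [h1, Finset.sum_apply]
        simp only [h2]
        simpa using b.sum_repr' (f x)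
      right_inv := fun g => by
        ext1 k
        simp only [map_sum, compLpL_comp_apply]
        have hcomp : ∀ j z, ((innerSL ℂ (b k)).comp (alongVector (b j))) z =
            z * inner ℂ (b k) (b j) :=
          fun j z => by simp
        rw [Finset.sum_eq_single k]
        · apply Lp.ext
          filter_upwards [((innerSL ℂ (b k)).comp (alongVector (b k))).coeFn_compLpL (g k)]
            with x hx
          rw [hx, hcomp, inner_self_eq_norm_sq_to_K, b.norm_eq_one]
          simp
        · intro j _ hj
          rw [Lp.eq_zero_iff_ae_eq_zero]
          filter_upwards [((innerSL ℂ (b k)).comp (alongVector (b j))).coeFn_compLpL (g j)]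
            with x hx
          rw [hx, hcomp, b.inner_eq_zero hj.symm]
          simp
        · exact fun h => absurd (Finset.mem_univ k) h }
    fun f g => by
      simp only [PiLp.inner_apply, LinearEquiv.coe_mk, LinearMap.coe_mk, AddHom.coe_mk,
        L2.inner_def]
      rw [← integral_finsetSum _ fun k _ => L2.integrable_inner _ _]
      have h : ∀ u : L2 E, ∀ᵐ x, ∀ k, (innerSL ℂ (b k)).compLpL 2 volume u x
          = inner ℂ (b k) (u x) := fun u =>
        ae_all_iff.2 fun k => ContinuousLinearMap.coeFn_compLpL _ u
      refine integral_congr_ae ?_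
      filter_upwards [h f, h g] with x hf hg
      rw [← b.sum_inner_mul_inner]
      refine Finset.sum_congr rfl fun k _ => ?_
      rw [hf, hg, RCLike.inner_apply, inner_conj_symm, mul_comm]

lemma componentsL2_symm_apply (b : OrthonormalBasis ι ℂ E) (g : PiLp 2 (fun _ : ι => L2 ℂ)) :
    (componentsL2 b).symm g = ∑ k, (alongVector (b k)).compLpL 2 volume (g k) := rfl

/-- Boundary conditions that are diagonal in an orthonormal basis decompose the operator. -/
theorem unitarilyEquivalent_directSum [CompleteSpace E] {P : Set ℝ} (hP : UniformlyDiscrete P)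
    (b : OrthonormalBasis ι ℂ E) {BC : ℝ → Submodule ℂ (BoundaryValues E)}
    {BC' : ι → ℝ → Submodule ℂ (BoundaryValues ℂ)}
    (h₁ : ∀ k, ∀ q ∈ P, ∀ c ∈ BC q, mapBoundaryValues (innerSL ℂ (b k)) c ∈ BC' k q)
    (h₂ : ∀ k, ∀ q ∈ P, ∀ c ∈ BC' k q, mapBoundaryValues (alongVector (b k)) c ∈ BC q) :
    UnitarilyEquivalent (pointInteraction P BC)
      (directSum fun k => pointInteraction P (BC' k)) := by
  have hfwd : ∀ x y, (x, y) ∈ (pointInteraction P BC).graph → ∀ k,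
      (componentsL2 b x k, componentsL2 b y k) ∈ (pointInteraction P (BC' k)).graph := by
    intro x y hxy k
    rw [graph_pointInteraction hP] at hxy ⊢
    exact compLpL_mem_graph _ (h₁ k) hxy
  -- The inverse unitary sums the components along the basis vectors; each summand lies in the graph
  -- by `h₂`, and the graph is a subspace.
  have hbwd : ∀ x y : PiLp 2 (fun _ : ι => L2 ℂ),
      (∀ k, (x k, y k) ∈ (pointInteraction P (BC' k)).graph) →
      ((componentsL2 b).symm x, (componentsL2 b).symm y) ∈ (pointInteraction P BC).graph := by
    intro x y hxy
    rw [graph_pointInteraction hP, componentsL2_symm_apply, componentsL2_symm_apply,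
      prod_mk_sum]
    refine Submodule.sum_mem _ fun k _ => ?_
    have := hxy k
    rw [graph_pointInteraction hP] at this
    exact compLpL_mem_graph _ (h₂ k) this
  refine ⟨componentsL2 b, fun x => ⟨fun h => ?_, fun h k => ?_⟩, fun x y hxy => ?_⟩
  · have hk : ∀ k, ∃ z, (componentsL2 b x k, z) ∈ (pointInteraction P (BC' k)).graph := fun k =>
      LinearPMap.mem_domain_iff.1 (h k)
    choose z hz using hk
    have := hbwd (componentsL2 b x) (WithLp.toLp 2 z) hz
    rw [LinearIsometryEquiv.symm_apply_apply] at this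
    exact LinearPMap.mem_domain_iff.2 ⟨_, this⟩
  · obtain ⟨z, hz⟩ := LinearPMap.mem_domain_iff.1 h
    exact LinearPMap.mem_domain_iff.2 ⟨_, hfwd x z hz k⟩
  · ext1 k
    have h1 := hfwd _ _ (LinearPMap.mem_graph _ x) k
    rw [← hxy] at h1
    exact LinearPMap.mem_graph_snd_inj _ (LinearPMap.mem_graph _ ⟨y.1 k, y.2 k⟩) h1 rfl

end Transport

/-! ### The couplings in a basis containing the uniform vector. -/

section Decomposition

variable {n : ℕ}

/-- The vector with all components equal to `1 / √n`. -/
def uniformVector (n : ℕ) : EuclideanSpace ℂ (Fin n) := WithLp.toLp 2 fun _ => ((√n : ℝ) : ℂ)⁻¹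

lemma sqrt_mul_sqrt_natCast (n : ℕ) : ((√n : ℝ) : ℂ) * ((√n : ℝ) : ℂ) = n := by
  rw [← Complex.ofReal_mul, Real.mul_self_sqrt (Nat.cast_nonneg n), Complex.ofReal_natCast]

lemma inner_uniformVector (x : EuclideanSpace ℂ (Fin n)) :
    inner ℂ (uniformVector n) x = ((√n : ℝ) : ℂ)⁻¹ * ∑ j, x j := by
  rw [PiLp.inner_apply, Finset.mul_sum]
  simp [uniformVector, mul_comm]

lemma inner_uniformVector_self [NeZero n] :
    inner ℂ (uniformVector n) (uniformVector n) = (1 : ℂ) := by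
  have h0 : (n : ℂ) ≠ 0 := NeZero.ne _
  have h1 : ((√n : ℝ) : ℂ) ≠ 0 := fun h => h0 (by rw [← sqrt_mul_sqrt_natCast, h, zero_mul])
  rw [inner_uniformVector]
  simp only [uniformVector, Finset.sum_const, Finset.card_univ, Fintype.card_fin, nsmul_eq_mul]
  rw [← sqrt_mul_sqrt_natCast]
  field_simp

/-- An orthonormal basis of `ℂⁿ` that starts with the uniform vector. -/
lemma exists_basis_uniformVector [NeZero n] :
    ∃ b : OrthonormalBasis (Fin n) ℂ (EuclideanSpace ℂ (Fin n)), b 0 = uniformVector n := by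
  have hv : Orthonormal ℂ (({0} : Set (Fin n)).domRestrict fun _ => uniformVector n) := by
    rw [orthonormal_iff_ite]
    rintro ⟨i, rfl⟩ ⟨j, rfl⟩
    rw [if_pos rfl]
    exact inner_uniformVector_self
  obtain ⟨b, hb⟩ := hv.exists_orthonormalBasis_extension_of_card_eq (by simp)
  exact ⟨b, hb 0 rfl⟩

lemma sum_eq_zero_of_inner_uniformVector [NeZero n] {v : EuclideanSpace ℂ (Fin n)}
    (h : inner ℂ (uniformVector n) v = 0) : ∑ j, v j = 0 := by
  have h0 : (n : ℂ) ≠ 0 := NeZero.ne _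
  have h1 : ((√n : ℝ) : ℂ) ≠ 0 := fun h => h0 (by rw [← sqrt_mul_sqrt_natCast, h, zero_mul])
  rw [inner_uniformVector] at h
  exact (mul_eq_zero.1 h).resolve_left (inv_ne_zero h1)

lemma inner_eq_zero_of_const {v x : EuclideanSpace ℂ (Fin n)} (hv : ∑ j, v j = 0) {c : ℂ}
    (hx : ∀ j, x j = c) : inner ℂ v x = 0 := by
  simp only [PiLp.inner_apply, hx, RCLike.inner_apply, ← Finset.mul_sum, ← map_sum, hv, map_zero,
    mul_zero]

variable {Q Qs Qp Q' : Set ℝ} {α β : ℝ → ℝ}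

open Classical in
/-- The boundary conditions of the Hamiltonian of `n` channels. -/
def channelBC (n : ℕ) (Q Qs Qp : Set ℝ) (α β : ℝ → ℝ) (q : ℝ) :
    Submodule ℂ (BoundaryValues (EuclideanSpace ℂ (Fin n))) :=
  if q ∈ Q then deltaCoupling n (α q)
  else if q ∈ Qs then deltaPrimeSCoupling n (β q)
  else if q ∈ Qp then deltaPCoupling n (α q)
  else deltaPrimeCoupling n (β q)

lemma mem_channelBC (hQQs : Disjoint Q Qs) (hQQp : Disjoint Q Qp) (hQQ' : Disjoint Q Q')
    (hQsQp : Disjoint Qs Qp) (hQsQ' : Disjoint Qs Q') (hQpQ' : Disjoint Qp Q') {q : ℝ}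
    (hq : q ∈ Q ∪ Qs ∪ Qp ∪ Q') (b : BoundaryValues (EuclideanSpace ℂ (Fin n))) :
    b ∈ channelBC n Q Qs Qp α β q ↔ (q ∈ Q → b ∈ deltaCoupling n (α q)) ∧
      (q ∈ Qs → b ∈ deltaPrimeSCoupling n (β q)) ∧ (q ∈ Qp → b ∈ deltaPCoupling n (α q)) ∧
      (q ∈ Q' → b ∈ deltaPrimeCoupling n (β q)) := by
  rw [disjoint_left] at *
  rcases hq with ((hq | hq) | hq) | hq
  · simp [channelBC, hq, hQQs hq, hQQp hq, hQQ' hq]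
  · have h1 : q ∉ Q := fun h => hQQs h hq
    simp [channelBC, hq, h1, hQsQp hq, hQsQ' hq]
  · have h1 : q ∉ Q := fun h => hQQp h hq
    have h2 : q ∉ Qs := fun h => hQsQp h hq
    simp [channelBC, hq, h1, h2, hQpQ' hq]
  · have h1 : q ∉ Q := fun h => hQQ' h hq
    have h2 : q ∉ Qs := fun h => hQsQ' h hq
    have h3 : q ∉ Qp := fun h => hQpQ' h hq
    simp [channelBC, hq, h1, h2, h3]

lemma isLagrangian_channelBC [NeZero n] (q : ℝ) : IsLagrangian (channelBC n Q Qs Qp α β q) := by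
  unfold channelBC
  split_ifs
  · exact isLagrangian_deltaCoupling _
  · exact isLagrangian_deltaPrimeSCoupling _
  · exact isLagrangian_deltaPCoupling _
  · exact isLagrangian_deltaPrimeCoupling _

/-- The component along the uniform vector is a multiple of the sum over the channels. Adding up `n`
equal values accounts for the strengths divided by `n` in `δ` and `δ'_s`. -/
lemma map_uniformVector_mem_scalarBC [NeZero n] {q : ℝ}
    {b : BoundaryValues (EuclideanSpace ℂ (Fin n))}
    (hb : (q ∈ Q → b ∈ deltaCoupling n (α q)) ∧
      (q ∈ Qs → b ∈ deltaPrimeSCoupling n (β q)) ∧ (q ∈ Qp → b ∈ deltaPCoupling n (α q)) ∧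
      (q ∈ Q' → b ∈ deltaPrimeCoupling n (β q))) :
    mapBoundaryValues (innerSL ℂ (uniformVector n)) b ∈
      scalarBC Q Qs Qp Q' (fun q => α q / n) (fun q => β q / n) q := by
  have h0 : (n : ℂ) ≠ 0 := NeZero.ne _
  obtain ⟨⟨fL, fR⟩, dL, dR⟩ := b
  simp only [mapBoundaryValues, innerSL_apply_apply, inner_uniformVector]
  -- The scalar conditions are homogeneous, so the normalization is irrelevant.
  generalize ((√n : ℝ) : ℂ)⁻¹ = r
  obtain ⟨h1, h2, h3, h4⟩ := hb
  refine ⟨fun h => ?_, fun h => ?_, fun h => ?_, fun h => ?_⟩ <;> push_cast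
  · obtain ⟨c, hc, hs⟩ := h1 h
    have hL : ∀ j, fL j = c := fun j => hc (.inl j)
    have hR : ∀ j, fR j = c := fun j => hc (.inr j)
    simp only [Fintype.sum_sum_type, Γ₂, Sum.elim_inl, Sum.elim_inr, Finset.sum_neg_distrib] at hs
    simp only [hL, hR, Finset.sum_const, Finset.card_univ, Fintype.card_fin, nsmul_eq_mul, true_and]
    field_simp
    linear_combination r * hs
  · obtain ⟨c, hc, hs⟩ := h2 h
    have hL : ∀ j, dL j = -c := fun j => neg_eq_iff_eq_neg.1 (hc (.inl j))
    have hR : ∀ j, dR j = c := fun j => hc (.inr j)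
    simp only [Fintype.sum_sum_type, Γ₁, Sum.elim_inl, Sum.elim_inr] at hs
    simp only [hL, hR, Finset.sum_const, Finset.card_univ, Fintype.card_fin, nsmul_eq_mul]
    refine ⟨by ring, ?_⟩
    field_simp
    linear_combination r * hs
  · obtain ⟨hd, hs⟩ := h3 h
    simp only [Fintype.sum_sum_type, Γ₁, Sum.elim_inl, Sum.elim_inr] at hs
    -- Comparing the left and right halves of the same channel and summing over channels relates the
    -- two sums; with the vanishing total sum this is the scalar condition.
    have hd' := Finset.sum_congr (rfl : (Finset.univ : Finset (Fin n)) = _)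
      fun j _ => hd (.inl j) (.inr j)
    simp only [Γ₁, Γ₂, Sum.elim_inl, Sum.elim_inr, Finset.sum_sub_distrib, ← Finset.mul_sum,
      Finset.sum_neg_distrib] at hd'
    refine ⟨by linear_combination r * hs, ?_⟩
    field_simp at hd' ⊢
    linear_combination -r / 2 * hd' - r * α q / 2 * hs
  · obtain ⟨hd, hs⟩ := h4 h
    simp only [Fintype.sum_sum_type, Γ₂, Sum.elim_inl, Sum.elim_inr, Finset.sum_neg_distrib] at hs
    have hd' := Finset.sum_congr (rfl : (Finset.univ : Finset (Fin n)) = _)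
      fun j _ => hd (.inl j) (.inr j)
    simp only [Γ₁, Γ₂, Sum.elim_inl, Sum.elim_inr, Finset.sum_sub_distrib, ← Finset.mul_sum,
      Finset.sum_neg_distrib] at hd'
    refine ⟨by linear_combination -r * hs, ?_⟩
    field_simp at hd' ⊢
    linear_combination -r / 2 * hd' - r * β q / 2 * hs

/-- A vector of zero sum is orthogonal to constant vectors. In each coupling the combination
required to vanish is, on either side of `q`, independent of the channel. -/
lemma map_mem_separatedBC [NeZero n] {v : EuclideanSpace ℂ (Fin n)} (hv : ∑ j, v j = 0) {q : ℝ}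
    {b : BoundaryValues (EuclideanSpace ℂ (Fin n))}
    (hb : (q ∈ Q → b ∈ deltaCoupling n (α q)) ∧
      (q ∈ Qs → b ∈ deltaPrimeSCoupling n (β q)) ∧ (q ∈ Qp → b ∈ deltaPCoupling n (α q)) ∧
      (q ∈ Q' → b ∈ deltaPrimeCoupling n (β q))) :
    mapBoundaryValues (innerSL ℂ v) b ∈ separatedBC n Q Qs Qp Q' α β q := by
  have h0 : (n : ℂ) ≠ 0 := NeZero.ne _
  obtain ⟨⟨fL, fR⟩, dL, dR⟩ := b
  simp only [mapBoundaryValues, innerSL_apply_apply]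
  obtain ⟨h1, h2, h3, h4⟩ := hb
  have key : ∀ (a a' c : ℂ) (x y : EuclideanSpace ℂ (Fin n)), (∀ j, a * x j + a' * y j = c) →
      a * inner ℂ v x + a' * inner ℂ v y = 0 := fun a a' c x y h => by
    rw [← inner_smul_right, ← inner_smul_right, ← inner_add_right]
    exact inner_eq_zero_of_const hv (c := c) fun j => by simpa using h j
  let i₀ : Fin n := 0
  refine ⟨fun h => ?_, fun h => ?_, fun h => ?_, fun h => ?_⟩
  · obtain ⟨c, hc, hs⟩ := h1 h
    exact ⟨inner_eq_zero_of_const hv fun j => hc (.inl j),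
      inner_eq_zero_of_const hv fun j => hc (.inr j)⟩
  · obtain ⟨c, hc, hs⟩ := h2 h
    exact ⟨inner_eq_zero_of_const hv fun j => neg_eq_iff_eq_neg.1 (hc (.inl j)),
      inner_eq_zero_of_const hv fun j => hc (.inr j)⟩
  · obtain ⟨hd, hs⟩ := h3 h
    simp only [Sum.forall, Γ₁, Γ₂, Sum.elim_inl, Sum.elim_inr] at hd
    constructor
    · refine key _ _ (α q * fL i₀ + 2 * n * dL i₀) _ _ fun j => ?_
      have := (hd.1 j).1 i₀
      field_simp at this
      linear_combination -this
    · rw [sub_eq_add_neg, ← neg_mul]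
      refine key _ _ (α q * fR i₀ - 2 * n * dR i₀) _ _ fun j => ?_
      have := (hd.2 j).2 i₀
      field_simp at this
      linear_combination -this
  · obtain ⟨hd, hs⟩ := h4 h
    simp only [Sum.forall, Γ₁, Γ₂, Sum.elim_inl, Sum.elim_inr] at hd
    constructor
    · refine key _ _ (2 * n * fL i₀ + β q * dL i₀) _ _ fun j => ?_
      have := (hd.1 j).1 i₀
      field_simp at this
      linear_combination this
    · rw [sub_eq_add_neg, ← neg_mul]
      refine key _ _ (2 * n * fR i₀ - β q * dR i₀) _ _ fun j => ?_
      have := (hd.2 j).2 i₀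
      field_simp at this
      linear_combination this

lemma Γ₁_map_alongVector (v : EuclideanSpace ℂ (Fin n)) (z : BoundaryValues ℂ) :
    Γ₁ (mapBoundaryValues (alongVector v) z) =
      Sum.elim (fun j => z.1.1 * v j) (fun j => z.1.2 * v j) := by
  funext s; cases s <;> simp [Γ₁, mapBoundaryValues]

lemma Γ₂_map_alongVector (v : EuclideanSpace ℂ (Fin n)) (z : BoundaryValues ℂ) :
    Γ₂ (mapBoundaryValues (alongVector v) z) =
      Sum.elim (fun j => -(z.2.1 * v j)) (fun j => z.2.2 * v j) := by
  funext s; cases s <;> simp [Γ₂, mapBoundaryValues]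

/-- Along the uniform vector all channels carry the same data, so only the two sides remain to be
compared, and sums over channels multiply by `n`, which cancels the division of the strengths. -/
lemma map_mem_couplings_of_scalarBC [NeZero n] {q : ℝ} {z : BoundaryValues ℂ}
    (hz : z ∈ scalarBC Q Qs Qp Q' (fun q => α q / n) (fun q => β q / n) q) :
    (q ∈ Q → mapBoundaryValues (alongVector (uniformVector n)) z ∈ deltaCoupling n (α q)) ∧
    (q ∈ Qs → mapBoundaryValues (alongVector (uniformVector n)) z ∈ deltaPrimeSCoupling n (β q)) ∧
    (q ∈ Qp → mapBoundaryValues (alongVector (uniformVector n)) z ∈ deltaPCoupling n (α q)) ∧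
    (q ∈ Q' →
      mapBoundaryValues (alongVector (uniformVector n)) z ∈ deltaPrimeCoupling n (β q)) := by
  have h0 : (n : ℂ) ≠ 0 := NeZero.ne _
  obtain ⟨⟨fL, fR⟩, dL, dR⟩ := z
  obtain ⟨h1, h2, h3, h4⟩ := hz
  push_cast at h1 h2 h3 h4
  refine ⟨fun h => ?_, fun h => ?_, fun h => ?_, fun h => ?_⟩
  · obtain ⟨e1, e2⟩ := h1 h
    refine ⟨fR * ((√n : ℝ) : ℂ)⁻¹, ?_, ?_⟩
    · rw [Γ₁_map_alongVector]
      rintro (j | j) <;> simp [uniformVector, e1]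
    · rw [Γ₂_map_alongVector]
      simp only [uniformVector, Fintype.sum_sum_type, Sum.elim_inl, Sum.elim_inr, Finset.sum_const,
        Finset.card_univ, Fintype.card_fin, nsmul_eq_mul]
      field_simp at e2
      linear_combination ((√n : ℝ) : ℂ)⁻¹ * e2
  · obtain ⟨e1, e2⟩ := h2 h
    refine ⟨dR * ((√n : ℝ) : ℂ)⁻¹, ?_, ?_⟩
    · rw [Γ₂_map_alongVector]
      rintro (j | j) <;> simp [uniformVector, eq_neg_of_add_eq_zero_left e1]
    · rw [Γ₁_map_alongVector]
      simp only [uniformVector, Fintype.sum_sum_type, Sum.elim_inl, Sum.elim_inr, Finset.sum_const,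
        Finset.card_univ, Fintype.card_fin, nsmul_eq_mul]
      field_simp at e2
      linear_combination ((√n : ℝ) : ℂ)⁻¹ * e2
  · obtain ⟨e1, e2⟩ := h3 h
    have e3 : dL = α q / n * fR - dR := by linear_combination e2
    refine ⟨?_, ?_⟩
    · rw [Γ₁_map_alongVector, Γ₂_map_alongVector]
      rintro (j | j) (k | k) <;>
        simp only [uniformVector, Sum.elim_inl, Sum.elim_inr, eq_neg_of_add_eq_zero_left e1, e3] <;>
        field_simp <;> ring
    · rw [Γ₁_map_alongVector]
      simp [uniformVector, Fintype.sum_sum_type, eq_neg_of_add_eq_zero_left e1]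
  · obtain ⟨e1, e2⟩ := h4 h
    have e3 : fL = fR - β q / n * dR := by linear_combination -e2
    refine ⟨?_, ?_⟩
    · rw [Γ₁_map_alongVector, Γ₂_map_alongVector]
      rintro (j | j) (k | k) <;>
        simp only [uniformVector, Sum.elim_inl, Sum.elim_inr, e1, e3] <;> field_simp <;> ring
    · rw [Γ₂_map_alongVector]
      simp [uniformVector, Fintype.sum_sum_type, e1]

/-- The zero sum of `v` makes both total sums vanish, so the common value in `δ` and `δ'_s` is `0`.
The Robin conditions say that `Γ₂` is `α / 2n` times `Γ₁`, respectively `Γ₁` is `β / 2n` times `Γ₂`,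
in every half-channel, which implies the difference conditions. -/
lemma map_mem_couplings_of_separatedBC [NeZero n] {v : EuclideanSpace ℂ (Fin n)}
    (hv : ∑ j, v j = 0) {q : ℝ} {z : BoundaryValues ℂ}
    (hz : z ∈ separatedBC n Q Qs Qp Q' α β q) :
    (q ∈ Q → mapBoundaryValues (alongVector v) z ∈ deltaCoupling n (α q)) ∧
    (q ∈ Qs → mapBoundaryValues (alongVector v) z ∈ deltaPrimeSCoupling n (β q)) ∧
    (q ∈ Qp → mapBoundaryValues (alongVector v) z ∈ deltaPCoupling n (α q)) ∧
    (q ∈ Q' → mapBoundaryValues (alongVector v) z ∈ deltaPrimeCoupling n (β q)) := by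
  have h0 : (n : ℂ) ≠ 0 := NeZero.ne _
  have hs₁ : ∑ s, Γ₁ (mapBoundaryValues (alongVector v) z) s = 0 := by
    simp [Γ₁_map_alongVector, Fintype.sum_sum_type, ← Finset.mul_sum, hv]
  have hs₂ : ∑ s, Γ₂ (mapBoundaryValues (alongVector v) z) s = 0 := by
    simp [Γ₂_map_alongVector, Fintype.sum_sum_type, ← Finset.mul_sum, hv]
  obtain ⟨⟨fL, fR⟩, dL, dR⟩ := z
  obtain ⟨h1, h2, h3, h4⟩ := hz
  refine ⟨fun h => ?_, fun h => ?_, fun h => ?_, fun h => ?_⟩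
  · obtain ⟨e1, e2⟩ := h1 h
    refine ⟨0, ?_, by rw [hs₂, mul_zero]⟩
    rw [Γ₁_map_alongVector]
    rintro (j | j) <;> simp [e1, e2]
  · obtain ⟨e1, e2⟩ := h2 h
    refine ⟨0, ?_, by rw [hs₁, mul_zero]⟩
    rw [Γ₂_map_alongVector]
    rintro (j | j) <;> simp [e1, e2]
  · obtain ⟨e1, e2⟩ := h3 h
    have e3 : dL = -(α q / (2 * n)) * fL := by field_simp; linear_combination e1
    have e4 : dR = α q / (2 * n) * fR := by field_simp; linear_combination -e2
    refine ⟨?_, hs₁⟩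
    rw [Γ₁_map_alongVector, Γ₂_map_alongVector]
    rintro (j | j) (k | k) <;> simp only [Sum.elim_inl, Sum.elim_inr, e3, e4] <;> ring
  · obtain ⟨e1, e2⟩ := h4 h
    have e3 : fL = -(β q / (2 * n)) * dL := by field_simp; linear_combination e1
    have e4 : fR = β q / (2 * n) * dR := by field_simp; linear_combination e2
    refine ⟨?_, hs₂⟩
    rw [Γ₁_map_alongVector, Γ₂_map_alongVector]
    rintro (j | j) (k | k) <;> simp only [Sum.elim_inl, Sum.elim_inr, e3, e4] <;> ring

end Decomposition

end CoupledChannels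

end

open CoupledChannels

theorem mainTheorem3 (n : ℕ) (hn : 1 < n) (Q Qs Qp Q' : Set ℝ)
    (hQQs : Disjoint Q Qs) (hQQp : Disjoint Q Qp) (hQQ' : Disjoint Q Q')
    (hQsQp : Disjoint Qs Qp) (hQsQ' : Disjoint Qs Q') (hQpQ' : Disjoint Qp Q')
    (hP : UniformlyDiscrete (Q ∪ Qs ∪ Qp ∪ Q')) (α β : ℝ → ℝ) :
    IsSelfAdjoint (channelHamiltonian n Q Qs Qp Q' α β) ∧
    IsSelfAdjoint (scalarHamiltonian Q Qs Qp Q' (fun q => α q / n) (fun q => β q / n)) ∧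
    IsSelfAdjoint (separatedHamiltonian n Q Qs Qp Q' α β) ∧
    UnitarilyEquivalent (channelHamiltonian n Q Qs Qp Q' α β)
      (directSum fun k : Fin n =>
        if (k : ℕ) = 0 then
          scalarHamiltonian Q Qs Qp Q' (fun q => α q / n) (fun q => β q / n)
        else separatedHamiltonian n Q Qs Qp Q' α β) := by
  have : NeZero n := ⟨by omega⟩
  refine ⟨isSelfAdjoint_pointInteraction hP fun q _ => isLagrangian_channelBC q,
    isSelfAdjoint_pointInteraction hP fun q hq =>
      isLagrangian_scalarBC hQQs hQQp hQQ' hQsQp hQsQ' hQpQ' _ _ hq,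
    isSelfAdjoint_pointInteraction hP fun q hq =>
      isLagrangian_separatedBC (by omega) hQQs hQQp hQQ' hQsQp hQsQ' hQpQ' _ _ hq, ?_⟩
  obtain ⟨b, hb⟩ := exists_basis_uniformVector (n := n)
  -- The remaining basis vectors are orthogonal to the uniform vector, that is, have zero sum.
  have hsum : ∀ k : Fin n, (k : ℕ) ≠ 0 → ∑ j, b k j = 0 := fun k hk =>
    sum_eq_zero_of_inner_uniformVector (by
      rw [← hb, b.inner_eq_zero fun h => hk (by rw [← h]; simp)])
  have hzero : ∀ k : Fin n, (k : ℕ) = 0 → b k = uniformVector n := fun k hk => by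
    rw [← hb]
    congr 1
    exact Fin.ext (by simpa using hk)
  have key := unitarilyEquivalent_directSum hP b
    (BC := channelBC n Q Qs Qp α β)
    (BC' := fun k => if (k : ℕ) = 0 then
      scalarBC Q Qs Qp Q' (fun q => α q / n) (fun q => β q / n) else separatedBC n Q Qs Qp Q' α β)
    (fun k q hq c hc => by
      have hc' := (mem_channelBC hQQs hQQp hQQ' hQsQp hQsQ' hQpQ' hq c).1 hc
      split_ifs with hk
      · rw [hzero k hk]
        exact map_uniformVector_mem_scalarBC hc'
      · exact map_mem_separatedBC (hsum k hk) hc')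
    (fun k q hq c hc => by
      refine (mem_channelBC hQQs hQQp hQQ' hQsQp hQsQ' hQpQ' hq _).2 ?_
      split_ifs at hc with hk
      · rw [hzero k hk]
        exact map_mem_couplings_of_scalarBC hc
      · exact map_mem_couplings_of_separatedBC (hsum k hk) hc)
  -- The case distinction is moved from the operators to their boundary conditions.
  have hfun : (fun k : Fin n => if (k : ℕ) = 0 then
        scalarHamiltonian Q Qs Qp Q' (fun q => α q / n) (fun q => β q / n)
      else separatedHamiltonian n Q Qs Qp Q' α β) =
      fun k : Fin n => pointInteraction (Q ∪ Qs ∪ Qp ∪ Q') (if (k : ℕ) = 0 then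
        scalarBC Q Qs Qp Q' (fun q => α q / n) (fun q => β q / n)
      else separatedBC n Q Qs Qp Q' α β) := by
    funext k
    split_ifs <;> rfl
  rw [hfun]
  exact key
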